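/- Say that a finite simple graph $G$ is an $(n,d,\lambda)$-graph if it has $n$ vertices, is $d$-regular, and, writing $\lambda_1\ge\lambda_2\ge\dots\ge\lambda_n$ for the eigenvalues of its adjacency matrix listed with multiplicity, satisfies $|\lambda_i|\le\lambda$ for all $2\le i\le n$. The square $G^2$ of $G$ is the graph obtained from $G$ by adding an edge between every pair of vertices at distance $2$ in $G$. For every $\Delta\in\mathbb N$ there are a constant $C>0$ and an integer $d_0$, both depending only on $\Delta$, such that for every integer $d\ge d_0$, every $n\in\mathbb N$ and every $\lambda>0$, the following holds. If $G$ is an $(n,d,\lambda)$-graph with $d/\lambda\ge C$, then $G^2$ contains a copy of every $n$-vertex tree with maximum degree at most $\Delta$ (that is, every such tree is isomorphic to a subgraph of $G^2$). -/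

import Mathlib

/-- `adjEigenvalue G i` is the `i`-th eigenvalue (counted from `i = 0`) of the adjacency matrix
of `G`, when the eigenvalues are listed with multiplicity in decreasing order
`λ₁ ≥ λ₂ ≥ ⋯ ≥ λₙ`; so `i = 0` is the largest one, which is `d` when `G` is `d`-regular. -/
noncomputable def adjEigenvalue {V : Type*} [Fintype V] [DecidableEq V]
    (G : SimpleGraph V) [DecidableRel G.Adj] (i : Fin (Fintype.card V)) : ℝ :=
  (SimpleGraph.isHermitian_adjMatrix ℝ G).eigenvalues₀ i

/-- `G` is an `(n, d, λ)`-graph: it has `n` vertices, is `d`-regular, and all its non-trivial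
eigenvalues `λ₂, …, λₙ` are at most `λ` in absolute value. -/
structure IsNDLambdaGraph {V : Type*} [Fintype V] [DecidableEq V]
    (G : SimpleGraph V) [DecidableRel G.Adj] (n d : ℕ) (lam : ℝ) : Prop where
  card_eq : Fintype.card V = n
  regular : G.IsRegularOfDegree d
  abs_eigenvalue_le : ∀ i : Fin (Fintype.card V), 0 < i.val → |adjEigenvalue G i| ≤ lam

/-- The square of `G`: the graph obtained from `G` by adding an edge between every pair of
vertices at distance `2` in `G`. -/
def graphSquare {V : Type*} (G : SimpleGraph V) : SimpleGraph V where
  Adj u v := G.Adj u v ∨ G.dist u v = 2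
  symm := ⟨by
    rintro u v (h | h)
    · exact Or.inl h.symm
    · exact Or.inr (by rw [SimpleGraph.dist_comm]; exact h)⟩
  loopless := ⟨by
    rintro u (h | h)
    · exact G.irrefl h
    · simp at h⟩

/-! It suffices to find a rooted tree T' on the vertex set of T such that every edge of T joins
vertices at distance at most 2 in T', and to embed T' as a spanning tree of G itself; squaring then
recovers T. The freedom in choosing T' is spent on gadgets that make a spanning embedding possible.

A gadget of scale a is a leaf of T' whose first 2a + 1 ancestors lie in a pendant branch. To build
one, take a connected cluster of T with a single exit vertex p_0 and topmost vertex p_q, and reorder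
the path between them as p_q, p_0, p_{q-1}, p_1, p_{q-2}, …. The exit becomes a child of the top,
old neighbours stay within distance 2, and all other vertices of the cluster now hang in branches
without exits; a vertex far from both top and exit supplies the leaf (`exists_zigzag`,
`exists_clusterGadget`). Cutting T greedily yields linearly many clusters, and at least half of them
have at most one exit, since each exit leads to the top of another cluster (`exists_clusters`).
Disjoint gadgets of all scales fit, in geometrically decreasing numbers (`exists_all_scales`).

On the side of G, the mixing lemma gives an edge between any two sets of size m, where m is a small
constant multiple of n. Repeated balanced splitting of the neighbourhoods gives a sparse set D such
that every vertex has a constant proportion of its neighbours in D and outside D, so small sets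
expand into both. Trees are embedded by the method of Friedman and Pippenger: the invariant
`Extendable` allows attaching leaves one by one, and attached vertices may be deleted again
(`Grown.rollback`).

With D reserved, T' minus all branches is embedded first. Then parents of gadget leaves are mapped
onto D: grow b-ary trees of depth a from uncovered vertices of D and from attachment points of
unused gadgets of scale a, find an edge between the two sets of ends, keep the resulting path of
length 2a + 1 and delete the rest. This works until fewer than m / b ^ a vertices of D are
uncovered, when scale a + 1 takes over (`exists_full`). Next everything except the used leaves is
embedded. The used leaves are placed by a perfect matching between D and the remaining |D| vertices:
Hall's condition comes from extendability for small sets, and from the edges between large sets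
together with expansion into D for large ones (`exists_spanning_embedding`). -/

/-! ### Spectral bounds and the expander mixing lemma -/

open Finset Matrix in
/-- The quadratic form of a Hermitian real matrix, expanded in its eigenbasis. -/
theorem Matrix.IsHermitian.dotProduct_mulVec_eq_sum {V : Type*} [Fintype V] [DecidableEq V]
    {A : Matrix V V ℝ} (hA : A.IsHermitian) (f g : V → ℝ) :
    f ⬝ᵥ (A *ᵥ g) = ∑ i, hA.eigenvalues i *
      ((f ⬝ᵥ (hA.eigenvectorBasis i).ofLp) * (g ⬝ᵥ (hA.eigenvectorBasis i).ofLp)) := by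
  have h1 := OrthonormalBasis.sum_inner_mul_inner hA.eigenvectorBasis
    (WithLp.toLp 2 f) (WithLp.toLp 2 (A *ᵥ g))
  simp only [EuclideanSpace.inner_eq_star_dotProduct, star_trivial] at h1
  rw [dotProduct_comm, ← h1]
  refine sum_congr rfl fun i _ => ?_
  have h2 : A *ᵥ g ⬝ᵥ (hA.eigenvectorBasis i).ofLp
      = hA.eigenvalues i * (g ⬝ᵥ (hA.eigenvectorBasis i).ofLp) := by
    have hT : Aᵀ = A := by simpa [Matrix.IsHermitian, conjTranspose] using hA
    rw [dotProduct_comm, dotProduct_mulVec, ← mulVec_transpose, hT, hA.mulVec_eigenvectorBasis,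
      dotProduct_comm, dotProduct_smul, smul_eq_mul]
  rw [h2, dotProduct_comm f]
  ring

open Finset Matrix in
/-- Parseval's identity in an orthonormal basis of `EuclideanSpace ℝ V`, in dot-product form. -/
theorem OrthonormalBasis.sum_dotProduct_sq {V : Type*} [Fintype V]
    (b : OrthonormalBasis V ℝ (EuclideanSpace ℝ V)) (f : V → ℝ) :
    ∑ i, (f ⬝ᵥ (b i).ofLp) ^ 2 = f ⬝ᵥ f := by
  have h1 := OrthonormalBasis.sum_inner_mul_inner b (WithLp.toLp 2 f) (WithLp.toLp 2 f)
  simp only [EuclideanSpace.inner_eq_star_dotProduct, star_trivial] at h1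
  rw [← h1]
  refine sum_congr rfl fun i _ => ?_
  rw [dotProduct_comm f]; ring

open Finset Matrix in
/-- On vectors orthogonal to the constants, the adjacency form of an `(n, d, λ)`-graph is bounded
by `λ`. -/
theorem IsNDLambdaGraph.abs_dotProduct_mulVec_le {V : Type*} [Fintype V] [DecidableEq V]
    {G : SimpleGraph V} [DecidableRel G.Adj] {n d : ℕ} {lam : ℝ} (h : IsNDLambdaGraph G n d lam)
    (hlam : lam < d) (hlam0 : 0 ≤ lam) (f g : V → ℝ) (hg : ∑ v, g v = 0) :
    |f ⬝ᵥ (G.adjMatrix ℝ *ᵥ g)| ≤ lam * (√(f ⬝ᵥ f) * √(g ⬝ᵥ g)) := by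
  set hA := SimpleGraph.isHermitian_adjMatrix ℝ G with hAdef
  set b := hA.eigenvectorBasis with hb
  rw [hA.dotProduct_mulVec_eq_sum]
  -- The constant vector is an eigenvector for d, hence orthogonal to every eigenvector with another
  -- eigenvalue.
  have hone : ∀ i : V, hA.eigenvalues i ≠ d → (∑ v, (b i).ofLp v) = 0 := by
    intro i hi
    have h1 := hA.mulVec_eigenvectorBasis i
    have h2 : (fun _ => (1 : ℝ)) ⬝ᵥ (G.adjMatrix ℝ *ᵥ (b i).ofLp)
        = d * ∑ v, (b i).ofLp v := by
      have hT : (G.adjMatrix ℝ)ᵀ = G.adjMatrix ℝ := G.transpose_adjMatrix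
      rw [dotProduct_mulVec, ← mulVec_transpose, hT]
      have : G.adjMatrix ℝ *ᵥ (fun _ => (1 : ℝ)) = fun _ => (d : ℝ) := by
        ext v
        have := SimpleGraph.adjMatrix_mulVec_const_apply_of_regular (a := (1:ℝ)) h.regular (v := v)
        simpa [Function.const_def] using this
      rw [this]
      simp [dotProduct, mul_sum]
    rw [h1] at h2
    simp only [dotProduct, one_mul, Pi.smul_apply, smul_eq_mul, ← mul_sum] at h2
    have h3 : (hA.eigenvalues i - d) * ∑ v, (b i).ofLp v = 0 := by linarith
    rcases mul_eq_zero.1 h3 with h4 | h4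
    · exact absurd (by linarith) hi
    · exact h4
  have key : ∀ i : V, |hA.eigenvalues i * ((f ⬝ᵥ (b i).ofLp) * (g ⬝ᵥ (b i).ofLp))|
      ≤ lam * (|f ⬝ᵥ (b i).ofLp| * |g ⬝ᵥ (b i).ofLp|) := by
    intro i
    set e : Fin (Fintype.card V) ≃ V := Fintype.equivOfCardEq (Fintype.card_fin _) with he
    have heig : ∀ j, hA.eigenvalues j = hA.eigenvalues₀ (e.symm j) := fun j => rfl
    have hsmall : ∀ j, 0 < (e.symm j).val → |hA.eigenvalues j| ≤ lam := by
      intro j hj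
      rw [heig]; exact h.abs_eigenvalue_le _ hj
    by_cases hi : 0 < (e.symm i).val
    · rw [abs_mul, abs_mul]
      exact mul_le_mul_of_nonneg_right (hsmall i hi) (by positivity)
    · have hz : g ⬝ᵥ (b i).ofLp = 0 := by
        -- All other basis vectors have eigenvalue of modulus at most `lam < d`, so they are
        -- orthogonal to the constants, and the constant vector is a multiple of the top eigenvector
        -- `b i`. The spectral gap thus replaces any appeal to connectedness.
        have hcst : ∀ v, (∑ w, (b i).ofLp w) * (b i).ofLp v = 1 := by
          intro v
          have h1 := OrthonormalBasis.sum_repr b (WithLp.toLp 2 (fun _ : V => (1:ℝ)))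
          have h2 := congrArg (fun x : EuclideanSpace ℝ V => x.ofLp v) h1
          simp only [WithLp.ofLp_sum, WithLp.ofLp_smul, Finset.sum_apply, Pi.smul_apply,
            smul_eq_mul, OrthonormalBasis.repr_apply_apply,
            EuclideanSpace.inner_eq_star_dotProduct, star_trivial] at h2
          simp only [dotProduct, one_mul] at h2
          rw [← h2]
          symm
          apply Finset.sum_eq_single i
          · intro j _ hj
            have hjpos : 0 < (e.symm j).val := by
              rcases Nat.eq_zero_or_pos (e.symm j).val with h0 | h0
              · exfalso; apply hj
                apply e.symm.injective
                apply Fin.ext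
                omega
              · exact h0
            have hne : hA.eigenvalues j ≠ d := by
              intro hd
              have := hsmall j hjpos
              rw [hd, abs_of_nonneg (by positivity)] at this
              linarith
            have := hone j hne
            simp [this]
          · simp
        have h5 : (∑ w, (b i).ofLp w) * (g ⬝ᵥ (b i).ofLp) = 0 := by
          rw [dotProduct, mul_sum]
          rw [← hg]
          refine sum_congr rfl fun v _ => ?_
          have := hcst v
          calc _ = g v * ((∑ w, (b i).ofLp w) * (b i).ofLp v) := by ring
            _ = g v := by rw [this, mul_one]
        rcases mul_eq_zero.1 h5 with h6 | h6
        · have := hcst i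
          rw [h6] at this; simp at this
        · exact h6
      rw [hz]; simp
  calc |∑ i, hA.eigenvalues i * ((f ⬝ᵥ (b i).ofLp) * (g ⬝ᵥ (b i).ofLp))|
      ≤ ∑ i, |hA.eigenvalues i * ((f ⬝ᵥ (b i).ofLp) * (g ⬝ᵥ (b i).ofLp))| :=
        abs_sum_le_sum_abs _ _
    _ ≤ ∑ i, lam * (|f ⬝ᵥ (b i).ofLp| * |g ⬝ᵥ (b i).ofLp|) := sum_le_sum fun i _ => key i
    _ = lam * ∑ i, |f ⬝ᵥ (b i).ofLp| * |g ⬝ᵥ (b i).ofLp| := by rw [mul_sum]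
    _ ≤ lam * (√(∑ i, |f ⬝ᵥ (b i).ofLp| ^ 2) * √(∑ i, |g ⬝ᵥ (b i).ofLp| ^ 2)) :=
        mul_le_mul_of_nonneg_left (Real.sum_mul_le_sqrt_mul_sqrt _ _ _) hlam0
    _ = _ := by simp only [sq_abs, OrthonormalBasis.sum_dotProduct_sq]

open Finset Matrix in
/-- The expander mixing lemma. -/
theorem IsNDLambdaGraph.mixing {V : Type*} [Fintype V] [DecidableEq V]
    {G : SimpleGraph V} [DecidableRel G.Adj] {n d : ℕ} {lam : ℝ} (h : IsNDLambdaGraph G n d lam)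
    (hlam : lam < d) (hlam0 : 0 ≤ lam) (A B : Finset V) :
    |(∑ a ∈ A, (#(G.neighborFinset a ∩ B) : ℝ)) - d * #A * #B / n| ≤ lam * √(#A * #B) := by
  rcases isEmpty_or_nonempty V with hV | hV
  · have hA : A = ∅ := Finset.eq_empty_of_isEmpty A
    subst hA; simp
  have hn : (0 : ℝ) < n := by
    rw [← h.card_eq]; exact_mod_cast Fintype.card_pos
  set f : V → ℝ := fun v => if v ∈ A then 1 else 0 with hf
  set u : V → ℝ := fun v => if v ∈ B then 1 else 0 with hu
  set g : V → ℝ := fun v => u v - #B / n with hgdef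
  have hsumu : ∑ v, u v = #B := by simp [hu]
  have hg : ∑ v, g v = 0 := by
    simp only [hgdef, sum_sub_distrib, hsumu, sum_const, card_univ, h.card_eq, nsmul_eq_mul]
    field_simp; ring
  have hmain := h.abs_dotProduct_mulVec_le hlam hlam0 f g hg
  have hff : f ⬝ᵥ f = #A := by simp [dotProduct, hf]
  have hgg : g ⬝ᵥ g ≤ #B := by
    have h1 : g ⬝ᵥ g = ∑ v, (u v * u v - 2 * (#B / n) * u v + (#B / n) ^ 2) :=
      sum_congr rfl fun v _ => by simp only [hgdef]; ring
    have h2 : ∑ v, u v * u v = #B := by simp [hu]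
    rw [h1, sum_add_distrib, sum_sub_distrib, h2, ← mul_sum, hsumu]
    simp only [sum_const, card_univ, h.card_eq, nsmul_eq_mul]
    have : (n : ℝ) * ((#B : ℝ) / n) ^ 2 = #B / n * #B := by field_simp
    rw [this]
    have : (0 : ℝ) ≤ #B / n * #B := by positivity
    linarith
  have hform : f ⬝ᵥ (G.adjMatrix ℝ *ᵥ g)
      = (∑ a ∈ A, (#(G.neighborFinset a ∩ B) : ℝ)) - d * #A * #B / n := by
    have h1 : ∀ v, (G.adjMatrix ℝ *ᵥ g) v = #(G.neighborFinset v ∩ B) - d * (#B / n) := by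
      intro v
      rw [SimpleGraph.adjMatrix_mulVec_apply]
      simp only [hgdef, sum_sub_distrib, sum_const, nsmul_eq_mul, SimpleGraph.card_neighborFinset_eq_degree,
        h.regular.degree_eq v]
      congr 1
      simp [hu]
    simp only [dotProduct, h1, hf, ite_mul, one_mul, zero_mul, sum_ite_mem, univ_inter,
      sum_sub_distrib, sum_const, nsmul_eq_mul]
    ring
  rw [hform, hff] at hmain
  refine hmain.trans (mul_le_mul_of_nonneg_left ?_ hlam0)
  rw [← Real.sqrt_mul (by positivity)]
  exact Real.sqrt_le_sqrt (mul_le_mul_of_nonneg_left hgg (by positivity))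

/-! ### Balanced splittings and a sparse dominating set -/

open Finset in
/-- The subsets of `P` that split every member of the family `S` contained in `P` into two parts of
size at least `r`. -/
noncomputable def goodSplits {I V : Type*} [DecidableEq V] (S : I → Finset V) (r : ℕ)
    (P : Finset V) : Finset (Finset V) := by
  classical
  exact P.powerset.filter fun D => ∀ i, S i ⊆ P → r ≤ #(S i ∩ D) ∧ r ≤ #(S i \ D)

open Finset in
theorem mem_goodSplits {I V : Type*} [DecidableEq V] {S : I → Finset V} {r : ℕ}
    {P D : Finset V} : D ∈ goodSplits S r P ↔
      D ⊆ P ∧ ∀ i, S i ⊆ P → r ≤ #(S i ∩ D) ∧ r ≤ #(S i \ D) := by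
  simp [goodSplits]

open Finset in
/-- A set of size `s` has at most `1.4 ^ s` subsets of size less than `s / 10`. -/
theorem card_small_subsets_le {V : Type*} (T : Finset V) (r : ℕ) (hr : 10 * r ≤ #T) :
    (#(T.powerset.filter fun B => #B < r) : ℝ) ≤ (1.4 : ℝ) ^ #T := by
  set s := #T with hs
  -- Exponential weights: with weight 9 ^ (s - #B), all subsets together weigh 10 ^ s, while each
  -- small one weighs at least 9 ^ (s - r).
  have h1 : (#(T.powerset.filter fun B => #B < r) : ℝ) * 9 ^ (s - r) ≤ 10 ^ s := by
    have h2 : ∑ B ∈ T.powerset, (1 : ℝ) ^ #B * 9 ^ (s - #B) = (1 + 9) ^ s :=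
      Finset.sum_pow_mul_eq_add_pow 1 9 T
    calc (#(T.powerset.filter fun B => #B < r) : ℝ) * 9 ^ (s - r)
        = ∑ B ∈ T.powerset.filter (fun B => #B < r), (9 : ℝ) ^ (s - r) := by
          rw [sum_const, nsmul_eq_mul]
      _ ≤ ∑ B ∈ T.powerset.filter (fun B => #B < r), (1 : ℝ) ^ #B * 9 ^ (s - #B) := by
          refine sum_le_sum fun B hB => ?_
          rw [mem_filter] at hB
          rw [one_pow, one_mul]
          exact pow_le_pow_right₀ (by norm_num) (by omega)
      _ ≤ ∑ B ∈ T.powerset, (1 : ℝ) ^ #B * 9 ^ (s - #B) :=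
          sum_le_sum_of_subset_of_nonneg (filter_subset _ _) fun _ _ _ => by positivity
      _ = 10 ^ s := by rw [h2]; norm_num
  -- After taking tenth powers this is 10 ^ 10 ≤ 1.4 ^ 10 * 9 ^ 9, combined with 10 * r ≤ s.
  have h3 : (10 : ℝ) ^ s ≤ 1.4 ^ s * 9 ^ (s - r) := by
    have h4 : ((10 : ℝ) ^ s) ^ 10 ≤ (1.4 ^ s * 9 ^ (s - r)) ^ 10 := by
      calc ((10 : ℝ) ^ s) ^ 10 = (10 ^ 10) ^ s := by rw [← pow_mul, ← pow_mul, mul_comm]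
        _ ≤ (1.4 ^ 10 * 9 ^ 9) ^ s := pow_le_pow_left₀ (by norm_num) (by norm_num) _
        _ = (1.4 ^ s) ^ 10 * 9 ^ (9 * s) := by
            rw [mul_pow, ← pow_mul, ← pow_mul, ← pow_mul, mul_comm 10 s]
        _ ≤ (1.4 ^ s) ^ 10 * 9 ^ ((s - r) * 10) :=
            mul_le_mul_of_nonneg_left (pow_le_pow_right₀ (by norm_num) (by omega)) (by positivity)
        _ = (1.4 ^ s * 9 ^ (s - r)) ^ 10 := by rw [mul_pow, ← pow_mul (9 : ℝ)]
    exact le_of_pow_le_pow_left₀ (by norm_num) (by positivity) h4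
  exact le_of_mul_le_mul_right (h1.trans h3) (by positivity)

open Finset in
-- Complementation exchanges the two ways of being unbalanced, whence the factor 2.
theorem card_bad_subsets_le {V : Type*} [DecidableEq V] (T : Finset V) (r : ℕ)
    (hr : 10 * r ≤ #T) :
    (#(T.powerset.filter fun B => ¬(r ≤ #B ∧ r ≤ #(T \ B))) : ℝ) ≤ 2 * (1.4 : ℝ) ^ #T := by
  have h1 : (T.powerset.filter fun B => ¬(r ≤ #B ∧ r ≤ #(T \ B)))
      ⊆ (T.powerset.filter fun B => #B < r) ∪
        (T.powerset.filter fun B => #B < r).image (fun B => T \ B) := by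
    intro B hB
    rw [mem_filter, mem_powerset] at hB
    rw [mem_union, mem_image]
    by_cases h : #B < r
    · left; simp [hB.1, h]
    · right
      refine ⟨T \ B, ?_, ?_⟩
      · rw [mem_filter, mem_powerset]
        refine ⟨sdiff_subset, ?_⟩
        by_contra hc
        exact hB.2 ⟨by omega, by omega⟩
      · rw [Finset.sdiff_sdiff_eq_self hB.1]
  have h2 := (card_le_card h1).trans (card_union_le _ _)
  have h3 : #((T.powerset.filter fun B => #B < r).image (fun B => T \ B))
      ≤ #(T.powerset.filter fun B => #B < r) := card_image_le
  have h4 := card_small_subsets_le T r hr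
  have h5 : (#(T.powerset.filter fun B => ¬(r ≤ #B ∧ r ≤ #(T \ B))) : ℝ)
      ≤ #(T.powerset.filter fun B => #B < r) + #(T.powerset.filter fun B => #B < r) := by
    exact_mod_cast h2.trans (by omega)
  linarith

open Finset in
/-- Rosenfeld's counting argument: the number of good splits grows by a factor `1.9` with every
new element. -/
theorem card_goodSplits_insert {I V : Type*} [Fintype I] [DecidableEq V] (S : I → Finset V)
    (r s t : ℕ) (hs : ∀ i, #(S i) = s) (hr : 10 * r ≤ s)
    (ht : ∀ x, #{i | x ∈ S i} ≤ t) (hst : 38 * t * (1.4 : ℝ) ^ s ≤ 1.9 ^ s) :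
    ∀ (N : ℕ) (P : Finset V) (x : V), #P = N → x ∉ P →
      1.9 * (#(goodSplits S r P) : ℝ) ≤ #(goodSplits S r (insert x P)) := by
  classical
  intro N
  induction N using Nat.strong_induction_on with
  | _ N ih =>
  intro P x hPN hx
  -- growth from smaller sets
  have hgrow : ∀ (Q R : Finset V), Disjoint Q R → Q ∪ R ⊆ P →
      (1.9 : ℝ) ^ #R * #(goodSplits S r Q) ≤ #(goodSplits S r (Q ∪ R)) := by
    intro Q R
    induction R using Finset.induction_on with
    | empty => intro _ _; simp
    | insert y R hy ihR =>
      intro hdis hsub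
      rw [disjoint_insert_right] at hdis
      have hsub' : Q ∪ R ⊆ P := (union_subset_union_right (subset_insert _ _)).trans hsub
      have h1 := ihR hdis.2 hsub'
      have hyQ : y ∉ Q ∪ R := by simp [hdis.1, hy]
      have hlt : #(Q ∪ R) < N := by
        rw [← hPN]
        refine card_lt_card ⟨hsub', fun hcon => hyQ (hcon (hsub ?_))⟩
        simp
      have h2 := ih _ hlt (Q ∪ R) y rfl hyQ
      rw [union_insert, card_insert_of_notMem hy, pow_succ]
      nlinarith
  -- The candidates: each good split of `P`, with and without `x`. A candidate can fail only at a
  -- set that contains `x` and is completed by it.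
  set 𝒜 := (goodSplits S r P) ∪ (goodSplits S r P).image (insert x) with h𝒜
  have hsubP : ∀ D ∈ goodSplits S r P, x ∉ D := fun D hD hxD =>
    hx ((mem_goodSplits.1 hD).1 hxD)
  have hcard𝒜 : #𝒜 = 2 * #(goodSplits S r P) := by
    rw [h𝒜, card_union_of_disjoint, card_image_of_injOn]
    · ring
    · intro D hD D' hD' hDD
      have := congrArg (fun E => E.erase x) hDD
      simpa [erase_insert (hsubP D hD), erase_insert (hsubP D' hD')] using this
    · rw [disjoint_left]
      intro D hD hD'
      obtain ⟨E, _, rfl⟩ := mem_image.1 hD'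
      exact hsubP _ hD (mem_insert_self _ _)
  have h𝒜mem : ∀ D ∈ 𝒜, D ⊆ insert x P ∧ D.erase x ∈ goodSplits S r P := by
    intro D hD
    rcases mem_union.1 hD with h | h
    · exact ⟨(mem_goodSplits.1 h).1.trans (subset_insert _ _), by
        rwa [erase_eq_of_notMem (hsubP D h)]⟩
    · obtain ⟨E, hE, rfl⟩ := mem_image.1 h
      exact ⟨insert_subset_insert _ (mem_goodSplits.1 hE).1, by rwa [erase_insert (hsubP E hE)]⟩
  have hse : ∀ T D : Finset V, x ∉ T → T \ D.erase x = T \ D := by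
    intro T D hxT
    ext y
    simp only [mem_sdiff, mem_erase, not_and]
    exact ⟨fun h => ⟨h.1, h.2 fun e => hxT (e ▸ h.1)⟩, fun h => ⟨h.1, fun _ => h.2⟩⟩
  set J : Finset I := {i | x ∈ S i ∧ S i ⊆ insert x P} with hJ
  have hJt : #J ≤ t := (card_le_card (by intro i; simp +contextual [hJ])).trans (ht x)
  set bad : I → Finset (Finset V) := fun i =>
    𝒜.filter fun D => ¬(r ≤ #(S i ∩ D) ∧ r ≤ #(S i \ D)) with hbad
  have hcover : 𝒜 ⊆ goodSplits S r (insert x P) ∪ J.biUnion bad := by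
    intro D hD
    by_cases hDb : D ∈ J.biUnion bad
    · exact mem_union_right _ hDb
    · refine mem_union_left _ (mem_goodSplits.2 ⟨(h𝒜mem D hD).1, fun i hi => ?_⟩)
      by_cases hxi : x ∈ S i
      · by_contra hcon
        exact hDb (mem_biUnion.2 ⟨i, by simp [hJ, hxi, hi], by simp only [hbad, mem_filter]; exact ⟨hD, hcon⟩⟩)
      · have hiP : S i ⊆ P := fun y hy => by
          rcases mem_insert.1 (hi hy) with rfl | h
          · exact absurd hy hxi
          · exact h
        have := (mem_goodSplits.1 (h𝒜mem D hD).2).2 i hiP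
        rwa [inter_erase, erase_eq_of_notMem (by simp [hxi]), hse _ _ hxi] at this
  have hbadcard : ∀ i ∈ J, (#(bad i) : ℝ) * 1.9 ^ s ≤
      1.9 * (2 * 1.4 ^ s) * #(goodSplits S r P) := by
    intro i hi
    obtain ⟨hxi, hiP⟩ := (by simpa [hJ] using hi : x ∈ S i ∧ S i ⊆ insert x P)
    -- A bad candidate is determined by its trace on `S i`, which is unbalanced, and its trace
    -- outside, which is a good split of `P \ S i`.
    have hinj : #(bad i) ≤ #(((S i).powerset.filter fun B => ¬(r ≤ #B ∧ r ≤ #(S i \ B))) ×ˢ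
        goodSplits S r (P \ S i)) := by
      refine card_le_card_of_injOn (fun D => (S i ∩ D, D \ S i)) ?_ ?_
      · intro D hD
        simp only [hbad, coe_filter, Set.mem_ofPred_eq] at hD
        simp only [coe_product, Set.mem_prod, mem_coe, mem_filter, mem_powerset]
        refine ⟨⟨inter_subset_left, ?_⟩, mem_goodSplits.2 ⟨?_, ?_⟩⟩
        · rw [sdiff_inter_self_left]; exact hD.2
        · intro y hy
          rw [mem_sdiff] at hy ⊢
          rcases mem_insert.1 ((h𝒜mem D hD.1).1 hy.1) with rfl | h
          · exact absurd hxi hy.2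
          · exact ⟨h, hy.2⟩
        · intro j hj
          have hxj : x ∉ S j := fun h => hx (mem_sdiff.1 (hj h)).1
          have h1 := (mem_goodSplits.1 (h𝒜mem D hD.1).2).2 j (hj.trans sdiff_subset)
          rw [inter_erase, erase_eq_of_notMem (by simp [hxj]), hse _ _ hxj] at h1
          have hdj : Disjoint (S j) (S i) := disjoint_left.2 fun y hy hyi =>
            (mem_sdiff.1 (hj hy)).2 hyi
          have e1 : S j ∩ (D \ S i) = S j ∩ D := by
            ext y; simp only [mem_inter, mem_sdiff]
            exact ⟨fun h => ⟨h.1, h.2.1⟩, fun h => ⟨h.1, h.2, disjoint_left.1 hdj h.1⟩⟩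
          have e2 : S j \ (D \ S i) = S j \ D := by
            ext y; simp only [mem_sdiff, not_and, not_not]
            exact ⟨fun h => ⟨h.1, fun hD => disjoint_left.1 hdj h.1 (h.2 hD)⟩,
              fun h => ⟨h.1, fun hD => absurd hD h.2⟩⟩
          rw [e1, e2]; exact h1
      · intro D _ D' _ hDD
        simp only [Prod.mk.injEq] at hDD
        rw [← sdiff_union_inter D (S i), ← sdiff_union_inter D' (S i), inter_comm D, inter_comm D',
          hDD.1, hDD.2]
    rw [card_product] at hinj
    have hb := card_bad_subsets_le (S i) r (by rw [hs]; exact hr)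
    rw [hs] at hb
    -- Putting back the s - 1 elements of `S i` other than `x` multiplies the number of good splits
    -- by at least 1.9 ^ (s - 1), so the splits of `P \ S i` are relatively few.
    have hg := hgrow (P \ S i) ((S i).erase x) (by
        rw [disjoint_left]; intro y hy hy'
        exact (mem_sdiff.1 hy).2 (mem_of_mem_erase hy')) (by
        intro y hy
        rcases mem_union.1 hy with h | h
        · exact (mem_sdiff.1 h).1
        · rcases mem_insert.1 (hiP (mem_of_mem_erase h)) with h' | h'
          · exact absurd h' (ne_of_mem_erase h)
          · exact h')
    have hU : P \ S i ∪ (S i).erase x = P := by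
      ext y
      simp only [mem_union, mem_sdiff, mem_erase]
      constructor
      · rintro (h | ⟨h1, h2⟩)
        · exact h.1
        · rcases mem_insert.1 (hiP h2) with h' | h'
          · exact absurd h' h1
          · exact h'
      · intro h
        by_cases hy : y ∈ S i
        · right; exact ⟨fun e => hx (e ▸ h), hy⟩
        · left; exact ⟨h, hy⟩
    rw [hU, card_erase_of_mem hxi, hs] at hg
    have hspos : 0 < s := by rw [← hs i]; exact card_pos.2 ⟨x, hxi⟩
    have hpow : (1.9 : ℝ) ^ s = 1.9 * 1.9 ^ (s - 1) := by
      rw [← pow_succ']; congr 1; omega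
    have hinj' : (#(bad i) : ℝ) ≤ (2 * 1.4 ^ s) * #(goodSplits S r (P \ S i)) := by
      calc (#(bad i) : ℝ) ≤ _ := by exact_mod_cast hinj
        _ ≤ _ := mul_le_mul_of_nonneg_right hb (by positivity)
    rw [hpow]
    calc (#(bad i) : ℝ) * (1.9 * 1.9 ^ (s - 1))
        ≤ ((2 * 1.4 ^ s) * #(goodSplits S r (P \ S i))) * (1.9 * 1.9 ^ (s - 1)) :=
          mul_le_mul_of_nonneg_right hinj' (by positivity)
      _ = 1.9 * (2 * 1.4 ^ s) * (1.9 ^ (s - 1) * #(goodSplits S r (P \ S i))) := by ring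
      _ ≤ _ := mul_le_mul_of_nonneg_left hg (by positivity)
  have h1 : (2 : ℝ) * #(goodSplits S r P) ≤
      #(goodSplits S r (insert x P)) + ∑ i ∈ J, (#(bad i) : ℝ) := by
    have := (card_le_card hcover).trans ((card_union_le _ _).trans
      (Nat.add_le_add_left card_biUnion_le _))
    rw [hcard𝒜] at this
    exact_mod_cast this
  -- The constant 38 is 1.9 * 2 / 0.1: the bad candidates cost at most 0.1 of the good splits of
  -- `P`, and 2 - 0.1 = 1.9 closes the induction.
  have h2 : (∑ i ∈ J, (#(bad i) : ℝ)) * 1.9 ^ s ≤ 0.1 * #(goodSplits S r P) * 1.9 ^ s := by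
    calc (∑ i ∈ J, (#(bad i) : ℝ)) * 1.9 ^ s = ∑ i ∈ J, (#(bad i) : ℝ) * 1.9 ^ s := by
          rw [sum_mul]
      _ ≤ ∑ i ∈ J, 1.9 * (2 * 1.4 ^ s) * (#(goodSplits S r P) : ℝ) := sum_le_sum hbadcard
      _ = #J * (1.9 * (2 * 1.4 ^ s) * #(goodSplits S r P)) := by rw [sum_const, nsmul_eq_mul]
      _ ≤ t * (1.9 * (2 * 1.4 ^ s) * #(goodSplits S r P)) :=
          mul_le_mul_of_nonneg_right (by exact_mod_cast hJt) (by positivity)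
      _ = 0.1 * (38 * t * 1.4 ^ s) * #(goodSplits S r P) := by ring
      _ ≤ 0.1 * 1.9 ^ s * #(goodSplits S r P) := by gcongr
      _ = _ := by ring
  have h3 := le_of_mul_le_mul_right h2 (by positivity)
  linarith

open Finset in
/-- A family of `s`-sets with bounded degrees has a splitting in which both parts of every member
contain at least a tenth of it. -/
theorem exists_balanced_split {I V : Type*} [Fintype I] [Fintype V] [DecidableEq V]
    (S : I → Finset V) (r s t : ℕ) (hs : ∀ i, s ≤ #(S i)) (hs0 : 0 < s) (hr : 10 * r ≤ s)
    (ht : ∀ x, #{i | x ∈ S i} ≤ t) (hst : 38 * t * (1.4 : ℝ) ^ s ≤ 1.9 ^ s) :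
    ∃ D : Finset V, ∀ i, r ≤ #(S i ∩ D) ∧ r ≤ #(S i \ D) := by
  classical
  -- The counting needs sets of equal size; a lower bound on both parts passes from a subset to the
  -- whole set.
  choose S' hS' hcard using fun i => exists_subset_card_eq (hs i)
  have ht' : ∀ x, #{i | x ∈ S' i} ≤ t := fun x => (card_le_card (by
    intro i hi; simp only [mem_filter, mem_univ, true_and] at hi ⊢; exact hS' i hi)).trans (ht x)
  have hpos : ∀ P : Finset V, 0 < #(goodSplits S' r P) := by
    intro P
    induction P using Finset.induction_on with
    | empty =>
      refine card_pos.2 ⟨∅, mem_goodSplits.2 ⟨subset_rfl, fun i hi => ?_⟩⟩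
      have := hcard i
      rw [subset_empty.1 hi] at this
      simp at this; omega
    | insert x P hx ih =>
      have := card_goodSplits_insert S' r s t hcard hr ht' hst _ P x rfl hx
      have h1 : (0 : ℝ) < #(goodSplits S' r P) := by exact_mod_cast ih
      have h2 : (0 : ℝ) < #(goodSplits S' r (insert x P)) := by linarith
      exact_mod_cast h2
  obtain ⟨D, hD⟩ := card_pos.1 (hpos univ)
  refine ⟨D, fun i => ?_⟩
  have := (mem_goodSplits.1 hD).2 i (subset_univ _)
  exact ⟨this.1.trans (card_le_card (inter_subset_inter_right (hS' i))),
    this.2.trans (card_le_card (sdiff_subset_sdiff (hS' i) subset_rfl))⟩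

/-- The ratio 1.9 / 1.4 exceeds 1. Earlier splitting rounds work with larger sets, so the condition
for the last round implies all of them. -/
theorem splitting_condition_mono {t s s' : ℕ} (hss : s ≤ s')
    (hst : 38 * t * (1.4 : ℝ) ^ s ≤ 1.9 ^ s) : 38 * t * (1.4 : ℝ) ^ s' ≤ 1.9 ^ s' := by
  obtain ⟨c, rfl⟩ := Nat.exists_eq_add_of_le hss
  rw [pow_add, pow_add, ← mul_assoc]
  exact mul_le_mul hst (pow_le_pow_left₀ (by norm_num) (by norm_num) _) (by positivity)
    (by positivity)

open Finset in
/-- A sparse set `D` such that every vertex has many neighbours both inside and outside `D`. -/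
theorem exists_sparse_dominating {V : Type*} [Fintype V] [DecidableEq V] (G : SimpleGraph V)
    [DecidableRel G.Adj] (d : ℕ) (hG : G.IsRegularOfDegree d) (s : ℕ) (hs : 0 < s)
    (hst : 38 * d * (1.4 : ℝ) ^ s ≤ 1.9 ^ s) (j : ℕ) :
    10 ^ (j + 1) * s ≤ d → ∃ D : Finset V, 2 ^ (j + 1) * #D ≤ Fintype.card V ∧
      ∀ v, s ≤ #(G.neighborFinset v ∩ D) ∧ s ≤ #(G.neighborFinset v \ D) := by
  -- Each round halves the set and keeps a tenth of every neighbourhood in it, so the induction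
  -- needs the previous round with 10 * s in place of s.
  have main : ∀ s : ℕ, 0 < s → 38 * d * (1.4 : ℝ) ^ s ≤ 1.9 ^ s → 10 ^ (j + 1) * s ≤ d →
      ∃ D : Finset V, 2 ^ (j + 1) * #D ≤ Fintype.card V ∧
        ∀ v, s ≤ #(G.neighborFinset v ∩ D) ∧ s ≤ #(G.neighborFinset v \ D) := by
    induction j with
    | zero =>
      intro s hs hst hd
      obtain ⟨D, hD⟩ := exists_balanced_split (fun v : V => G.neighborFinset v) s (10 * s) d
        (fun v => by rw [G.card_neighborFinset_eq_degree, hG.degree_eq]; simpa using hd)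
        (by omega) le_rfl
        (fun x => by
          have : ({i | x ∈ G.neighborFinset i} : Finset V) = G.neighborFinset x := by
            ext i; simp [G.adj_comm]
          rw [this, G.card_neighborFinset_eq_degree, hG.degree_eq])
        (splitting_condition_mono (by omega) hst)
      -- The splitting condition is symmetric, so the smaller of `D` and its complement can be kept.
      by_cases h : 2 * #D ≤ Fintype.card V
      · exact ⟨D, by simpa using h, hD⟩
      · refine ⟨Dᶜ, ?_, fun v => ⟨?_, ?_⟩⟩
        · rw [card_compl]; simp; omega
        · rw [← sdiff_eq_inter_compl]; exact (hD v).2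
        · rw [sdiff_compl]; exact (hD v).1
    | succ j ih =>
      intro s hs hst hd
      obtain ⟨D, hDc, hD⟩ := ih (10 * s) (by omega) (splitting_condition_mono (by omega) hst)
        (by rw [pow_succ] at hd; linarith)
      obtain ⟨E, hE⟩ := exists_balanced_split (fun v : V => G.neighborFinset v ∩ D) s (10 * s) d
        (fun v => (hD v).1) (by omega) le_rfl
        (fun x => by
          have : ({i | x ∈ G.neighborFinset i ∩ D} : Finset V) ⊆ G.neighborFinset x := by
            intro i; simp +contextual [G.adj_comm]
          exact (card_le_card this).trans
            (by rw [G.card_neighborFinset_eq_degree, hG.degree_eq]))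
        (splitting_condition_mono (by omega) hst)
      have hout : ∀ (F : Finset V), F ⊆ D → ∀ v, s ≤ #(G.neighborFinset v \ F) := fun F hF v =>
        (by have := (hD v).2; omega : s ≤ #(G.neighborFinset v \ D)).trans
          (card_le_card (sdiff_subset_sdiff subset_rfl hF))
      have hsum := card_inter_add_card_sdiff D E
      by_cases h : #(D ∩ E) ≤ #(D \ E)
      · refine ⟨D ∩ E, ?_, fun v => ⟨?_, hout _ inter_subset_left v⟩⟩
        · calc 2 ^ (j + 1 + 1) * #(D ∩ E) = 2 ^ (j + 1) * (2 * #(D ∩ E)) := by ring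
            _ ≤ 2 ^ (j + 1) * #D := Nat.mul_le_mul_left _ (by omega)
            _ ≤ _ := hDc
        · rw [← inter_assoc]; exact (hE v).1
      · refine ⟨D \ E, ?_, fun v => ⟨?_, hout _ sdiff_subset v⟩⟩
        · calc 2 ^ (j + 1 + 1) * #(D \ E) = 2 ^ (j + 1) * (2 * #(D \ E)) := by ring
            _ ≤ 2 ^ (j + 1) * #D := Nat.mul_le_mul_left _ (by omega)
            _ ≤ _ := hDc
        · rw [← inter_sdiff_assoc]; exact (hE v).2
  exact main s hs hst

/-! ### Extendability and the Friedman–Pippenger step -/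

open Finset

/-- The neighbourhood of a set of vertices. -/
def SimpleGraph.nbhd {V : Type*} [Fintype V] [DecidableEq V] (G : SimpleGraph V)
    [DecidableRel G.Adj] (Y : Finset V) : Finset V := Y.biUnion fun y => G.neighborFinset y

theorem SimpleGraph.mem_nbhd {V : Type*} [Fintype V] [DecidableEq V] {G : SimpleGraph V}
    [DecidableRel G.Adj] {Y : Finset V} {v : V} : v ∈ G.nbhd Y ↔ ∃ y ∈ Y, G.Adj y v := by
  simp [SimpleGraph.nbhd]

theorem SimpleGraph.nbhd_union {V : Type*} [Fintype V] [DecidableEq V] {G : SimpleGraph V}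
    [DecidableRel G.Adj] (Y Z : Finset V) : G.nbhd (Y ∪ Z) = G.nbhd Y ∪ G.nbhd Z := by
  ext v; simp only [SimpleGraph.mem_nbhd, mem_union]
  constructor
  · rintro ⟨y, h | h, ha⟩
    · exact Or.inl ⟨y, h, ha⟩
    · exact Or.inr ⟨y, h, ha⟩
  · rintro (⟨y, h, ha⟩ | ⟨y, h, ha⟩)
    · exact ⟨y, Or.inl h, ha⟩
    · exact ⟨y, Or.inr h, ha⟩

/-- The Friedman–Pippenger invariant: small vertex sets have enough free neighbours (outside the
occupied set `X`) for the demand `dem` of their members. -/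
def Extendable {V : Type*} [Fintype V] [DecidableEq V] (G : SimpleGraph V) [DecidableRel G.Adj]
    (m : ℕ) (X : Finset V) (dem : V → ℕ) : Prop :=
  ∀ Y : Finset V, #Y ≤ 2 * m → ∑ y ∈ Y, dem y ≤ #(G.nbhd Y \ X)

/-- The Friedman–Pippenger step: a vertex with positive demand can be given a new neighbour. -/
theorem Extendable.exists_insert {V : Type*} [Fintype V] [DecidableEq V] {G : SimpleGraph V}
    [DecidableRel G.Adj] {m k : ℕ} {X : Finset V} {dem : V → ℕ} (h : Extendable G m X dem)
    (hm : 0 < m) (hbig : ∀ Y : Finset V, m < #Y → Fintype.card V ≤ #(G.nbhd Y) + m)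
    (hdem : ∀ v, dem v ≤ k) (hX : #X + m + 2 * m * k < Fintype.card V) (x : V)
    (hx : 0 < dem x) :
    ∃ y, G.Adj x y ∧ y ∉ X ∧ Extendable G m (insert y X) (dem - Pi.single x 1) := by
  classical
  by_contra hcon
  push Not at hcon
  -- tight sets
  set tight : Finset V → Prop := fun Y => #Y ≤ 2 * m ∧ #(G.nbhd Y \ X) = ∑ y ∈ Y, dem y with htight
  -- A set of more than m vertices has at least |V| - m - |X| > 2mk free neighbours, more than its
  -- demand.
  have htm : ∀ Y, tight Y → #Y ≤ m := by
    intro Y hY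
    by_contra hc
    have h1 := hbig Y (by omega)
    have h2 : ∑ y ∈ Y, dem y ≤ #Y * k := sum_le_card_nsmul _ _ _ fun y _ => hdem y
    have h3 : #Y * k ≤ 2 * m * k := Nat.mul_le_mul_right _ hY.1
    have h4 := le_card_sdiff X (G.nbhd Y)
    have h5 := hY.2
    omega
  -- Free neighbourhoods are submodular and demand is additive. Two tight sets have at most m
  -- elements each, so the invariant, imposed up to size 2m, applies to their union.
  have hunion : ∀ Y Z, tight Y → tight Z → tight (Y ∪ Z) := by
    intro Y Z hY hZ
    have hc : #(Y ∪ Z) ≤ 2 * m := by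
      have := card_union_le Y Z; have := htm Y hY; have := htm Z hZ; omega
    refine ⟨hc, le_antisymm ?_ (h _ hc)⟩
    have h1 := h (Y ∩ Z) ((card_le_card inter_subset_left).trans hY.1)
    have h2 : #(G.nbhd (Y ∪ Z) \ X) + #(G.nbhd (Y ∩ Z) \ X)
        ≤ #(G.nbhd Y \ X) + #(G.nbhd Z \ X) := by
      rw [G.nbhd_union, union_sdiff_distrib, ← card_union_add_card_inter (G.nbhd Y \ X)]
      refine Nat.add_le_add_left (card_le_card fun v hv => ?_) _
      rw [mem_sdiff, SimpleGraph.mem_nbhd] at hv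
      obtain ⟨⟨y, hy, ha⟩, hvX⟩ := hv
      rw [mem_inter] at hy
      rw [mem_inter, mem_sdiff, mem_sdiff, SimpleGraph.mem_nbhd, SimpleGraph.mem_nbhd]
      exact ⟨⟨⟨y, hy.1, ha⟩, hvX⟩, ⟨y, hy.2, ha⟩, hvX⟩
    have h3 := sum_union_inter (s₁ := Y) (s₂ := Z) (f := dem)
    have h4 := hY.2
    have h5 := hZ.2
    omega
  -- every free neighbour of `x` is blocked by a tight set avoiding `x`
  have hblock : ∀ y, G.Adj x y → y ∉ X → ∃ Y, tight Y ∧ x ∉ Y ∧ y ∈ G.nbhd Y := by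
    intro y hy hyX
    have := hcon y hy hyX
    simp only [Extendable, not_forall, not_le] at this
    obtain ⟨Y, hYc, hY⟩ := this
    have h1 := h Y hYc
    have h2 : #(G.nbhd Y \ X) ≤ #(G.nbhd Y \ insert y X) + 1 := by
      rw [sdiff_insert]
      have := pred_card_le_card_erase (s := G.nbhd Y \ X) (a := y)
      omega
    have h3 : ∑ v ∈ Y, (dem - Pi.single x 1 : V → ℕ) v ≤ ∑ v ∈ Y, dem v :=
      sum_le_sum fun v _ => by simp
    refine ⟨Y, ⟨hYc, by omega⟩, fun hxY => ?_, ?_⟩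
    · have h4 : ∑ v ∈ Y, (dem - Pi.single x 1 : V → ℕ) v < ∑ v ∈ Y, dem v :=
        sum_lt_sum (fun v _ => by simp) ⟨x, hxY, by simp; exact hx⟩
      omega
    · by_contra hyN
      have : G.nbhd Y \ insert y X = G.nbhd Y \ X := by
        rw [sdiff_insert, erase_eq_of_notMem (by simp [hyN])]
      rw [this] at hY
      omega
  have hbig_tight : ∀ F : Finset V, (∀ y ∈ F, G.Adj x y ∧ y ∉ X) →
      ∃ Y, tight Y ∧ x ∉ Y ∧ F ⊆ G.nbhd Y := by
    intro F
    induction F using Finset.induction_on with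
    | empty => exact fun _ => ⟨∅, by simp [htight, SimpleGraph.nbhd], by simp, by simp⟩
    | insert y F _ ih =>
      intro hF
      obtain ⟨Y, hY, hxY, hFY⟩ := ih fun z hz => hF z (mem_insert_of_mem hz)
      obtain ⟨Z, hZ, hxZ, hyZ⟩ := hblock y (hF y (mem_insert_self _ _)).1
        (hF y (mem_insert_self _ _)).2
      refine ⟨Y ∪ Z, hunion Y Z hY hZ, by simp [hxY, hxZ], ?_⟩
      rw [G.nbhd_union]
      exact insert_subset (mem_union_right _ hyZ) (hFY.trans subset_union_left)
  obtain ⟨Y, hY, hxY, hNY⟩ := hbig_tight (G.neighborFinset x \ X) (fun y hy => by simpa using hy)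
  -- All free neighbours of `x` already lie in the neighbourhood of the tight set `Y`. Adding `x`
  -- increases the demand but not the free neighbourhood: a contradiction.
  have h1 := h (insert x Y) (by
    have := htm Y hY; have := card_insert_le x Y; omega)
  rw [sum_insert hxY] at h1
  have h2 : G.nbhd (insert x Y) \ X = G.nbhd Y \ X := by
    refine subset_antisymm (fun v hv => ?_) (fun v hv => ?_)
    · rw [mem_sdiff, SimpleGraph.mem_nbhd] at hv
      obtain ⟨⟨y, hy, ha⟩, hvX⟩ := hv
      rcases mem_insert.1 hy with rfl | hy
      · exact mem_sdiff.2 ⟨hNY (by simp [ha, hvX]), hvX⟩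
      · exact mem_sdiff.2 ⟨SimpleGraph.mem_nbhd.2 ⟨y, hy, ha⟩, hvX⟩
    · rw [mem_sdiff, SimpleGraph.mem_nbhd] at hv
      obtain ⟨⟨y, hy, ha⟩, hvX⟩ := hv
      exact mem_sdiff.2 ⟨SimpleGraph.mem_nbhd.2 ⟨y, mem_insert_of_mem hy, ha⟩, hvX⟩
  rw [h2, hY.2] at h1
  omega

/-! ### Growing trees, rolling back, and connecting paths -/

/-- `X'` arises from `X` by attaching new vertices one by one, `p` being the parent map, so that the
demand that remains is still met. -/
structure Grown {V : Type*} [Fintype V] [DecidableEq V] (G : SimpleGraph V) [DecidableRel G.Adj]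
    (m : ℕ) (X : Finset V) (dem : V → ℕ) (X' : Finset V) (p : V → V) : Prop where
  subset : X ⊆ X'
  adj : ∀ y ∈ X' \ X, G.Adj (p y) y
  parent_mem : ∀ y ∈ X' \ X, p y ∈ X'
  count_le : ∀ v, #{y ∈ X' \ X | p y = v} ≤ dem v
  ext : Extendable G m X' fun v => dem v - #{y ∈ X' \ X | p y = v}

section
variable {V : Type*} [Fintype V] [DecidableEq V] {G : SimpleGraph V} [DecidableRel G.Adj]
  {m k : ℕ} {X X' : Finset V} {dem : V → ℕ} {p : V → V}

theorem Grown.refl (h : Extendable G m X dem) (p : V → V) : Grown G m X dem X p where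
  subset := subset_rfl
  adj := by simp
  parent_mem := by simp
  count_le := by simp
  ext := by simpa using h

/-- Deleting an arbitrary set of grown vertices preserves extendability. -/
theorem Grown.rollback (h : Grown G m X dem X' p) {K : Finset V} (hK : K ⊆ X' \ X) :
    Extendable G m (X ∪ K) fun v => dem v - #{y ∈ K | p y = v} := by
  intro Y hY
  beta_reduce
  have h1 := h.ext Y hY
  beta_reduce at h1
  have hsplit : ∀ v, #{y ∈ X' \ X | p y = v}
      = #{y ∈ K | p y = v} + #{y ∈ (X' \ X) \ K | p y = v} := by
    intro v
    rw [← card_union_of_disjoint, ← filter_union, union_sdiff_of_subset hK]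
    exact disjoint_filter_filter disjoint_sdiff
  have h2 : ∑ v ∈ Y, (dem v - #{y ∈ K | p y = v})
      = ∑ v ∈ Y, (dem v - #{y ∈ X' \ X | p y = v}) + ∑ v ∈ Y, #{y ∈ (X' \ X) \ K | p y = v} := by
    rw [← sum_add_distrib]
    refine sum_congr rfl fun v _ => ?_
    have := h.count_le v; have := hsplit v; omega
  have h3 : ∑ v ∈ Y, #{y ∈ (X' \ X) \ K | p y = v} = #{y ∈ (X' \ X) \ K | p y ∈ Y} := by
    rw [card_eq_sum_card_fiberwise (f := p) (t := Y) (fun y hy => by simpa using (mem_filter.1 hy).2)]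
    refine sum_congr rfl fun v hv => ?_
    rw [filter_filter]
    congr 1
    ext y
    simp only [mem_filter]
    exact ⟨fun h => ⟨h.1, h.2.symm ▸ hv, h.2⟩, fun h => ⟨h.1, h.2.2⟩⟩
  -- The deleted children of vertices of `Y` are free neighbours again, and their number is exactly
  -- the demand that is restored. Hence `K` need not be closed under parents.
  have h4 : (G.nbhd Y \ X') ∪ {y ∈ (X' \ X) \ K | p y ∈ Y} ⊆ G.nbhd Y \ (X ∪ K) := by
    intro v hv
    rcases mem_union.1 hv with hv | hv
    · rw [mem_sdiff] at hv ⊢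
      refine ⟨hv.1, fun hc => hv.2 ?_⟩
      rcases mem_union.1 hc with hc | hc
      · exact h.subset hc
      · exact (mem_sdiff.1 (hK hc)).1
    · rw [mem_filter, mem_sdiff, mem_sdiff] at hv
      rw [mem_sdiff, mem_union, SimpleGraph.mem_nbhd]
      exact ⟨⟨p v, hv.2, h.adj v (mem_sdiff.2 hv.1.1)⟩, fun hc => hc.elim hv.1.1.2 hv.1.2⟩
  have h5 : Disjoint (G.nbhd Y \ X') {y ∈ (X' \ X) \ K | p y ∈ Y} := by
    rw [disjoint_left]
    intro v hv hv'
    rw [mem_filter, mem_sdiff, mem_sdiff] at hv'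
    exact (mem_sdiff.1 hv).2 hv'.1.1.1
  have h6 := card_le_card h4
  rw [card_union_of_disjoint h5] at h6
  omega

theorem Grown.exists_insert (h : Grown G m X dem X' p)
    (hm : 0 < m) (hbig : ∀ Y : Finset V, m < #Y → Fintype.card V ≤ #(G.nbhd Y) + m)
    (hdem : ∀ v, dem v ≤ k) (hX : #X' + m + 2 * m * k < Fintype.card V) (x : V)
    (hxX : x ∈ X') (hx : #{y ∈ X' \ X | p y = x} < dem x) :
    ∃ y, y ∉ X' ∧ Grown G m X dem (insert y X') (Function.update p y x) := by
  obtain ⟨y, hxy, hyX, hE⟩ := h.ext.exists_insert hm hbig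
    (fun v => (Nat.sub_le _ _).trans (hdem v)) hX x (by omega)
  have hyX0 : y ∉ X := fun hc => hyX (h.subset hc)
  have hins : insert y X' \ X = insert y (X' \ X) := by rw [insert_sdiff_of_notMem _ hyX0]
  have hupd : ∀ z ∈ X' \ X, Function.update p y x z = p z := by
    intro z hz
    exact Function.update_of_ne (fun e => hyX (by rw [← e]; exact (mem_sdiff.1 hz).1)) _ _
  have hcount : ∀ v, #{z ∈ insert y X' \ X | Function.update p y x z = v}
      = #{z ∈ X' \ X | p z = v} + (Pi.single x 1 : V → ℕ) v := by
    intro v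
    rw [hins, filter_insert, Function.update_self,
      filter_congr (fun z hz => by rw [hupd z hz] : ∀ z ∈ X' \ X,
        (Function.update p y x z = v ↔ p z = v))]
    by_cases hv : x = v
    · subst hv
      rw [if_pos rfl, card_insert_of_notMem (by simp [hyX])]
      simp
    · rw [if_neg hv, Pi.single_eq_of_ne (Ne.symm hv)]; rfl
  refine ⟨y, hyX, h.subset.trans (subset_insert _ _), ?_, ?_, ?_, ?_⟩
  · intro z hz
    rw [hins, mem_insert] at hz
    rcases hz with rfl | hz
    · rwa [Function.update_self]
    · rw [hupd z hz]; exact h.adj z hz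
  · intro z hz
    rw [hins, mem_insert] at hz
    rcases hz with rfl | hz
    · rw [Function.update_self]; exact mem_insert_of_mem hxX
    · rw [hupd z hz]; exact mem_insert_of_mem (h.parent_mem z hz)
  · intro v
    rw [hcount]
    by_cases hv : v = x
    · subst hv; simp only [Pi.single_eq_same]; omega
    · rw [Pi.single_eq_of_ne hv]; simpa using h.count_le v
  · convert hE using 2 with v
    rw [hcount, Pi.sub_apply]; omega

theorem Grown.exists_children (hm : 0 < m)
    (hbig : ∀ Y : Finset V, m < #Y → Fintype.card V ≤ #(G.nbhd Y) + m)
    (hdem : ∀ v, dem v ≤ k) (x : V) (hxX : x ∈ X') (b : ℕ) (h : Grown G m X dem X' p)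
    (hX : #X' + b + m + 2 * m * k ≤ Fintype.card V)
    (hx : #{y ∈ X' \ X | p y = x} + b ≤ dem x) :
    ∃ X'' q, X' ⊆ X'' ∧ Grown G m X dem X'' q ∧ (∀ y ∈ X', q y = p y) ∧
      (∀ y ∈ X'' \ X', q y = x) ∧ #X'' = #X' + b := by
  induction b with
  | zero => exact ⟨X', p, subset_rfl, h, fun _ _ => rfl, by simp, by simp⟩
  | succ b ih =>
    obtain ⟨X'', q, hsub, hG, hq, hqx, hc⟩ := ih (by omega) (by omega)
    have hcnt : #{y ∈ X'' \ X | q y = x} ≤ #{y ∈ X' \ X | p y = x} + b := by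
      have h1 : ({y ∈ X'' \ X | q y = x} : Finset V) ⊆ {y ∈ X' \ X | p y = x} ∪ (X'' \ X') := by
        intro y hy
        rw [mem_filter, mem_sdiff] at hy
        by_cases hyX : y ∈ X'
        · exact mem_union_left _ (mem_filter.2 ⟨mem_sdiff.2 ⟨hyX, hy.1.2⟩, by rw [← hq y hyX, hy.2]⟩)
        · exact mem_union_right _ (mem_sdiff.2 ⟨hy.1.1, hyX⟩)
      have h2 := (card_le_card h1).trans (card_union_le _ _)
      have h3 := card_sdiff_of_subset hsub
      omega
    obtain ⟨y, hy, hGy⟩ := hG.exists_insert hm hbig hdem (by omega) x (hsub hxX) (by omega)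
    refine ⟨insert y X'', _, hsub.trans (subset_insert _ _), hGy, ?_, ?_, ?_⟩
    · intro z hz
      rw [Function.update_of_ne (fun e => hy (by rw [← e]; exact hsub hz)), hq z hz]
    · intro z hz
      rw [mem_sdiff, mem_insert] at hz
      by_cases hzy : z = y
      · subst hzy; simp
      · rw [Function.update_of_ne hzy]
        exact hqx z (mem_sdiff.2 ⟨hz.1.resolve_left hzy, hz.2⟩)
    · rw [card_insert_of_notMem hy, hc]; ring

/-- No vertex of `L` has a child yet, so its full demand is still available; the vertices of `L` are
served one after another. -/
theorem Grown.exists_level (hm : 0 < m)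
    (hbig : ∀ Y : Finset V, m < #Y → Fintype.card V ≤ #(G.nbhd Y) + m)
    (hdem : ∀ v, dem v ≤ k) (b : ℕ) (h : Grown G m X dem X' p) (L : Finset V)
    (hLX : L ⊆ X')
    (hX : #X' + #L * b + m + 2 * m * k ≤ Fintype.card V)
    (hL : ∀ x ∈ L, b ≤ dem x) (hLp : ∀ y ∈ X' \ X, p y ∉ L) :
    ∃ X'' q, X' ⊆ X'' ∧ Grown G m X dem X'' q ∧ (∀ y ∈ X', q y = p y) ∧
      (∀ y ∈ X'' \ X', q y ∈ L) ∧ #X'' = #X' + #L * b := by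
  induction L using Finset.induction_on with
  | empty => exact ⟨X', p, subset_rfl, h, fun _ _ => rfl, by simp, by simp⟩
  | insert x L hxL ih =>
    rw [card_insert_of_notMem hxL, Nat.succ_mul] at hX
    obtain ⟨X1, q1, hs1, hG1, hq1, hqL1, hc1⟩ := ih
      (fun z hz => hLX (mem_insert_of_mem hz)) (by omega)
      (fun z hz => hL z (mem_insert_of_mem hz)) (fun y hy hc => hLp y hy (mem_insert_of_mem hc))
    have h0 : #{y ∈ X1 \ X | q1 y = x} = 0 := by
      rw [card_eq_zero, filter_eq_empty_iff]
      intro y hy e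
      by_cases hyX : y ∈ X'
      · rw [hq1 y hyX] at e
        exact hLp y (mem_sdiff.2 ⟨hyX, (mem_sdiff.1 hy).2⟩) (e ▸ mem_insert_self _ _)
      · exact hxL (e ▸ hqL1 y (mem_sdiff.2 ⟨(mem_sdiff.1 hy).1, hyX⟩))
    obtain ⟨X2, q2, hs2, hG2, hq2, hqx2, hc2⟩ := Grown.exists_children hm hbig hdem x (hs1 (hLX (mem_insert_self _ _))) b hG1
      (by omega) (by rw [h0, zero_add]; exact hL x (mem_insert_self _ _))
    refine ⟨X2, q2, hs1.trans hs2, hG2, fun y hy => by rw [hq2 y (hs1 hy), hq1 y hy], ?_, ?_⟩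
    · intro y hy
      rw [mem_sdiff] at hy
      by_cases hy1 : y ∈ X1
      · rw [hq2 y hy1]
        exact mem_insert_of_mem (hqL1 y (mem_sdiff.2 ⟨hy1, hy.2⟩))
      · rw [hqx2 y (mem_sdiff.2 ⟨hy.1, hy1⟩)]
        exact mem_insert_self _ _
    · rw [hc2, hc1, card_insert_of_notMem hxL]; ring

/-- Growing `b`-ary trees of depth `a` from all vertices of `L`. -/
theorem Grown.exists_trees (hm : 0 < m)
    (hbig : ∀ Y : Finset V, m < #Y → Fintype.card V ≤ #(G.nbhd Y) + m)
    (hdem : ∀ v, dem v ≤ k) {b : ℕ} (hb : 2 ≤ b) (h : Grown G m X dem X' p) (L : Finset V)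
    (hLX : L ⊆ X) (hbX : ∀ v ∉ X, b ≤ dem v)
    (hL : ∀ x ∈ L, b ≤ dem x) (hLp : ∀ y ∈ X' \ X, p y ∉ L) (a : ℕ)
    (hX : #X' + 2 * (#L * b ^ a) + m + 2 * m * k ≤ Fintype.card V) :
    ∃ X'' q F, X' ⊆ X'' ∧ Grown G m X dem X'' q ∧ (∀ y ∈ X', q y = p y) ∧
      (∀ y ∈ X'' \ X', q y ∈ L ∪ X'' \ X') ∧ #X'' ≤ #X' + 2 * (#L * b ^ a) ∧
      #F = #L * b ^ a ∧ (∀ y ∈ X'' \ X', q y ∉ F) ∧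
      ∀ y ∈ F, q^[a] y ∈ L ∧ ∀ i < a, q^[i] y ∈ X'' \ X' := by
  induction a with
  | zero =>
    exact ⟨X', p, L, subset_rfl, h, fun _ _ => rfl, by simp, by simp, by simp, by simp,
      fun y hy => ⟨by simpa using hy, by simp⟩⟩
  | succ a ih =>
    -- As b ≥ 2, the levels grow geometrically and all of them together have at most twice the size
    -- of the last.
    have hpow : 2 * (#L * b ^ a) ≤ #L * b ^ (a + 1) := by
      rw [pow_succ]
      calc 2 * (#L * b ^ a) = #L * (b ^ a * 2) := by ring
        _ ≤ _ := Nat.mul_le_mul_left _ (Nat.mul_le_mul_left _ hb)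
    obtain ⟨X1, q1, F, hs1, hG1, hq1, hqL1, hc1, hF, hFc, hchain⟩ := ih (by omega)
    have hFb : #F * b = #L * b ^ (a + 1) := by rw [hF, pow_succ]; ring
    have hFX : ∀ x ∈ F, x ∈ L ∨ x ∈ X1 \ X' := by
      intro x hx
      rcases Nat.eq_zero_or_pos a with rfl | ha
      · exact Or.inl (by simpa using (hchain x hx).1)
      · exact Or.inr (by simpa using (hchain x hx).2 0 ha)
    have hF1 : F ⊆ X1 := fun x hx => (hFX x hx).elim (fun hx => hs1 (h.subset (hLX hx)))
      fun hx => (mem_sdiff.1 hx).1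
    obtain ⟨X2, q2, hs2, hG2, hq2, hqF2, hc2⟩ := Grown.exists_level hm hbig hdem b hG1 F hF1
      (by rw [hFb]; omega)
      (by
        intro x hx
        rcases hFX x hx with hx | hx
        · exact hL x hx
        · exact hbX x fun hc => (mem_sdiff.1 hx).2 (h.subset hc))
      (by
        intro y hy hyF
        rw [mem_sdiff] at hy
        by_cases hyX : y ∈ X'
        · have hy' := mem_sdiff.2 ⟨hyX, hy.2⟩
          rw [hq1 y hyX] at hyF
          rcases hFX _ hyF with hx | hx
          · exact hLp y hy' hx
          · exact (mem_sdiff.1 hx).2 (h.parent_mem y hy')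
        · exact hFc y (mem_sdiff.2 ⟨hy.1, hyX⟩) hyF)
    refine ⟨X2, q2, X2 \ X1, hs1.trans hs2, hG2, fun y hy => by rw [hq2 y (hs1 hy), hq1 y hy],
      ?_, ?_, ?_, ?_, ?_⟩
    · intro y hy
      rw [mem_sdiff] at hy
      by_cases hy1 : y ∈ X1
      · rw [hq2 y hy1]
        rcases mem_union.1 (hqL1 y (mem_sdiff.2 ⟨hy1, hy.2⟩)) with h' | h'
        · exact mem_union_left _ h'
        · exact mem_union_right _ (sdiff_subset_sdiff hs2 subset_rfl h')
      · rcases hFX _ (hqF2 y (mem_sdiff.2 ⟨hy.1, hy1⟩)) with h' | h'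
        · exact mem_union_left _ h'
        · exact mem_union_right _ (sdiff_subset_sdiff hs2 subset_rfl h')
    · rw [hc2, hFb]; omega
    · rw [card_sdiff_of_subset hs2, hc2, hFb]; omega
    · intro y hy hyF
      rw [mem_sdiff] at hy hyF
      by_cases hy1 : y ∈ X1
      · rw [hq2 y hy1] at hyF
        refine hyF.2 ?_
        rcases mem_union.1 (hqL1 y (mem_sdiff.2 ⟨hy1, hy.2⟩)) with h' | h'
        · exact hs1 (h.subset (hLX h'))
        · exact (mem_sdiff.1 h').1
      · exact hyF.2 (hF1 (hqF2 y (mem_sdiff.2 ⟨hy.1, hy1⟩)))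
    · intro y hy
      have hyF := hqF2 y hy
      have hc := hchain _ hyF
      have hiter : ∀ i ≤ a, q2^[i] (q2 y) = q1^[i] (q2 y) := by
        intro i
        induction i with
        | zero => exact fun _ => rfl
        | succ i ihi =>
          intro hi
          rw [Function.iterate_succ_apply', Function.iterate_succ_apply', ihi (by omega)]
          exact hq2 _ (mem_sdiff.1 (hc.2 i (by omega))).1
      refine ⟨?_, fun i hi => ?_⟩
      · rw [Function.iterate_succ_apply, hiter a le_rfl]; exact hc.1
      · rcases i with _ | i
        · rw [mem_sdiff] at hy
          exact mem_sdiff.2 ⟨hy.1, fun hcon => hy.2 (hs1 hcon)⟩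
        · rw [Function.iterate_succ_apply, hiter i (by omega)]
          exact sdiff_subset_sdiff hs2 subset_rfl (hc.2 i (by omega))
end

/-- A repetition would let one skip a period and reach the exit point earlier. This makes the
ancestor paths in grown trees consist of distinct vertices. -/
theorem Function.iterate_injOn_of_first_exit {V : Type*} {f : V → V} {P : Set V} {y : V} {a : ℕ}
    (hend : f^[a] y ∉ P) (hP : ∀ i < a, f^[i] y ∈ P) :
    ∀ i ≤ a, ∀ j ≤ a, f^[i] y = f^[j] y → i = j := by
  have key : ∀ i j, i < j → j ≤ a → f^[i] y ≠ f^[j] y := by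
    intro i j hij hj heq
    have h1 : f^[a - j + i] y = f^[a] y := by
      rw [Function.iterate_add_apply, heq, ← Function.iterate_add_apply]
      congr 1; omega
    exact hend (h1 ▸ hP _ (by omega))
  intro i hi j hj h
  rcases lt_trichotomy i j with h' | h' | h'
  · exact absurd h (key i j h' hj)
  · exact h'
  · exact absurd h.symm (key j i h' hi)

/-- Take ⌈m / c⌉ elements. The upper bound limits the space occupied by the trees grown from them.
-/
theorem Finset.exists_subset_card_mul_between {V : Type*} {Z : Finset V} {m c : ℕ} (hc : 0 < c)
    (h : m ≤ #Z * c) : ∃ Y ⊆ Z, m ≤ #Y * c ∧ #Y * c ≤ m + c := by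
  have hle : (m + c - 1) / c ≤ #Z := by
    apply Nat.le_of_lt_succ
    rw [Nat.div_lt_iff_lt_mul hc, Nat.succ_mul]; omega
  obtain ⟨Y, hY, hYc⟩ := exists_subset_card_eq hle
  refine ⟨Y, hY, ?_, ?_⟩
  · rw [hYc]
    have := Nat.lt_div_mul_add (a := m + c - 1) hc
    omega
  · rw [hYc]
    have := Nat.div_mul_le_self (m + c - 1) c
    omega

section
variable {V : Type*} [Fintype V] [DecidableEq V] {G : SimpleGraph V} [DecidableRel G.Adj]

/-- Connecting two large sets of occupied vertices by a short path through free vertices. -/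
theorem Extendable.exists_connection {m k b a : ℕ} {X : Finset V} {dem : V → ℕ}
    (h : Extendable G m X dem) (hm : 0 < m)
    (hjoin : ∀ A B : Finset V, m ≤ #A → m ≤ #B → ∃ x ∈ A, ∃ y ∈ B, G.Adj x y)
    (hbig : ∀ Y : Finset V, m < #Y → Fintype.card V ≤ #(G.nbhd Y) + m)
    (hdem : ∀ v, dem v ≤ k) (hb : 2 ≤ b) (Z Q : Finset V) (hZX : Z ⊆ X) (hQX : Q ⊆ X)
    (hZQ : Disjoint Z Q) (hbX : ∀ v ∉ X, b ≤ dem v) (hbZ : ∀ v ∈ Z, b ≤ dem v)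
    (hbQ : ∀ v ∈ Q, b ≤ dem v) (hZ : m ≤ #Z * b ^ a) (hQ : m ≤ #Q * b ^ a)
    (hab : b ^ a ≤ b * m) (hX : #X + 4 * (m + b * m) + m + 2 * m * k ≤ Fintype.card V) :
    ∃ (π : ℕ → V) (dem' : V → ℕ), π 0 ∈ Z ∧ π (2 * a + 1) ∈ Q ∧
      (∀ i ≤ 2 * a, G.Adj (π i) (π (i + 1))) ∧ (∀ i, 1 ≤ i → i ≤ 2 * a → π i ∉ X) ∧
      (∀ i ≤ 2 * a + 1, ∀ j ≤ 2 * a + 1, π i = π j → i = j) ∧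
      Extendable G m (X ∪ (Finset.Icc 1 (2 * a)).image π) dem' ∧
      (∀ v, dem' v ≤ dem v) ∧ (∀ v, dem v ≤ dem' v + 1) ∧
      ∀ v, (∀ i ≤ 2 * a + 1, π i ≠ v) → dem' v = dem v := by
  have hpos : 0 < b ^ a := Nat.pow_pos (by omega)
  obtain ⟨Z', hZ'Z, hZ'1, hZ'2⟩ := exists_subset_card_mul_between hpos hZ
  obtain ⟨Q', hQ'Q, hQ'1, hQ'2⟩ := exists_subset_card_mul_between hpos hQ
  obtain ⟨X1, q1, F1, hs1, hG1, -, hqL1, hc1, hF1, -, hch1⟩ :=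
    Grown.exists_trees hm hbig hdem hb (Grown.refl h id) Z' (hZ'Z.trans hZX) hbX
      (fun x hx => hbZ x (hZ'Z hx)) (by simp) a (by omega)
  obtain ⟨X2, q, F2, hs2, hG2, hq2, hqL2, hc2, hF2, -, hch2⟩ :=
    Grown.exists_trees hm hbig hdem hb hG1 Q' (hQ'Q.trans hQX) hbX
      (fun x hx => hbQ x (hQ'Q hx)) (by
        intro y hy hyQ
        rcases mem_union.1 (hqL1 y hy) with h' | h'
        · exact disjoint_left.1 hZQ (hZ'Z h') (hQ'Q hyQ)
        · exact (mem_sdiff.1 h').2 (hQX (hQ'Q hyQ))) a (by omega)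
  -- Both forests have at least m vertices at depth a, so an edge joins two of these.
  obtain ⟨y1, hy1, y2, hy2, hadj⟩ := hjoin F1 F2 (by omega) (by omega)
  have hit : ∀ i ≤ a, q^[i] y1 = q1^[i] y1 := by
    intro i
    induction i with
    | zero => exact fun _ => rfl
    | succ i ih =>
      intro hi
      rw [Function.iterate_succ_apply', Function.iterate_succ_apply', ih (by omega)]
      exact hq2 _ (mem_sdiff.1 ((hch1 y1 hy1).2 i (by omega))).1
  have hA1 : ∀ i < a, q^[i] y1 ∈ X1 \ X := fun i hi => by
    rw [hit i hi.le]; exact (hch1 y1 hy1).2 i hi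
  have hAa : q^[a] y1 ∈ Z' := by rw [hit a le_rfl]; exact (hch1 y1 hy1).1
  have hB1 : ∀ i < a, q^[i] y2 ∈ X2 \ X1 := (hch2 y2 hy2).2
  have hBa : q^[a] y2 ∈ Q' := (hch2 y2 hy2).1
  have hAin : ∀ i ≤ a, q^[i] y1 ∈ X1 := fun i hi => by
    rcases hi.lt_or_eq with h' | rfl
    · exact (mem_sdiff.1 (hA1 i h')).1
    · exact hs1 (hZX (hZ'Z hAa))
  have hinjA := Function.iterate_injOn_of_first_exit (P := ((X1 \ X : Finset V) : Set V))
    (fun hc => (mem_sdiff.1 (mem_coe.1 hc)).2 (hZX (hZ'Z hAa))) hA1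
  have hinjB := Function.iterate_injOn_of_first_exit (P := ((X2 \ X1 : Finset V) : Set V))
    (fun hc => (mem_sdiff.1 (mem_coe.1 hc)).2 (hs1 (hQX (hQ'Q hBa)))) hB1
  have hAB : ∀ i ≤ a, ∀ j ≤ a, q^[i] y1 ≠ q^[j] y2 := by
    intro i hi j hj he
    rcases hj.lt_or_eq with h' | rfl
    · exact (mem_sdiff.1 (hB1 j h')).2 (he ▸ hAin i hi)
    · rcases hi.lt_or_eq with h' | rfl
      · exact (mem_sdiff.1 (hA1 i h')).2 (he ▸ hQX (hQ'Q hBa))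
      · exact disjoint_left.1 hZQ (hZ'Z hAa) (he ▸ hQ'Q hBa)
  -- From the root in `Z` down to `y1`, across the edge, then from `y2` up to the root in `Q`.
  set π : ℕ → V := fun i => if i ≤ a then q^[a - i] y1 else q^[i - a - 1] y2 with hπ
  have hπ1 : ∀ i ≤ a, π i = q^[a - i] y1 := fun i hi => by simp [hπ, hi]
  have hπ2 : ∀ i, a < i → π i = q^[i - a - 1] y2 := fun i hi => by simp [hπ, not_le.2 hi]
  set K := (Finset.Icc 1 (2 * a)).image π with hK
  have hKmem : ∀ y, y ∈ K ↔ ∃ i < a, y = q^[i] y1 ∨ y = q^[i] y2 := by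
    intro y
    simp only [hK, mem_image, mem_Icc]
    constructor
    · rintro ⟨i, ⟨h1, h2⟩, rfl⟩
      by_cases hi : i ≤ a
      · exact ⟨a - i, by omega, Or.inl (hπ1 i hi)⟩
      · exact ⟨i - a - 1, by omega, Or.inr (hπ2 i (by omega))⟩
    · rintro ⟨i, hi, rfl | rfl⟩
      · exact ⟨a - i, by omega, by rw [hπ1 _ (by omega)]; congr 1; omega⟩
      · exact ⟨i + a + 1, by omega, by rw [hπ2 _ (by omega)]; congr 1; omega⟩
  have hKX : K ⊆ X2 \ X := by
    intro y hy
    obtain ⟨i, hi, rfl | rfl⟩ := (hKmem y).1 hy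
    · have := mem_sdiff.1 (hA1 i hi)
      exact mem_sdiff.2 ⟨hs2 this.1, this.2⟩
    · have := mem_sdiff.1 (hB1 i hi)
      exact mem_sdiff.2 ⟨this.1, fun hc => this.2 (hs1 hc)⟩
  -- Along the path every vertex is the parent of at most one kept vertex, so after the rollback
  -- each demand has dropped by at most 1.
  have hcnt : ∀ v, #{y ∈ K | q y = v} ≤ 1 := by
    intro v
    rw [card_le_one]
    intro y hy y' hy'
    rw [mem_filter, hKmem] at hy hy'
    obtain ⟨⟨i, hi, hiy⟩, hv⟩ := hy
    obtain ⟨⟨j, hj, hjy⟩, hv'⟩ := hy'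
    have e : q y = q y' := hv.trans hv'.symm
    rcases hiy with rfl | rfl <;> rcases hjy with rfl | rfl <;>
      rw [← Function.iterate_succ_apply' q, ← Function.iterate_succ_apply' q] at e
    · rw [show i = j by have := hinjA (i + 1) (by omega) (j + 1) (by omega) e; omega]
    · exact absurd e (hAB (i + 1) (by omega) (j + 1) (by omega))
    · exact absurd e.symm (hAB (j + 1) (by omega) (i + 1) (by omega))
    · rw [show i = j by have := hinjB (i + 1) (by omega) (j + 1) (by omega) e; omega]
  refine ⟨π, fun v => dem v - #{y ∈ K | q y = v}, ?_, ?_, ?_, ?_, ?_, hG2.rollback hKX,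
    fun v => Nat.sub_le _ _, fun v => ?_, fun v hv => ?_⟩
  · rw [hπ1 0 (by omega)]; exact hZ'Z hAa
  · rw [hπ2 _ (by omega), show 2 * a + 1 - a - 1 = a by omega]; exact hQ'Q hBa
  · intro i hi
    by_cases h1 : i < a
    · rw [hπ1 i h1.le, hπ1 (i + 1) h1, show a - i = (a - (i + 1)) + 1 by omega,
        Function.iterate_succ_apply']
      have := mem_sdiff.1 (hA1 (a - (i + 1)) (by omega))
      exact hG2.adj _ (mem_sdiff.2 ⟨hs2 this.1, this.2⟩)
    · by_cases h2 : i = a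
      · subst h2
        rw [hπ1 i le_rfl, hπ2 (i + 1) (by omega)]
        simpa using hadj
      · rw [hπ2 i (by omega), hπ2 (i + 1) (by omega), show i + 1 - a - 1 = (i - a - 1) + 1 by omega,
          Function.iterate_succ_apply']
        have := mem_sdiff.1 (hB1 (i - a - 1) (by omega))
        exact (hG2.adj _ (mem_sdiff.2 ⟨this.1, fun hc => this.2 (hs1 hc)⟩)).symm
  · intro i h1 h2 hc
    exact (mem_sdiff.1 (hKX (mem_image_of_mem π (mem_Icc.2 ⟨h1, h2⟩)))).2 hc
  · intro i hi j hj he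
    by_cases h1 : i ≤ a <;> by_cases h2 : j ≤ a
    · rw [hπ1 i h1, hπ1 j h2] at he
      have := hinjA _ (by omega) _ (by omega) he; omega
    · rw [hπ1 i h1, hπ2 j (by omega)] at he
      exact absurd he (hAB _ (by omega) _ (by omega))
    · rw [hπ2 i (by omega), hπ1 j h2] at he
      exact absurd he.symm (hAB _ (by omega) _ (by omega))
    · rw [hπ2 i (by omega), hπ2 j (by omega)] at he
      have := hinjB _ (by omega) _ (by omega) he; omega
  · beta_reduce; have := hcnt v; omega
  · have : #{y ∈ K | q y = v} = 0 := by
      rw [card_eq_zero, filter_eq_empty_iff]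
      intro y hy e
      obtain ⟨i, hi, rfl | rfl⟩ := (hKmem y).1 hy
      · refine hv (a - (i + 1)) (by omega) ?_
        rw [hπ1 _ (by omega), ← e, show a - (a - (i + 1)) = i + 1 by omega,
          Function.iterate_succ_apply']
      · refine hv (a + 1 + (i + 1)) (by omega) ?_
        rw [hπ2 _ (by omega), ← e, show a + 1 + (i + 1) - a - 1 = i + 1 by omega,
          Function.iterate_succ_apply']
    beta_reduce; rw [this, Nat.sub_zero]
end

/-! ### Partial embeddings of trees with gadgets -/

/-- `pt` is the parent map of a rooted tree with at most `D` children per vertex; `rk` is a rank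
function witnessing well-foundedness. The value `pt root` is irrelevant. -/
structure IsParentMap {W : Type*} [Fintype W] [DecidableEq W] (pt : W → W) (root : W) (rk : W → ℕ)
    (D : ℕ) : Prop where
  rk_lt : ∀ w, w ≠ root → rk (pt w) < rk w
  card_children : ∀ w, #{c | c ≠ root ∧ pt c = w} ≤ D

/-- A family of gadgets in a rooted tree: leaves `ℓ ∈ Λ` of scale `sc ℓ`, each together with a
pendant branch `Br ℓ` that contains the first `2 * sc ℓ + 1` ancestors of `ℓ`, but not the next
one, which lies outside all branches. -/
structure IsGadgetFamily {W : Type*} [Fintype W] [DecidableEq W] (pt : W → W) (root : W)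
    (Λ : Finset W) (sc : W → ℕ) (Br : W → Finset W) : Prop where
  leaf : ∀ l ∈ Λ, ∀ w, w ≠ root → pt w ≠ l
  path_mem : ∀ l ∈ Λ, ∀ j ≤ 2 * sc l + 1, pt^[j] l ∈ Br l
  attach_notMem : ∀ l ∈ Λ, ∀ l' ∈ Λ, pt^[2 * sc l + 2] l ∉ Br l'
  closed : ∀ l ∈ Λ, ∀ w, w ≠ root → pt w ∈ Br l → w ∈ Br l
  root_notMem : ∀ l ∈ Λ, root ∉ Br l
  disjoint : ∀ l ∈ Λ, ∀ l' ∈ Λ, l ≠ l' → Disjoint (Br l) (Br l')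
  attach_inj : ∀ l ∈ Λ, ∀ l' ∈ Λ, sc l = sc l' → pt^[2 * sc l + 2] l = pt^[2 * sc l' + 2] l' →
    l = l'

/-- A partial embedding of a rooted tree (on the ancestor-closed set `S`) that is extendable in the
sense of Friedman and Pippenger, where the vertices of `D` are kept reserved. -/
structure IsPartialEmb {V W : Type*} [Fintype V] [DecidableEq V] [Fintype W] [DecidableEq W]
    (G : SimpleGraph V) [DecidableRel G.Adj] (m k : ℕ) (pt : W → W) (root : W) (D : Finset V)
    (S : Finset W) (φ : W → V) (dem : V → ℕ) : Prop where
  root_mem : root ∈ S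
  closed : ∀ w ∈ S, w ≠ root → pt w ∈ S
  inj : Set.InjOn φ S
  adj : ∀ w ∈ S, w ≠ root → G.Adj (φ w) (φ (pt w))
  ext : Extendable G m (S.image φ ∪ D) dem
  dem_le : ∀ v, dem v ≤ k
  dem_free : ∀ v, v ∉ S.image φ → dem v = k
  dem_used : ∀ w ∈ S, k ≤ dem (φ w) + #{c ∈ S | c ≠ root ∧ pt c = w} + 1

section
variable {V W : Type*} [Fintype V] [DecidableEq V] [Fintype W] [DecidableEq W]
  {G : SimpleGraph V} [DecidableRel G.Adj] {m k Dl : ℕ} {pt : W → W} {root : W} {rk : W → ℕ}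
  {D : Finset V} {S : Finset W} {φ : W → V} {dem : V → ℕ}

/-- The parent still lacks a child, so at most `Dl - 1` children are embedded; since `Dl + 1 ≤ k`,
the bound `dem_used` leaves a positive demand. -/
theorem IsPartialEmb.exists_insert (h : IsPartialEmb G m k pt root D S φ dem)
    (hT : IsParentMap pt root rk Dl) (hk : Dl + 1 ≤ k) (hm : 0 < m)
    (hbig : ∀ Y : Finset V, m < #Y → Fintype.card V ≤ #(G.nbhd Y) + m)
    (hsize : #(S.image φ ∪ D) + m + 2 * m * k < Fintype.card V)
    (w : W) (hw : w ∉ S) (hpw : pt w ∈ S) :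
    ∃ y dem', y ∉ S.image φ ∪ D ∧
      IsPartialEmb G m k pt root D (insert w S) (Function.update φ w y) dem' := by
  have hwr : w ≠ root := fun e => hw (e ▸ h.root_mem)
  have hch : #{c ∈ S | c ≠ root ∧ pt c = pt w} + 1 ≤ Dl := by
    refine le_trans ?_ (hT.card_children (pt w))
    rw [← card_insert_of_notMem (a := w) (by simp [hw])]
    refine card_le_card fun c hc => ?_
    rcases mem_insert.1 hc with rfl | hc
    · simp [hwr]
    · simp only [mem_filter] at hc; simp [hc.2]
  have hpos : 0 < dem (φ (pt w)) := by have := h.dem_used _ hpw; omega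
  obtain ⟨y, hxy, hy, hE⟩ := h.ext.exists_insert hm hbig h.dem_le hsize _ hpos
  have hyS : y ∉ S.image φ := fun hc => hy (mem_union_left _ hc)
  have hupd : ∀ u ∈ S, Function.update φ w y u = φ u := fun u hu =>
    Function.update_of_ne (fun e => hw (by rw [← e]; exact hu)) _ _
  have himg : (insert w S).image (Function.update φ w y) = insert y (S.image φ) := by
    rw [image_insert, Function.update_self, image_congr (fun u hu => hupd u hu)]
  refine ⟨y, dem - Pi.single (φ (pt w)) 1, hy, ?_, ?_, ?_, ?_, ?_, ?_, ?_, ?_⟩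
  · exact mem_insert_of_mem h.root_mem
  · intro u hu hur
    rcases mem_insert.1 hu with rfl | hu
    · exact mem_insert_of_mem hpw
    · exact mem_insert_of_mem (h.closed u hu hur)
  · rw [coe_insert, Set.injOn_insert (by simpa using hw)]
    refine ⟨fun u hu u' hu' e => ?_, ?_⟩
    · rw [hupd u hu, hupd u' hu'] at e; exact h.inj hu hu' e
    · rw [Function.update_self]
      rintro ⟨u, hu, e⟩
      rw [hupd u hu] at e
      exact hyS (mem_image.2 ⟨u, hu, e⟩)
  · intro u hu hur
    rcases mem_insert.1 hu with rfl | hu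
    · rw [Function.update_self, hupd _ hpw]; exact hxy.symm
    · rw [hupd u hu, hupd _ (h.closed u hu hur)]; exact h.adj u hu hur
  · rw [himg, insert_union]; exact hE
  · intro v; exact (Nat.sub_le _ _).trans (h.dem_le v)
  · intro v hv
    rw [himg, mem_insert, not_or] at hv
    have : v ≠ φ (pt w) := fun e => hv.2 (e ▸ mem_image_of_mem φ hpw)
    rw [Pi.sub_apply, Pi.single_eq_of_ne this]
    exact h.dem_free v hv.2
  · intro u hu
    rcases mem_insert.1 hu with rfl | hu
    · rw [Function.update_self, Pi.sub_apply, h.dem_free y hyS,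
        Pi.single_eq_of_ne (fun e => hyS (by rw [e]; exact mem_image_of_mem φ hpw))]
      omega
    · rw [hupd u hu, Pi.sub_apply]
      have h1 := h.dem_used u hu
      have hsub : ({c ∈ S | c ≠ root ∧ pt c = u} : Finset W)
          ⊆ {c ∈ insert w S | c ≠ root ∧ pt c = u} := filter_subset_filter _ (subset_insert _ _)
      by_cases hu' : u = pt w
      · subst hu'
        rw [Pi.single_eq_same]
        have : #{c ∈ insert w S | c ≠ root ∧ pt c = pt w}
            = #{c ∈ S | c ≠ root ∧ pt c = pt w} + 1 := by
          rw [filter_insert, if_pos ⟨hwr, rfl⟩, card_insert_of_notMem (by simp [hw])]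
        omega
      · rw [Pi.single_eq_of_ne (fun e => hu' (h.inj hu hpw e))]
        have := card_le_card hsub
        omega

/-- Missing vertices are embedded in order of rank, so that the parent always comes first. -/
theorem IsPartialEmb.exists_extend (h : IsPartialEmb G m k pt root D S φ dem)
    (hT : IsParentMap pt root rk Dl) (hk : Dl + 1 ≤ k) (hm : 0 < m)
    (hbig : ∀ Y : Finset V, m < #Y → Fintype.card V ≤ #(G.nbhd Y) + m)
    (S' : Finset W) (hSS' : S ⊆ S') (hS' : ∀ w ∈ S', w ≠ root → pt w ∈ S')
    (hsize : #(S' \ S) + #(S.image φ ∪ D) + m + 2 * m * k ≤ Fintype.card V) :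
    ∃ φ' dem', IsPartialEmb G m k pt root D S' φ' dem' ∧ (∀ w ∈ S, φ' w = φ w) ∧
      ∀ w ∈ S' \ S, φ' w ∉ D := by
  induction hn : #(S' \ S) generalizing S φ dem with
  | zero =>
    rw [card_eq_zero, sdiff_eq_empty_iff_subset] at hn
    obtain rfl := subset_antisymm hSS' hn
    exact ⟨φ, dem, h, fun _ _ => rfl, by simp⟩
  | succ n ih =>
    obtain ⟨w, hw, hmin⟩ := exists_min_image (S' \ S) rk (card_pos.1 (by omega))
    rw [mem_sdiff] at hw
    have hwr : w ≠ root := fun e => hw.2 (e ▸ h.root_mem)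
    have hpw : pt w ∈ S := by
      by_contra hc
      have := hmin _ (mem_sdiff.2 ⟨hS' w hw.1 hwr, hc⟩)
      have := hT.rk_lt w hwr
      omega
    obtain ⟨y, dem1, hy, h1⟩ := h.exists_insert hT hk hm hbig (by omega) w hw.2 hpw
    have hupd : ∀ u ∈ S, Function.update φ w y u = φ u := fun u hu =>
      Function.update_of_ne (fun e => hw.2 (by rw [← e]; exact hu)) _ _
    have himg : (insert w S).image (Function.update φ w y) = insert y (S.image φ) := by
      rw [image_insert, Function.update_self, image_congr (fun u hu => hupd u hu)]
    have hcard : #(S' \ insert w S) = n := by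
      rw [sdiff_insert, card_erase_of_mem (mem_sdiff.2 hw)]; omega
    obtain ⟨φ', dem', h2, h3, h4⟩ := ih h1 (insert_subset hw.1 hSS') (by
      rw [himg, insert_union, hcard]
      have := card_insert_le y (S.image φ ∪ D); omega) hcard
    refine ⟨φ', dem', h2, fun u hu => by rw [h3 u (mem_insert_of_mem hu), hupd u hu], ?_⟩
    intro u hu
    by_cases huw : u = w
    · subst huw
      rw [h3 u (mem_insert_self _ _), Function.update_self]
      exact fun hc => hy (mem_union_right _ hc)
    · rw [mem_sdiff] at hu
      exact h4 u (mem_sdiff.2 ⟨hu.1, by simp [huw, hu.2]⟩)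

/-- Embedding the path of one gadget so that the parent of its leaf goes to a reserved vertex. -/
theorem IsPartialEmb.exists_connect (h : IsPartialEmb G m k pt root D S φ dem)
    (hT : IsParentMap pt root rk Dl) {b a : ℕ} (hk : b + Dl + 1 ≤ k) (hm : 0 < m) (hb : 2 ≤ b)
    (hjoin : ∀ A B : Finset V, m ≤ #A → m ≤ #B → ∃ x ∈ A, ∃ y ∈ B, G.Adj x y)
    (hbig : ∀ Y : Finset V, m < #Y → Fintype.card V ≤ #(G.nbhd Y) + m)
    {Λ : Finset W} {sc : W → ℕ} {Br : W → Finset W} (hΛ : IsGadgetFamily pt root Λ sc Br)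
    (U : Finset W) (hU : U ⊆ Λ) (hsc : ∀ l ∈ U, sc l = a)
    (hattach : ∀ l ∈ U, pt^[2 * a + 2] l ∈ S) (hdisj : ∀ l ∈ U, Disjoint S (Br l))
    (hZ : m ≤ #(D \ S.image φ) * b ^ a) (hUc : m ≤ #U * b ^ a) (hab : b ^ a ≤ b * m)
    (hsize : #(S.image φ ∪ D) + 4 * (m + b * m) + m + 2 * m * k ≤ Fintype.card V) :
    ∃ l ∈ U, ∃ φ' dem',
      IsPartialEmb G m k pt root D (S ∪ (Icc 1 (2 * a + 1)).image fun j => pt^[j] l) φ' dem' ∧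
      (∀ w ∈ S, φ' w = φ w) ∧ φ' (pt l) ∈ D \ S.image φ ∧
      ∀ j, 2 ≤ j → j ≤ 2 * a + 1 → φ' (pt^[j] l) ∉ D := by
  set att : W → W := pt^[2 * a + 2] with hatt
  set Q := U.image (fun l => φ (att l)) with hQ
  have hQS : Q ⊆ S.image φ := by
    intro v hv
    obtain ⟨l, hl, rfl⟩ := mem_image.1 hv
    exact mem_image_of_mem φ (hattach l hl)
  have hQc : #Q = #U := by
    refine card_image_of_injOn fun l hl l' hl' e => ?_
    have := h.inj (hattach l hl) (hattach l' hl') e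
    exact hΛ.attach_inj l (hU hl) l' (hU hl') ((hsc l hl).trans (hsc l' hl').symm)
      (by rw [hsc l hl, hsc l' hl']; exact this)
  have hbfree : ∀ v, v ∉ S.image φ → b ≤ dem v := fun v hv => by
    rw [h.dem_free v hv]; omega
  obtain ⟨π, dem', hπ0, hπe, hπadj, hπX, hπinj, hE, hd1, hd2, hd3⟩ :=
    h.ext.exists_connection hm hjoin hbig h.dem_le hb (D \ S.image φ) Q
      (sdiff_subset.trans subset_union_right) (hQS.trans subset_union_left)
      (disjoint_left.2 fun v hv hv' => (mem_sdiff.1 hv).2 (hQS hv'))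
      (fun v hv => hbfree v fun hc => hv (mem_union_left _ hc))
      (fun v hv => hbfree v (mem_sdiff.1 hv).2)
      (fun v hv => by
        obtain ⟨w, hw, rfl⟩ := mem_image.1 (hQS hv)
        have h1 := h.dem_used w hw
        have h2 := hT.card_children w
        have h3 : #{c ∈ S | c ≠ root ∧ pt c = w} ≤ #{c | c ≠ root ∧ pt c = w} :=
          card_le_card (filter_subset_filter _ (subset_univ _))
        omega)
      hZ (by rw [hQc]; exact hUc) hab hsize
  obtain ⟨l, hl, hle⟩ := mem_image.1 hπe
  have hla := hsc l hl
  have hpath : ∀ j ≤ 2 * a + 1, pt^[j] l ∈ Br l := by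
    have := hΛ.path_mem l (hU hl); rwa [hla] at this
  have hnr : ∀ j ≤ 2 * a + 1, pt^[j] l ≠ root := fun j hj e =>
    hΛ.root_notMem l (hU hl) (e ▸ hpath j hj)
  have hnS : ∀ j ≤ 2 * a + 1, pt^[j] l ∉ S := fun j hj hc =>
    disjoint_left.1 (hdisj l hl) hc (hpath j hj)
  have hrk : ∀ i j, i < j → j ≤ 2 * a + 2 → rk (pt^[j] l) < rk (pt^[i] l) := by
    intro i j hij
    induction j, hij using Nat.le_induction with
    | base => intro hj; rw [Function.iterate_succ_apply']; exact hT.rk_lt _ (hnr i (by omega))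
    | succ j hij ih =>
      intro hj
      rw [Function.iterate_succ_apply']
      exact (hT.rk_lt _ (hnr j (by omega))).trans (ih (by omega))
  have hinj : ∀ i ≤ 2 * a + 2, ∀ j ≤ 2 * a + 2, pt^[i] l = pt^[j] l → i = j := by
    intro i hi j hj e
    rcases lt_trichotomy i j with h' | h' | h'
    · have := hrk i j h' hj; rw [e] at this; omega
    · exact h'
    · have := hrk j i h' hi; rw [e] at this; omega
  classical
  -- Shift by one: `pt l` goes to `π 0` in `D`, and the attachment point `pt^[2 * a + 2] l`, already
  -- embedded, is `π (2 * a + 1)`. The leaf `l` itself stays unembedded.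
  set φ' : W → V := fun w =>
    if hw : ∃ j, 1 ≤ j ∧ j ≤ 2 * a + 1 ∧ pt^[j] l = w then π (hw.choose - 1) else φ w with hφ'
  have hφ'p : ∀ j, 1 ≤ j → j ≤ 2 * a + 1 → φ' (pt^[j] l) = π (j - 1) := by
    intro j h1 h2
    have hw : ∃ i, 1 ≤ i ∧ i ≤ 2 * a + 1 ∧ pt^[i] l = pt^[j] l := ⟨j, h1, h2, rfl⟩
    have hs := hw.choose_spec
    have := hinj _ (by omega) _ (by omega) hs.2.2
    simp only [hφ']
    rw [dif_pos hw, this]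
  have hφ'S : ∀ w ∈ S, φ' w = φ w := by
    intro w hw
    simp only [hφ']
    rw [dif_neg]
    rintro ⟨j, h1, h2, rfl⟩
    exact hnS j h2 hw
  set P := (Icc 1 (2 * a + 1)).image fun j => pt^[j] l with hP
  have hPmem : ∀ w, w ∈ P ↔ ∃ j, 1 ≤ j ∧ j ≤ 2 * a + 1 ∧ pt^[j] l = w := by
    intro w; simp [hP, and_assoc]
  have hπS : ∀ i ≤ 2 * a, π i ∉ S.image φ := by
    intro i hi
    rcases Nat.eq_zero_or_pos i with rfl | h'
    · exact (mem_sdiff.1 hπ0).2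
    · exact fun hc => hπX i h' hi (mem_union_left _ hc)
  have himg : (S ∪ P).image φ' ∪ D = (S.image φ ∪ D) ∪ (Icc 1 (2 * a)).image π := by
    rw [image_union, image_congr (fun u hu => hφ'S u hu)]
    have : P.image φ' ∪ D = D ∪ (Icc 1 (2 * a)).image π := by
      ext v
      simp only [mem_union, mem_image, mem_Icc]
      constructor
      · rintro (⟨w, hw, rfl⟩ | hv)
        · obtain ⟨j, h1, h2, rfl⟩ := (hPmem w).1 hw
          rw [hφ'p j h1 h2]
          rcases Nat.lt_or_ge 1 j with h' | h'
          · exact Or.inr ⟨j - 1, ⟨by omega, by omega⟩, rfl⟩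
          · rw [show j - 1 = 0 by omega]; exact Or.inl (mem_sdiff.1 hπ0).1
        · exact Or.inl hv
      · rintro (hv | ⟨i, ⟨h1, h2⟩, rfl⟩)
        · exact Or.inr hv
        · exact Or.inl ⟨pt^[i + 1] l, (hPmem _).2 ⟨i + 1, by omega, by omega, rfl⟩, by
            rw [hφ'p _ (by omega) (by omega)]; rfl⟩
    rw [union_assoc, this, ← union_assoc]
  refine ⟨l, hl, φ', dem', ⟨?_, ?_, ?_, ?_, ?_, ?_, ?_, ?_⟩, hφ'S, ?_, ?_⟩
  · exact mem_union_left _ h.root_mem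
  · intro w hw hwr
    rcases mem_union.1 hw with hw | hw
    · exact mem_union_left _ (h.closed w hw hwr)
    · obtain ⟨j, h1, h2, rfl⟩ := (hPmem w).1 hw
      rw [← Function.iterate_succ_apply' pt]
      rcases h2.lt_or_eq with h' | h'
      · exact mem_union_right _ ((hPmem _).2 ⟨j + 1, by omega, by omega, rfl⟩)
      · rw [h']; exact mem_union_left _ (hattach l hl)
  · intro w hw w' hw' e
    rw [mem_coe, mem_union] at hw hw'
    rcases hw with hw | hw <;> rcases hw' with hw' | hw'
    · rw [hφ'S w hw, hφ'S w' hw'] at e; exact h.inj hw hw' e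
    · obtain ⟨j, h1, h2, rfl⟩ := (hPmem w').1 hw'
      rw [hφ'S w hw, hφ'p j h1 h2] at e
      exact absurd (e ▸ mem_image_of_mem φ hw) (hπS _ (by omega))
    · obtain ⟨j, h1, h2, rfl⟩ := (hPmem w).1 hw
      rw [hφ'S w' hw', hφ'p j h1 h2] at e
      exact absurd (e ▸ mem_image_of_mem φ hw') (hπS _ (by omega))
    · obtain ⟨j, h1, h2, rfl⟩ := (hPmem w).1 hw
      obtain ⟨i, h3, h4, rfl⟩ := (hPmem w').1 hw'
      rw [hφ'p j h1 h2, hφ'p i h3 h4] at e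
      have := hπinj _ (by omega) _ (by omega) e
      rw [show i = j by omega]
  · intro w hw hwr
    rcases mem_union.1 hw with hw | hw
    · rw [hφ'S w hw, hφ'S _ (h.closed w hw hwr)]; exact h.adj w hw hwr
    · obtain ⟨j, h1, h2, rfl⟩ := (hPmem w).1 hw
      rw [← Function.iterate_succ_apply' pt, hφ'p j h1 h2]
      rcases h2.lt_or_eq with h' | h'
      · rw [hφ'p (j + 1) (by omega) (by omega)]
        have := hπadj (j - 1) (by omega)
        rwa [show j - 1 + 1 = j + 1 - 1 by omega] at this
      · have h5 : pt^[j + 1] l ∈ S := by rw [h']; exact hattach l hl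
        rw [hφ'S _ h5, h']
        have h6 := hπadj (2 * a) le_rfl
        rw [← hle] at h6
        exact h6
  · rw [himg]; exact hE
  · intro v; exact (hd1 v).trans (h.dem_le v)
  · intro v hv
    rw [image_union, mem_union, not_or, image_congr (fun u hu => hφ'S u hu)] at hv
    rw [hd3, h.dem_free v hv.1]
    intro i hi e
    rcases hi.lt_or_eq with h' | h'
    · refine hv.2 (mem_image.2 ⟨pt^[i + 1] l, (hPmem _).2 ⟨i + 1, by omega, by omega, rfl⟩, ?_⟩)
      rw [hφ'p _ (by omega) (by omega), ← e]; rfl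
    · rw [h', ← hle] at e
      exact hv.1 (e ▸ mem_image_of_mem φ (hattach l hl))
  · intro w hw
    rw [← hP] at hw ⊢
    rcases mem_union.1 hw with hw | hw
    · rw [hφ'S w hw]
      have h1 := h.dem_used w hw
      have hsub : ({c ∈ S | c ≠ root ∧ pt c = w} : Finset W)
          ⊆ {c ∈ S ∪ P | c ≠ root ∧ pt c = w} := filter_subset_filter _ subset_union_left
      by_cases hwa : w = att l
      · have h2 := hd2 (φ w)
        have hnew : pt^[2 * a + 1] l ∉ ({c ∈ S | c ≠ root ∧ pt c = w} : Finset W) := fun hc =>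
          hnS _ le_rfl (mem_filter.1 hc).1
        have h3 : insert (pt^[2 * a + 1] l) ({c ∈ S | c ≠ root ∧ pt c = w} : Finset W)
            ⊆ {c ∈ S ∪ P | c ≠ root ∧ pt c = w} := by
          refine insert_subset ?_ hsub
          rw [mem_filter]
          refine ⟨mem_union_right _ ((hPmem _).2 ⟨2 * a + 1, by omega, le_rfl, rfl⟩),
            hnr _ le_rfl, ?_⟩
          rw [← Function.iterate_succ_apply' pt, hwa]
        have h4 := card_le_card h3
        rw [card_insert_of_notMem hnew] at h4
        omega
      · have h2 : dem' (φ w) = dem (φ w) := by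
          apply hd3
          intro i hi e
          rcases hi.lt_or_eq with h' | h'
          · exact hπS i (by omega) (e ▸ mem_image_of_mem φ hw)
          · rw [h', ← hle] at e
            exact hwa (h.inj hw (hattach l hl) e.symm)
        have := card_le_card hsub
        omega
    -- The `+ 1` in `dem_used` is for `pt l`: it may spend one unit on the path towards its own tree
    -- parent, while none of its children is embedded.
    · obtain ⟨j, h1, h2, rfl⟩ := (hPmem w).1 hw
      rw [hφ'p j h1 h2]
      have h3 := hd2 (π (j - 1))
      rw [h.dem_free _ (hπS _ (by omega))] at h3
      omega
  · have := hφ'p 1 le_rfl (by omega)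
    rw [Function.iterate_one] at this
    rw [this]; exact hπ0
  · intro j h1 h2
    rw [hφ'p j (by omega) h2]
    exact fun hc => hπX (j - 1) (by omega) (by omega) (mem_union_right _ hc)
end

/-! ### Covering the reserved set scale by scale -/

/-- A partial embedding in the course of covering the reserved set `D`: the vertices of `D` covered
so far are the images of the parents of the leaves in `used`, and no gadget leaf is embedded. -/
structure IsCovering {V W : Type*} [Fintype V] [DecidableEq V] [Fintype W] [DecidableEq W]
    (G : SimpleGraph V) [DecidableRel G.Adj] (m k : ℕ) (pt : W → W) (root : W) (D : Finset V)
    (Λ : Finset W) (sc : W → ℕ) (Br : W → Finset W)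
    (S : Finset W) (φ : W → V) (dem : V → ℕ) (used : Finset W) : Prop where
  emb : IsPartialEmb G m k pt root D S φ dem
  used_subset : used ⊆ Λ
  used_mem : ∀ l ∈ used, pt l ∈ S ∧ φ (pt l) ∈ D
  covered : ∀ w ∈ S, φ w ∈ D → ∃ l ∈ used, pt l = w
  leaf_notMem : ∀ l ∈ Λ, l ∉ S
  unused : ∀ l ∈ Λ, l ∉ used → Disjoint S (Br l)
  attach_mem : ∀ l ∈ Λ, pt^[2 * sc l + 2] l ∈ S

section
variable {V W : Type*} [Fintype V] [DecidableEq V] [Fintype W] [DecidableEq W]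
  {G : SimpleGraph V} [DecidableRel G.Adj] {m k Dl b : ℕ} {pt : W → W} {root : W} {rk : W → ℕ}
  {D : Finset V} {Λ : Finset W} {sc : W → ℕ} {Br : W → Finset W}

/-- The gadget leaves stay unembedded and number at least twice |D|. So |D| vertices are always left
as working space for the auxiliary trees. -/
theorem IsCovering.card_union_le {S : Finset W} {φ : W → V} {dem : V → ℕ} {used : Finset W}
    (h : IsCovering G m k pt root D Λ sc Br S φ dem used) (hΛD : 2 * #D ≤ #Λ)
    (hVW : Fintype.card W = Fintype.card V) :
    #(S.image φ ∪ D) + #D ≤ Fintype.card V := by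
  have h1 := Finset.card_union_le (S.image φ) D
  have h2 : #(S.image φ) ≤ #S := card_image_le
  have h3 : #S + #Λ ≤ Fintype.card W := by
    rw [← card_union_of_disjoint (disjoint_right.2 h.leaf_notMem)]
    exact card_le_univ _
  omega

/-- One gadget covers one vertex of `D`. This is possible as long as the uncovered vertices, and the
unused gadgets of scale `a`, each reach m after `a` rounds of b-fold branching. -/
theorem IsCovering.exists_step {S : Finset W} {φ : W → V} {dem : V → ℕ} {used : Finset W}
    (h : IsCovering G m k pt root D Λ sc Br S φ dem used)
    (hT : IsParentMap pt root rk Dl) (hk : b + Dl + 1 ≤ k) (hm : 0 < m) (hb : 2 ≤ b)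
    (hjoin : ∀ A B : Finset V, m ≤ #A → m ≤ #B → ∃ x ∈ A, ∃ y ∈ B, G.Adj x y)
    (hbig : ∀ Y : Finset V, m < #Y → Fintype.card V ≤ #(G.nbhd Y) + m)
    (hΛ : IsGadgetFamily pt root Λ sc Br) (hVW : Fintype.card W = Fintype.card V)
    (hD : 4 * (m + b * m) + m + 2 * m * k ≤ #D) (hΛD : 2 * #D ≤ #Λ) {a : ℕ}
    (hab : b ^ a ≤ b * m) (hZ : m ≤ #(D \ S.image φ) * b ^ a)
    (hU : m ≤ #{l ∈ Λ \ used | sc l = a} * b ^ a) :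
    ∃ l ∈ Λ \ used, sc l = a ∧ ∃ S' φ' dem',
      IsCovering G m k pt root D Λ sc Br S' φ' dem' (insert l used) ∧
      #(D \ S'.image φ') + 1 = #(D \ S.image φ) := by
  set U : Finset W := {l ∈ Λ \ used | sc l = a} with hUdef
  have hUΛ : ∀ l ∈ U, l ∈ Λ ∧ l ∉ used ∧ sc l = a := by
    intro l hl; simp only [hUdef, mem_filter, mem_sdiff] at hl; tauto
  have hsz := h.card_union_le hΛD hVW
  obtain ⟨l, hl, φ', dem', hE, hφS, hφl, hφp⟩ := h.emb.exists_connect hT hk hm hb hjoin hbig hΛ U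
    (fun l hl => (hUΛ l hl).1) (fun l hl => (hUΛ l hl).2.2)
    (fun l hl => by have := h.attach_mem l (hUΛ l hl).1; rwa [(hUΛ l hl).2.2] at this)
    (fun l hl => h.unused l (hUΛ l hl).1 (hUΛ l hl).2.1) hZ hU hab (by omega)
  obtain ⟨hlΛ, hlu, hla⟩ := hUΛ l hl
  have hpath : ∀ j ≤ 2 * a + 1, pt^[j] l ∈ Br l := by
    have := hΛ.path_mem l hlΛ; rwa [hla] at this
  set P := (Icc 1 (2 * a + 1)).image fun j => pt^[j] l with hP
  have hPmem : ∀ w, w ∈ P ↔ ∃ j, 1 ≤ j ∧ j ≤ 2 * a + 1 ∧ pt^[j] l = w := by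
    intro w; simp [hP, and_assoc]
  have hptP : pt l ∈ P := (hPmem _).2 ⟨1, le_rfl, by omega, rfl⟩
  refine ⟨l, mem_sdiff.2 ⟨hlΛ, hlu⟩, hla, S ∪ P, φ', dem', ⟨hE, ?_, ?_, ?_, ?_, ?_, ?_⟩, ?_⟩
  · exact insert_subset hlΛ h.used_subset
  · intro l' hl'
    rcases mem_insert.1 hl' with rfl | hl'
    · exact ⟨mem_union_right _ hptP, (mem_sdiff.1 hφl).1⟩
    · have := h.used_mem l' hl'
      exact ⟨mem_union_left _ this.1, by rw [hφS _ this.1]; exact this.2⟩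
  · intro w hw hwD
    rcases mem_union.1 hw with hw | hw
    · rw [hφS w hw] at hwD
      obtain ⟨l', hl', e⟩ := h.covered w hw hwD
      exact ⟨l', mem_insert_of_mem hl', e⟩
    · obtain ⟨j, h1, h2, rfl⟩ := (hPmem w).1 hw
      rcases h1.lt_or_eq with h' | rfl
      · exact absurd hwD (hφp j h' h2)
      · exact ⟨l, mem_insert_self _ _, rfl⟩
  · intro l' hl' hc
    rcases mem_union.1 hc with hc | hc
    · exact h.leaf_notMem l' hl' hc
    · obtain ⟨j, h1, h2, e⟩ := (hPmem l').1 hc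
      obtain ⟨i, rfl⟩ : ∃ i, j = i + 1 := ⟨j - 1, by omega⟩
      rw [Function.iterate_succ_apply'] at e
      exact hΛ.leaf l' hl' _ (fun e' => hΛ.root_notMem l hlΛ (e' ▸ hpath i (by omega))) e
  · intro l' hl' hl'u
    rw [mem_insert, not_or] at hl'u
    rw [disjoint_union_left]
    refine ⟨h.unused l' hl' hl'u.2, disjoint_left.2 fun w hw hw' => ?_⟩
    obtain ⟨j, h1, h2, rfl⟩ := (hPmem w).1 hw
    exact disjoint_left.1 (hΛ.disjoint l hlΛ l' hl' (Ne.symm hl'u.1)) (hpath j h2) hw'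
  · intro l' hl'; exact mem_union_left _ (h.attach_mem l' hl')
  · have : D \ (S ∪ P).image φ' = (D \ S.image φ).erase (φ' (pt l)) := by
      ext v
      rw [image_union, image_congr (fun u hu => hφS u hu)]
      simp only [mem_sdiff, mem_union, not_or, mem_erase]
      constructor
      · rintro ⟨h1, h2, h3⟩
        exact ⟨fun e => h3 (e ▸ mem_image_of_mem φ' hptP), h1, h2⟩
      · rintro ⟨h1, h2, h3⟩
        refine ⟨h2, h3, fun hc => ?_⟩
        obtain ⟨w, hw, rfl⟩ := mem_image.1 hc
        obtain ⟨j, h4, h5, rfl⟩ := (hPmem w).1 hw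
        rcases h4.lt_or_eq with h' | rfl
        · exact hφp j h' h5 h2
        · exact h1 rfl
    rw [this, card_erase_of_mem hφl]
    have := card_pos.2 ⟨_, hφl⟩
    omega

/-- A step removes one uncovered vertex and one gadget, so the surplus in `hU` is preserved and the
gadgets outlast the uncovered vertices. -/
theorem IsCovering.exists_scale {S : Finset W} {φ : W → V} {dem : V → ℕ} {used : Finset W}
    (h : IsCovering G m k pt root D Λ sc Br S φ dem used)
    (hT : IsParentMap pt root rk Dl) (hk : b + Dl + 1 ≤ k) (hm : 0 < m) (hb : 2 ≤ b)
    (hjoin : ∀ A B : Finset V, m ≤ #A → m ≤ #B → ∃ x ∈ A, ∃ y ∈ B, G.Adj x y)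
    (hbig : ∀ Y : Finset V, m < #Y → Fintype.card V ≤ #(G.nbhd Y) + m)
    (hΛ : IsGadgetFamily pt root Λ sc Br) (hVW : Fintype.card W = Fintype.card V)
    (hD : 4 * (m + b * m) + m + 2 * m * k ≤ #D) (hΛD : 2 * #D ≤ #Λ) {a : ℕ}
    (hab : b ^ a ≤ b * m) (hused : ∀ l ∈ used, sc l ≤ a)
    (hU : #(D \ S.image φ) * b ^ a + m ≤ #{l ∈ Λ \ used | sc l = a} * b ^ a) :
    ∃ S' φ' dem' used', IsCovering G m k pt root D Λ sc Br S' φ' dem' used' ∧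
      (∀ l ∈ used', sc l ≤ a) ∧ #(D \ S'.image φ') * b ^ a < m := by
  induction hn : #(D \ S.image φ) generalizing S φ dem used with
  | zero => exact ⟨S, φ, dem, used, h, hused, by rw [hn]; simpa using hm⟩
  | succ n ih =>
    by_cases hlt : #(D \ S.image φ) * b ^ a < m
    · exact ⟨S, φ, dem, used, h, hused, hlt⟩
    · obtain ⟨l, hl, hla, S', φ', dem', h', hc⟩ := h.exists_step hT hk hm hb hjoin hbig hΛ hVW hD
        hΛD hab (not_lt.1 hlt) (by omega)
      refine ih h' ?_ ?_ (by omega)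
      · intro l' hl'
        rcases mem_insert.1 hl' with rfl | hl'
        · exact hla.le
        · exact hused l' hl'
      · have e1 : ({l' ∈ Λ \ insert l used | sc l' = a} : Finset W)
            = ({l' ∈ Λ \ used | sc l' = a} : Finset W).erase l := by
          ext w; simp only [mem_filter, mem_sdiff, mem_insert, not_or, mem_erase]; tauto
        have hlm : l ∈ ({l' ∈ Λ \ used | sc l' = a} : Finset W) := mem_filter.2 ⟨hl, hla⟩
        rw [e1, card_erase_of_mem hlm]
        have hpos := card_pos.2 ⟨_, hlm⟩
        obtain ⟨c, hcc⟩ : ∃ c, #({l' ∈ Λ \ used | sc l' = a} : Finset W) = c + 1 :=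
          ⟨_, (Nat.sub_add_cancel hpos).symm⟩
        rw [← hc, hcc, Nat.succ_mul, Nat.succ_mul] at hU
        rw [hcc, Nat.add_sub_cancel]
        omega

/-- After scale a fewer than m / b ^ a vertices are uncovered. Multiplied by b ^ (a + 1) this is
below b * m, which with the surplus m explains the requirement (b + 1) * m in `hΛa`. Once b ^ a ≥ m
nothing is uncovered. -/
theorem IsCovering.exists_full {S : Finset W} {φ : W → V} {dem : V → ℕ}
    (h : IsCovering G m k pt root D Λ sc Br S φ dem ∅)
    (hT : IsParentMap pt root rk Dl) (hk : b + Dl + 1 ≤ k) (hm : 0 < m) (hb : 2 ≤ b)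
    (hjoin : ∀ A B : Finset V, m ≤ #A → m ≤ #B → ∃ x ∈ A, ∃ y ∈ B, G.Adj x y)
    (hbig : ∀ Y : Finset V, m < #Y → Fintype.card V ≤ #(G.nbhd Y) + m)
    (hΛ : IsGadgetFamily pt root Λ sc Br) (hVW : Fintype.card W = Fintype.card V)
    (hD : 4 * (m + b * m) + m + 2 * m * k ≤ #D) (hΛD : 2 * #D ≤ #Λ)
    (hΛ0 : #D + m ≤ #{l ∈ Λ | sc l = 0})
    (hΛa : ∀ a, b ^ a < m → (b + 1) * m ≤ #{l ∈ Λ | sc l = a + 1} * b ^ (a + 1)) :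
    ∃ S' φ' dem' used', IsCovering G m k pt root D Λ sc Br S' φ' dem' used' ∧
      D ⊆ S'.image φ' := by
  have key : ∀ a, ∃ S' φ' dem' used', IsCovering G m k pt root D Λ sc Br S' φ' dem' used' ∧
      (∀ l ∈ used', sc l ≤ a) ∧ #(D \ S'.image φ') * b ^ a < m := by
    intro a
    induction a with
    | zero =>
      refine h.exists_scale hT hk hm hb hjoin hbig hΛ hVW hD hΛD
        (by rw [pow_zero]; nlinarith) (by simp) ?_
      have : #(D \ S.image φ) ≤ #D := card_le_card sdiff_subset
      simp only [pow_zero, mul_one, sdiff_empty]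
      omega
    | succ a ih =>
      obtain ⟨S', φ', dem', used', h', hu, hlt⟩ := ih
      by_cases hba : b ^ a < m
      · have h1 := hΛa a hba
        have h2 : ({l ∈ Λ \ used' | sc l = a + 1} : Finset W) = {l ∈ Λ | sc l = a + 1} := by
          ext l
          simp only [mem_filter, mem_sdiff]
          refine ⟨fun h => ⟨h.1.1, h.2⟩, fun h => ⟨⟨h.1, fun hl => ?_⟩, h.2⟩⟩
          have := hu l hl; omega
        refine h'.exists_scale hT hk hm hb hjoin hbig hΛ hVW hD hΛD
          (by rw [pow_succ, mul_comm]; exact Nat.mul_le_mul_left _ hba.le)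
          (fun l hl => (hu l hl).trans (Nat.le_succ _)) ?_
        rw [h2]
        have h3 : #(D \ S'.image φ') * b ^ (a + 1) ≤ b * m := by
          rw [pow_succ, ← mul_assoc, mul_comm b]
          exact Nat.mul_le_mul_right _ hlt.le
        rw [Nat.succ_mul] at h1
        omega
      · have hz : #(D \ S'.image φ') = 0 := by
          by_contra hne
          have : b ^ a ≤ #(D \ S'.image φ') * b ^ a := Nat.le_mul_of_pos_left _ (by omega)
          omega
        exact ⟨S', φ', dem', used', h', fun l hl => (hu l hl).trans (Nat.le_succ _), by
          rw [hz]; simpa using hm⟩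
  -- Scale m is large enough because m < b ^ m.
  obtain ⟨S', φ', dem', used', h', -, hlt⟩ := key m
  refine ⟨S', φ', dem', used', h', ?_⟩
  have h1 : m < b ^ m := Nat.lt_pow_self (by omega)
  rw [← sdiff_eq_empty_iff_subset, ← card_eq_zero]
  by_contra hne
  have : b ^ m ≤ #(D \ S'.image φ') * b ^ m := Nat.le_mul_of_pos_left _ (by omega)
  omega

/-- Start by sending the root to a vertex outside `D`; the factor k + 1 instead of k in `hexp` pays
for this occupied vertex. All vertices outside the branches, among them every attachment point, are
then embedded away from `D`. -/
theorem exists_isCovering (hT : IsParentMap pt root rk Dl) (hk : Dl + 1 ≤ k) (hm : 0 < m)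
    (hbig : ∀ Y : Finset V, m < #Y → Fintype.card V ≤ #(G.nbhd Y) + m)
    (hΛ : IsGadgetFamily pt root Λ sc Br) (hVW : Fintype.card W = Fintype.card V)
    (hD : m + 2 * m * k ≤ #D) (hΛD : 2 * #D ≤ #Λ)
    (hexp : ∀ Y : Finset V, #Y ≤ 2 * m → (k + 1) * #Y ≤ #(G.nbhd Y \ D)) :
    ∃ S φ dem, IsCovering G m k pt root D Λ sc Br S φ dem ∅ := by
  have hΛn : #Λ ≤ Fintype.card W := card_le_univ _
  obtain ⟨v₀, hv₀⟩ : ∃ v, v ∉ D := by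
    by_contra hc
    push Not at hc
    have : D = univ := eq_univ_iff_forall.2 hc
    have h1 : #D = Fintype.card V := by rw [this, card_univ]
    omega
  have h0 : IsPartialEmb G m k pt root D {root} (fun _ => v₀) (fun _ => k) := by
    refine ⟨by simp, by simp, by simp, by simp, ?_, by simp, by simp, fun w _ => by omega⟩
    intro Y hY
    rcases Y.eq_empty_or_nonempty with rfl | hYne
    · simp
    have h1 := hexp Y hY
    have h2 : 0 < #Y := card_pos.2 hYne
    have h3 : #((G.nbhd Y \ D).erase v₀) + 1 ≥ #(G.nbhd Y \ D) := by
      have := pred_card_le_card_erase (s := G.nbhd Y \ D) (a := v₀); omega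
    have h4 : G.nbhd Y \ (({root} : Finset W).image (fun _ => v₀) ∪ D)
        = (G.nbhd Y \ D).erase v₀ := by
      ext v; simp only [image_singleton, mem_sdiff, mem_union, mem_singleton, not_or, mem_erase]
      tauto
    rw [h4, sum_const, smul_eq_mul, mul_comm]
    rw [Nat.succ_mul] at h1
    omega
  set S' : Finset W := univ \ Λ.biUnion Br with hS'
  have hmem : ∀ w, w ∈ S' ↔ ∀ l ∈ Λ, w ∉ Br l := by intro w; simp [hS']
  have hleaf : ∀ l ∈ Λ, l ∉ S' := fun l hl hc =>
    (hmem l).1 hc l hl (hΛ.path_mem l hl 0 (by omega))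
  have hS'c : #S' + #Λ ≤ Fintype.card W := by
    rw [← card_union_of_disjoint (disjoint_right.2 hleaf)]
    exact card_le_univ _
  have hroot : root ∈ S' := (hmem _).2 hΛ.root_notMem
  obtain ⟨φ, dem, h1, h2, h3⟩ := h0.exists_extend hT hk hm hbig S' (by simpa using hroot)
    (fun w hw hwr => (hmem _).2 fun l hl hc => (hmem w).1 hw l hl (hΛ.closed l hl w hwr hc)) (by
      have e1 : #(S' \ {root}) = #S' - 1 := by
        rw [card_sdiff_of_subset (by simpa using hroot)]; simp
      have e2 := card_union_le (({root} : Finset W).image fun _ => v₀) D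
      have e3 : #(({root} : Finset W).image fun _ => v₀) ≤ 1 := by simp
      have e4 := card_pos.2 ⟨_, hroot⟩
      omega)
  refine ⟨S', φ, dem, h1, by simp, by simp, fun w hw hwD => ?_, hleaf, fun l hl _ => ?_,
    fun l hl => (hmem _).2 fun l' hl' => hΛ.attach_notMem l hl l' hl'⟩
  · by_cases hwr : w = root
    · rw [h2 w (by simp [hwr])] at hwD; exact absurd hwD hv₀
    · exact absurd hwD (h3 w (by simp [hw, hwr]))
  · exact disjoint_left.2 fun w hw => (hmem w).1 hw l hl

/-! ### Completing the embedding by Hall's theorem -/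

/-- Spanning embedding of a rooted tree with gadgets at all scales into an expander. -/
theorem exists_spanning_embedding (hT : IsParentMap pt root rk Dl) (hk : b + Dl + 1 ≤ k)
    (hm : 0 < m) (hb : 2 ≤ b)
    (hjoin : ∀ A B : Finset V, m ≤ #A → m ≤ #B → ∃ x ∈ A, ∃ y ∈ B, G.Adj x y)
    (hbig : ∀ Y : Finset V, m < #Y → Fintype.card V ≤ #(G.nbhd Y) + m)
    (hΛ : IsGadgetFamily pt root Λ sc Br) (hVW : Fintype.card W = Fintype.card V)
    (hD : 4 * (m + b * m) + m + 2 * m * k ≤ #D) (hΛD : 2 * #D ≤ #Λ)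
    (hΛ0 : #D + m ≤ #{l ∈ Λ | sc l = 0})
    (hΛa : ∀ a, b ^ a < m → (b + 1) * m ≤ #{l ∈ Λ | sc l = a + 1} * b ^ (a + 1))
    (hexp : ∀ Y : Finset V, #Y ≤ 2 * m → (k + 1) * #Y ≤ #(G.nbhd Y \ D))
    (hdom : ∀ A : Finset V, #A ≤ m → #A ≤ #(G.nbhd A ∩ D)) :
    ∃ φ : W → V, Function.Injective φ ∧ ∀ w, w ≠ root → G.Adj (φ w) (φ (pt w)) := by
  obtain ⟨S₀, φ₀, dem₀, h₀⟩ := exists_isCovering hT (by omega) hm hbig hΛ hVW (by omega) hΛD hexp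
  obtain ⟨S₁, φ₁, dem₁, used, h₁, hcov⟩ := h₀.exists_full hT hk hm hb hjoin hbig hΛ hVW hD hΛD
    hΛ0 hΛa
  -- the parents of used leaves are in bijection with `D`
  have hptinj : ∀ l ∈ used, ∀ l' ∈ used, pt l = pt l' → l = l' := by
    intro l hl l' hl' e
    by_contra hne
    have h1 := hΛ.path_mem l (h₁.used_subset hl) 1 (by omega)
    have h2 := hΛ.path_mem l' (h₁.used_subset hl') 1 (by omega)
    rw [Function.iterate_one] at h1 h2
    exact disjoint_left.1 (hΛ.disjoint l (h₁.used_subset hl) l' (h₁.used_subset hl') hne) h1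
      (e ▸ h2)
  have husedD : used.image (fun l => φ₁ (pt l)) = D := by
    ext v
    rw [mem_image]
    constructor
    · rintro ⟨l, hl, rfl⟩; exact (h₁.used_mem l hl).2
    · intro hv
      obtain ⟨w, hw, rfl⟩ := mem_image.1 (hcov hv)
      obtain ⟨l, hl, rfl⟩ := h₁.covered w hw hv
      exact ⟨l, hl, rfl⟩
  have husedc : #used = #D := by
    rw [← husedD, card_image_of_injOn]
    intro l hl l' hl' e
    exact hptinj l hl l' hl' (h₁.emb.inj (h₁.used_mem l hl).1 (h₁.used_mem l' hl').1 e)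
  -- Once `D` is covered, nothing is reserved any more: the unused gadgets are embedded like the
  -- rest of the tree, and only the used leaves are held back.
  set S' : Finset W := univ \ used with hS'
  have hS'mem : ∀ w, w ∈ S' ↔ w ∉ used := by intro w; simp [hS']
  have hsub : S₁ ⊆ S' := fun w hw => (hS'mem w).2 fun hc =>
    h₁.leaf_notMem w (h₁.used_subset hc) hw
  have hS'c : #S' + #D = Fintype.card V := by
    rw [hS', card_sdiff_of_subset (subset_univ _), card_univ, husedc, hVW]
    have : #D ≤ Fintype.card V := card_le_univ _
    omega
  obtain ⟨φ₂, dem₂, h₂, hφ₂, -⟩ := h₁.emb.exists_extend hT (by omega) hm hbig S' hsub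
    (fun w _ hwr => (hS'mem _).2 fun hc => hΛ.leaf _ (h₁.used_subset hc) w hwr rfl) (by
      rw [union_eq_left.2 hcov, card_image_of_injOn h₁.emb.inj, card_sdiff_of_subset hsub]
      have := card_le_card hsub
      omega)
  have hDS : D ⊆ S'.image φ₂ := by
    intro v hv
    obtain ⟨w, hw, rfl⟩ := mem_image.1 (hcov hv)
    exact mem_image.2 ⟨w, hsub hw, hφ₂ w hw⟩
  set U : Finset V := univ \ S'.image φ₂ with hUdef
  have hUc : #U = #D := by
    rw [hUdef, card_sdiff_of_subset (subset_univ _), card_univ, card_image_of_injOn h₂.inj]; omega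
  have hE := h₂.ext
  rw [union_eq_left.2 hDS] at hE
  have hdem1 : ∀ v, 1 ≤ dem₂ v := by
    intro v
    by_cases hv : v ∈ S'.image φ₂
    · obtain ⟨w, hw, rfl⟩ := mem_image.1 hv
      have h1 := h₂.dem_used w hw
      have h2 := hT.card_children w
      have h3 : #{c ∈ S' | c ≠ root ∧ pt c = w} ≤ #{c | c ≠ root ∧ pt c = w} :=
        card_le_card (filter_subset_filter _ (subset_univ _))
      omega
    · rw [h₂.dem_free v hv]; omega
  -- Hall's condition
  have hhall : ∀ s : Finset {l // l ∈ used},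
      #s ≤ #(s.biUnion fun l => G.neighborFinset (φ₂ (pt l.1)) ∩ U) := by
    intro s
    set Y : Finset V := s.image fun l => φ₂ (pt l.1) with hY
    have hYc : #Y = #s := by
      refine card_image_of_injective _ fun l l' e => ?_
      have e' : φ₂ (pt l.1) = φ₂ (pt l'.1) := e
      rw [hφ₂ _ (h₁.used_mem l.1 l.2).1, hφ₂ _ (h₁.used_mem l'.1 l'.2).1] at e'
      exact Subtype.ext (hptinj _ l.2 _ l'.2
        (h₁.emb.inj (h₁.used_mem l.1 l.2).1 (h₁.used_mem l'.1 l'.2).1 e'))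
    have hYD : Y ⊆ D := by
      intro v hv
      obtain ⟨l, _, rfl⟩ := mem_image.1 hv
      rw [hφ₂ _ (h₁.used_mem l.1 l.2).1]; exact (h₁.used_mem l.1 l.2).2
    have hN : s.biUnion (fun l => G.neighborFinset (φ₂ (pt l.1)) ∩ U) = G.nbhd Y ∩ U := by
      ext v
      simp only [mem_biUnion, mem_inter, SimpleGraph.mem_nbhd, SimpleGraph.mem_neighborFinset, hY,
        mem_image]
      constructor
      · rintro ⟨l, hl, h1, h2⟩; exact ⟨⟨_, ⟨l, hl, rfl⟩, h1⟩, h2⟩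
      · rintro ⟨⟨_, ⟨l, hl, rfl⟩, h1⟩, h2⟩; exact ⟨l, hl, h1, h2⟩
    have hNU : G.nbhd Y ∩ U = G.nbhd Y \ S'.image φ₂ := by
      ext v; simp [hUdef]
    rw [hN, ← hYc]
    by_cases hsmall : #Y ≤ 2 * m
    · rw [hNU]
      refine le_trans ?_ (hE Y hsmall)
      rw [card_eq_sum_ones]
      exact sum_le_sum fun v _ => hdem1 v
    -- For large `Y`, the set `A` of unreached vertices has at most m elements. Its neighbours in
    -- `D` avoid `Y` and number at least |A|, so |Y| ≤ |D| - |A| = |U| - |A|.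
    · set A := U \ G.nbhd Y with hA
      have hAm : #A ≤ m := by
        by_contra hc
        obtain ⟨x, hx, y, hy, hxy⟩ := hjoin Y A (by omega) (by omega)
        exact (mem_sdiff.1 hy).2 (SimpleGraph.mem_nbhd.2 ⟨x, hx, hxy⟩)
      have h1 := hdom A hAm
      have h2 : Disjoint (G.nbhd A ∩ D) Y := by
        rw [disjoint_left]
        intro v hv hvY
        obtain ⟨x, hx, hxv⟩ := SimpleGraph.mem_nbhd.1 (mem_inter.1 hv).1
        exact (mem_sdiff.1 hx).2 (SimpleGraph.mem_nbhd.2 ⟨v, hvY, hxv.symm⟩)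
      have h3 := card_le_card (union_subset (inter_subset_right (s₁ := G.nbhd A) (s₂ := D)) hYD)
      rw [card_union_of_disjoint h2] at h3
      have h4 := card_inter_add_card_sdiff U (G.nbhd Y)
      rw [inter_comm, ← hA] at h4
      omega
  obtain ⟨f, hfinj, hf⟩ := (all_card_le_biUnion_card_iff_exists_injective
    (fun l : {l // l ∈ used} => G.neighborFinset (φ₂ (pt l.1)) ∩ U)).1 hhall
  have hfU : ∀ l, f l ∉ S'.image φ₂ := fun l => by
    have := (mem_inter.1 (hf l)).2
    simpa [hUdef] using this
  have hfA : ∀ l, G.Adj (φ₂ (pt l.1)) (f l) := fun l => by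
    simpa using (mem_inter.1 (hf l)).1
  classical
  set φ : W → V := fun w => if hw : w ∈ used then f ⟨w, hw⟩ else φ₂ w with hφ
  have hφu : ∀ w (hw : w ∈ used), φ w = f ⟨w, hw⟩ := fun w hw => by simp [hφ, hw]
  have hφn : ∀ w, w ∉ used → φ w = φ₂ w := fun w hw => by simp [hφ, hw]
  refine ⟨φ, fun w w' e => ?_, fun w hw => ?_⟩
  · by_cases h1 : w ∈ used <;> by_cases h2 : w' ∈ used
    · rw [hφu w h1, hφu w' h2] at e
      exact congrArg Subtype.val (hfinj e)
    · rw [hφu w h1, hφn w' h2] at e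
      exact absurd (e ▸ mem_image_of_mem φ₂ ((hS'mem w').2 h2)) (hfU _)
    · rw [hφn w h1, hφu w' h2] at e
      exact absurd (e ▸ mem_image_of_mem φ₂ ((hS'mem w).2 h1)) (hfU ⟨w', h2⟩)
    · rw [hφn w h1, hφn w' h2] at e
      exact h₂.inj ((hS'mem w).2 h1) ((hS'mem w').2 h2) e
  · have hpw : pt w ∉ used := fun hc => hΛ.leaf _ (h₁.used_subset hc) w hw rfl
    rw [hφn _ hpw]
    by_cases h1 : w ∈ used
    · rw [hφu w h1]; exact (hfA ⟨w, h1⟩).symm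
    · rw [hφn w h1]; exact h₂.adj w ((hS'mem w).2 h1) hw
end

/-! ### Rearranging a rooted tree inside a cluster -/

/-- `par` is the parent map of a rooted tree with depth function `dp` and at most `Δ` children per
vertex; by convention `root` is its own parent. -/
structure IsRootedTree {W : Type*} [Fintype W] [DecidableEq W] (par : W → W) (root : W)
    (dp : W → ℕ) (Δ : ℕ) : Prop where
  par_root : par root = root
  depth : ∀ w, w ≠ root → dp (par w) + 1 = dp w
  card_children : ∀ w, #{c | c ≠ root ∧ par c = w} ≤ Δ

/-- The local rearrangement of a rooted tree on a connected set `carrier` with topmost vertex `top`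
that has all its exits below the single vertex `bot`: the vertices of `carrier` other than `top`
get new parents `map v`, in such a way that the square of the new tree contains the old one, and
the new tree has a pendant branch, disjoint from `top` and `bot`, containing the first
`2 * scale + 1` ancestors of a leaf. -/
structure ClusterGadget {W : Type*} (par : W → W) (root : W) (dp : W → ℕ) where
  carrier : Finset W
  top : W
  bot : W
  scale : ℕ
  map : W → W
  rank : W → ℕ
  leaf : W
  branch : Finset W
  top_mem : top ∈ carrier
  exit : ∀ v, v ≠ root → v ∉ carrier → par v ∈ carrier → par v = bot
  ne_root : ∀ v ∈ carrier, v ≠ top → v ≠ root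
  par_mem : ∀ v ∈ carrier, v ≠ top → par v ∈ carrier
  depth_le : ∀ v ∈ carrier, dp top ≤ dp v
  map_top : map top = top
  map_mem : ∀ v ∈ carrier, map v ∈ carrier
  rank_lt : ∀ v ∈ carrier, v ≠ top → rank (map v) < rank v
  near : ∀ v ∈ carrier, v ≠ top →
    par v = map v ∨ par v = map (map v) ∨ map (par v) = v ∨ map (map (par v)) = v
  children : ∀ w, ∃ e, ∀ v ∈ carrier, v ≠ top → map v = w → par v = w ∨ v = e
  branch_subset : branch ⊆ carrier
  top_notMem : top ∉ branch
  bot_notMem : bot ∉ branch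
  path_mem : ∀ j ≤ 2 * scale + 1, map^[j] leaf ∈ branch
  attach_notMem : map^[2 * scale + 2] leaf ∉ branch
  closed : ∀ v ∈ carrier, map v ∈ branch → v ∈ branch
  isLeaf : ∀ v ∈ carrier, map v ≠ leaf

section
variable {W : Type*} [Fintype W] [DecidableEq W] {par : W → W} {root : W} {dp : W → ℕ} {Δ : ℕ}

theorem IsRootedTree.exists_iterate (hT : IsRootedTree par root dp Δ) {C : Finset W} {x : W}
    (hroot : ∀ v ∈ C, v ≠ x → v ≠ root) (hC : ∀ v ∈ C, v ≠ x → par v ∈ C) (v : W) (hv : v ∈ C) :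
    ∃ q, par^[q] v = x ∧ (∀ j ≤ q, par^[j] v ∈ C) ∧ (∀ j < q, par^[j] v ≠ x) ∧
      (∀ j ≤ q, dp (par^[j] v) + j = dp v) := by
  induction hd : dp v using Nat.strong_induction_on generalizing v with
  | _ d ih =>
    by_cases hvx : v = x
    · refine ⟨0, by simpa using hvx, fun j hj => ?_, by simp, fun j hj => ?_⟩
      · obtain rfl : j = 0 := by omega
        exact hv
      · obtain rfl : j = 0 := by omega
        exact hd
    · have h1 := hT.depth v (hroot v hv hvx)
      obtain ⟨q, h2, h3, h4, h5⟩ := ih (dp (par v)) (by omega) (par v) (hC v hv hvx) rfl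
      refine ⟨q + 1, by rwa [Function.iterate_succ_apply], ?_, ?_, ?_⟩
      · rintro (_ | j) hj
        · exact hv
        · rw [Function.iterate_succ_apply]; exact h3 j (by omega)
      · rintro (_ | j) hj
        · exact hvx
        · rw [Function.iterate_succ_apply]; exact h4 j (by omega)
      · rintro (_ | j) hj
        · exact hd
        · rw [Function.iterate_succ_apply]; have := h5 j (by omega); omega

/-- The path from `bot` up to `top` can be rearranged to a zigzag path so that `bot` becomes a child
of `top`. -/
theorem IsRootedTree.exists_zigzag (hT : IsRootedTree par root dp Δ) {C : Finset W} {x b : W}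
    (hroot : ∀ v ∈ C, v ≠ x → v ≠ root) (hC : ∀ v ∈ C, v ≠ x → par v ∈ C) (hx : x ∈ C)
    (hb : b ∈ C) :
    ∃ (f : W → W) (rank : W → ℕ), f x = x ∧ f b = x ∧ (∀ v ∈ C, f v ∈ C) ∧
      (∀ v ∈ C, v ≠ x → rank (f v) < rank v) ∧
      (∀ v ∈ C, v ≠ x → par v = f v ∨ par v = f (f v) ∨ f (par v) = v ∨ f (f (par v)) = v) ∧
      ∀ w, ∃ e, ∀ v ∈ C, v ≠ x → f v = w → par v = w ∨ v = e := by
  obtain ⟨q, hq, hqC, hqx, hqd⟩ := hT.exists_iterate hroot hC b hb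
  set P : ℕ → W := fun j => par^[j] b with hP
  have hPq : P q = x := hq
  have hPC : ∀ j ≤ q, P j ∈ C := hqC
  have hPx : ∀ j < q, P j ≠ x := hqx
  have hPd : ∀ j ≤ q, dp (P j) + j = dp b := hqd
  have hPs : ∀ j, par (P j) = P (j + 1) := fun j => (Function.iterate_succ_apply' par j b).symm
  have hPinj : ∀ i ≤ q, ∀ j ≤ q, P i = P j → i = j := by
    intro i hi j hj e
    have h1 := hPd i hi
    have h2 := hPd j hj
    rw [e] at h1
    omega
  have hb0 : P 0 = b := rfl
  clear_value P
  clear hP hq hqC hqx hqd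
  -- The zigzag P q, P 0, P (q - 1), P 1, P (q - 2), …: `σ j` is the index just before `j` in this
  -- order. Consecutive indices are two places apart, except at the middle, where they are adjacent.
  set σ : ℕ → ℕ := fun j => if q ≤ 2 * j then q - j - 1 else q - j with hσ
  set f : W → W := fun v => if v = x then x else
    if ∃ j < q, P j = v then P (σ (dp b - dp v)) else par v with hf
  -- On the path, the rank is the position in the zigzag; other vertices keep their parents and are
  -- ranked by depth, above the whole path.
  set rank : W → ℕ := fun v => if ∃ j ≤ q, P j = v then
    (if q ≤ 2 * (dp b - dp v) then 2 * (q - (dp b - dp v)) else 2 * (dp b - dp v) + 1)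
    else 2 * q + 2 + dp v with hrank
  have hPj : ∀ j ≤ q, dp b - dp (P j) = j := fun j hj => by have := hPd j hj; omega
  have hfx : f x = x := by simp [hf]
  have hfP : ∀ j < q, f (P j) = P (σ j) := by
    intro j hj
    simp only [hf]
    rw [if_neg (hPx j hj), if_pos ⟨j, hj, rfl⟩, hPj j hj.le]
  have hfo : ∀ v, v ≠ x → (¬ ∃ j < q, P j = v) → f v = par v := by
    intro v hv hn
    simp only [hf]
    rw [if_neg hv, if_neg hn]
  have hrP : ∀ j ≤ q, rank (P j) = if q ≤ 2 * j then 2 * (q - j) else 2 * j + 1 := by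
    intro j hj
    simp only [hrank]
    rw [if_pos ⟨j, hj, rfl⟩, hPj j hj]
  have hro : ∀ v, (¬ ∃ j ≤ q, P j = v) → rank v = 2 * q + 2 + dp v := by
    intro v hn
    simp only [hrank]
    rw [if_neg hn]
  have hσle : ∀ j < q, σ j ≤ q := by
    intro j hj; simp only [hσ]; split_ifs <;> omega
  have hσinj : ∀ i < q, ∀ j < q, σ i = σ j → i = j := by
    intro i hi j hj e
    simp only [hσ] at e
    split_ifs at e <;> omega
  clear_value f rank
  refine ⟨f, rank, hfx, ?_, ?_, ?_, ?_, ?_⟩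
  · rcases Nat.eq_zero_or_pos q with h0 | h0
    · rw [h0] at hPq
      rw [← hb0, hPq, hfx]
    · rw [← hb0, hfP 0 h0, ← hPq]
      congr 1
      simp only [hσ]; rw [if_neg (by omega)]; omega
  · intro v hv
    by_cases hvx : v = x
    · rw [hvx, hfx]; exact hx
    by_cases hon : ∃ j < q, P j = v
    · obtain ⟨j, hj, rfl⟩ := hon
      rw [hfP j hj]; exact hPC _ (hσle j hj)
    · rw [hfo v hvx hon]; exact hC v hv hvx
  · intro v hv hvx
    by_cases hon : ∃ j < q, P j = v
    · obtain ⟨j, hj, rfl⟩ := hon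
      rw [hfP j hj, hrP _ (hσle j hj), hrP j hj.le]
      simp only [hσ]
      split_ifs <;> omega
    · have hon' : ¬ ∃ j ≤ q, P j = v := by
        rintro ⟨j, hj, e⟩
        rcases hj.lt_or_eq with h | rfl
        · exact hon ⟨j, h, e⟩
        · exact hvx (e.symm.trans hPq)
      rw [hfo v hvx hon, hro v hon']
      have h1 := hT.depth v (hroot v hv hvx)
      by_cases hpn : ∃ j ≤ q, P j = par v
      · obtain ⟨j, hj, e⟩ := hpn
        rw [← e, hrP j hj]
        split_ifs <;> omega
      · rw [hro _ hpn]; omega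
  · intro v hv hvx
    by_cases hon : ∃ j < q, P j = v
    · obtain ⟨j, hj, rfl⟩ := hon
      rw [hPs j]
      by_cases h1 : q ≤ 2 * j
      · right; left
        have e1 : σ j = q - j - 1 := if_pos h1
        have e2 : σ (q - j - 1) = j + 1 := by
          simp only [hσ]; rw [if_neg (by omega)]; omega
        rw [hfP j hj, e1, hfP _ (by omega), e2]
      · have e1 : σ j = q - j := if_neg h1
        by_cases h2 : q = 2 * j + 1
        · left
          rw [hfP j hj, e1]; congr 1; omega
        by_cases h3 : q = 2 * j + 2
        · right; right; left
          rw [hfP _ (by omega)]; congr 1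
          simp only [hσ]; rw [if_pos (by omega)]; omega
        · right; right; right
          have e2 : σ (j + 1) = q - j - 1 := by
            simp only [hσ]; rw [if_neg (by omega)]; omega
          have e3 : σ (q - j - 1) = j := by
            simp only [hσ]; rw [if_pos (by omega)]; omega
          rw [hfP _ (by omega), e2, hfP _ (by omega), e3]
    · left; exact (hfo v hvx hon).symm
  · intro w
    by_cases hw : ∃ j < q, f (P j) = w
    · obtain ⟨i, hi, hiw⟩ := hw
      refine ⟨P i, fun v hv hvx hfv => ?_⟩
      by_cases hon : ∃ j < q, P j = v
      · obtain ⟨j, hj, rfl⟩ := hon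
        right
        rw [← hiw, hfP j hj, hfP i hi] at hfv
        rw [hσinj j hj i hi (hPinj _ (hσle j hj) _ (hσle i hi) hfv)]
      · left; rw [← hfv, hfo v hvx hon]
    · refine ⟨x, fun v hv hvx hfv => ?_⟩
      left
      by_cases hon : ∃ j < q, P j = v
      · obtain ⟨j, hj, rfl⟩ := hon
        exact absurd ⟨j, hj, hfv⟩ hw
      · rw [← hfv, hfo v hvx hon]

/-- Since `b` becomes a child of `x`, the branch below any other vertex avoids both. New degrees are
bounded, so few vertices are close to `x` or `b`, and a large cluster contains a vertex that is far
from them. -/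
theorem IsRootedTree.exists_clusterGadget (hT : IsRootedTree par root dp Δ) {C : Finset W} {x b : W}
    (hroot : ∀ v ∈ C, v ≠ x → v ≠ root) (hC : ∀ v ∈ C, v ≠ x → par v ∈ C) (hx : x ∈ C)
    (hb : b ∈ C) (hexit : ∀ v, v ≠ root → v ∉ C → par v ∈ C → par v = b) (a : ℕ)
    (hcard : 2 * (Δ + 2) ^ (2 * a + 1) < #C) :
    ∃ g : ClusterGadget par root dp, g.carrier = C ∧ g.scale = a := by
  obtain ⟨f, rank, hfx, hfb, hfC, hrk, hnear, hch⟩ := hT.exists_zigzag hroot hC hx hb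
  -- the number of vertices close to `x` or `b` is small
  have hball : ∀ K, ∃ S : Finset W, #S ≤ 2 * (Δ + 2) ^ K ∧ x ∈ S ∧ b ∈ S ∧
      (∀ v ∈ S, v ≠ x → v ≠ b → f v ∈ S) ∧
      ∀ v ∈ C, v ∉ S → ∀ j ≤ K, f^[j] v ∈ C ∧ f^[j] v ≠ x ∧ f^[j] v ≠ b := by
    intro K
    induction K with
    | zero =>
      refine ⟨{x, b}, by simpa using card_le_two, by simp, by simp, ?_, ?_⟩
      · intro v hv h1 h2; simp [h1, h2] at hv
      · intro v hv hvS j hj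
        obtain rfl : j = 0 := by omega
        simp only [mem_insert, mem_singleton, not_or] at hvS
        exact ⟨hv, hvS⟩
    | succ K ih =>
      obtain ⟨S, h1, h2, h3, h4, h5⟩ := ih
      refine ⟨S ∪ S.biUnion fun w => {v ∈ C | v ≠ x ∧ f v = w}, ?_, by simp [h2], by simp [h3],
        ?_, ?_⟩
      · refine (card_union_le _ _).trans ?_
        have : #(S.biUnion fun w => {v ∈ C | v ≠ x ∧ f v = w}) ≤ #S * (Δ + 1) := by
          refine card_biUnion_le_card_mul _ _ _ fun w _ => ?_
          obtain ⟨e, he⟩ := hch w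
          refine le_trans (card_le_card
            (t := insert e ({c | c ≠ root ∧ par c = w} : Finset W))
            fun v hv => ?_) ((card_insert_le _ _).trans (Nat.succ_le_succ (hT.card_children w)))
          simp only [mem_filter] at hv
          rcases he v hv.1 hv.2.1 hv.2.2 with h | h
          · simp [h, hroot v hv.1 hv.2.1]
          · simp [h]
        rw [pow_succ]
        nlinarith
      · intro v hv hvx hvb
        rcases mem_union.1 hv with hv | hv
        · exact mem_union_left _ (h4 v hv hvx hvb)
        · obtain ⟨w, hw, hv⟩ := mem_biUnion.1 hv
          simp only [mem_filter] at hv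
          rw [hv.2.2]; exact mem_union_left _ hw
      · intro v hv hvS j hj
        rw [mem_union, not_or] at hvS
        rcases j with _ | j
        · exact h5 v hv hvS.1 0 (by omega)
        · rw [Function.iterate_succ_apply]
          refine h5 (f v) (hfC v hv) (fun hc => hvS.2 (mem_biUnion.2 ⟨f v, hc, ?_⟩)) j (by omega)
          exact mem_filter.2 ⟨hv, fun e => hvS.1 (by rw [e]; exact h2), rfl⟩
  obtain ⟨S, hS, hxS, hbS, hSf, hSp⟩ := hball (2 * a + 1)
  have hne : (C \ S).Nonempty := by
    rw [← card_pos]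
    have := le_card_sdiff S C
    omega
  -- Maximal rank makes `l` a leaf: a child of `l` would have larger rank, and it would lie outside
  -- `S` because `S` is closed under parents (apart from those of `x` and `b`).
  obtain ⟨l, hl, hmax⟩ := exists_max_image (C \ S) rank hne
  rw [mem_sdiff] at hl
  have hpath := hSp l hl.1 hl.2
  set u := f^[2 * a + 1] l with hu
  have hrkle : ∀ j, ∀ v ∈ C, f^[j] v ∈ C ∧ rank (f^[j] v) ≤ rank v := by
    intro j
    induction j with
    | zero => exact fun v hv => ⟨hv, le_rfl⟩
    | succ j ih =>
      intro v hv
      have h1 := ih v hv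
      rw [Function.iterate_succ_apply']
      refine ⟨hfC _ h1.1, ?_⟩
      by_cases e : f^[j] v = x
      · rw [e, hfx, ← e]; exact h1.2
      · exact (hrk _ h1.1 e).le.trans h1.2
  have hux := hpath (2 * a + 1) le_rfl
  rw [← hu] at hux
  have hxit : ∀ j, f^[j] x = x := Function.iterate_fixed hfx
  classical
  refine ⟨⟨C, x, b, a, f, rank, l, {w ∈ C | ∃ j, f^[j] w = u}, hx, hexit, hroot, hC, ?_, hfx, hfC, hrk,
    hnear, hch, filter_subset _ _, ?_, ?_, ?_, ?_, ?_, ?_⟩, rfl, rfl⟩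
  · intro v hv
    obtain ⟨q, h1, h2, h3, h4⟩ := hT.exists_iterate hroot hC v hv
    have := h4 q le_rfl
    rw [h1] at this
    omega
  · intro hc
    obtain ⟨j, hj⟩ := (mem_filter.1 hc).2
    rw [hxit] at hj
    exact hux.2.1 hj.symm
  · intro hc
    obtain ⟨j, hj⟩ := (mem_filter.1 hc).2
    rcases j with _ | j
    · exact hux.2.2 hj.symm
    · rw [Function.iterate_succ_apply, hfb, hxit] at hj
      exact hux.2.1 hj.symm
  · intro j hj
    refine mem_filter.2 ⟨(hpath j hj).1, 2 * a + 1 - j, ?_⟩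
    rw [← Function.iterate_add_apply, Nat.sub_add_cancel hj]
  · intro hc
    obtain ⟨j, hj⟩ := (mem_filter.1 hc).2
    rw [Function.iterate_succ_apply', ← hu] at hj
    have h1 := (hrkle j (f u) (hfC u hux.1)).2
    rw [hj] at h1
    have h2 := hrk u hux.1 hux.2.1
    omega
  · intro v hv hc
    obtain ⟨j, hj⟩ := (mem_filter.1 hc).2
    exact mem_filter.2 ⟨hv, j + 1, by rwa [Function.iterate_succ_apply]⟩
  · intro v hv e
    have hlx := hpath 0 (by omega)
    rw [Function.iterate_zero_apply] at hlx
    have hvx : v ≠ x := fun h => by rw [h, hfx] at e; exact hlx.2.1 e.symm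
    have hvb : v ≠ b := fun h => by rw [h, hfb] at e; exact hlx.2.1 e.symm
    have hvS : v ∉ S := fun hc => hl.2 (by rw [← e]; exact hSf v hc hvx hvb)
    have h1 := hmax v (mem_sdiff.2 ⟨hv, hvS⟩)
    have h2 := hrk v hv hvx
    rw [e] at h2
    omega
end

/-! ### Disjoint clusters and gadgets at all scales -/

section
variable {W : Type*} [Fintype W] [DecidableEq W] {par : W → W} {root : W} {dp : W → ℕ} {Δ : ℕ}

/-- Decomposition of most of a rooted tree of bounded degree into connected clusters of bounded
size, such that every vertex that hangs below a cluster is itself the top of a cluster. -/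
theorem IsRootedTree.exists_clusters (hT : IsRootedTree par root dp Δ) {M : ℕ} (hM : 0 < M)
    (R : Finset W) (hR : ∀ w ∈ R, w ≠ root → par w ∈ R) :
    ∃ (I : Finset W) (C : W → Finset W), I ⊆ R ∧
      (∀ x ∈ I, C x ⊆ R ∧ x ∈ C x ∧ M ≤ #(C x) ∧ #(C x) ≤ Δ * M + 1 ∧
        ∀ v ∈ C x, v ≠ x → v ≠ root ∧ par v ∈ C x) ∧
      (∀ x ∈ I, ∀ y ∈ I, x ≠ y → Disjoint (C x) (C y)) ∧
      (∀ x ∈ I, ∀ v ∈ R, v ≠ root → v ∉ C x → par v ∈ C x → v ∈ I) ∧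
      #R ≤ (Δ * M + 1) * #I + M := by
  classical
  induction hn : #R using Nat.strong_induction_on generalizing R with
  | _ n ih =>
    by_cases hRM : #R < M
    · exact ⟨∅, fun _ => ∅, by simp, by simp, by simp, by simp, by omega⟩
    have hRpar : ∀ w ∈ R, par w ∈ R := by
      intro w hw
      by_cases h : w = root
      · rw [h, hT.par_root, ← h]; exact hw
      · exact hR w hw h
    have hRit : ∀ j, ∀ w ∈ R, par^[j] w ∈ R := by
      intro j
      induction j with
      | zero => exact fun w hw => hw
      | succ j ih => intro w hw; rw [Function.iterate_succ_apply]; exact ih _ (hRpar w hw)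
    have hRroot : ∀ w ∈ R, ∃ j, par^[j] w = root := fun w hw =>
      let ⟨q, h, _⟩ := hT.exists_iterate (fun _ _ h => h) hR w hw
      ⟨q, h⟩
    set dsc : W → Finset W := fun x => {w ∈ R | ∃ j, par^[j] w = x} with hdsc
    have hmem : ∀ x w, w ∈ dsc x ↔ w ∈ R ∧ ∃ j, par^[j] w = x := by intro x w; simp [hdsc]
    have hrootR : root ∈ R := by
      obtain ⟨w, hw⟩ := card_pos.1 (show 0 < #R by omega)
      obtain ⟨j, hj⟩ := hRroot w hw
      rw [← hj]; exact hRit j w hw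
    have hX : ({x ∈ R | M ≤ #(dsc x)} : Finset W).Nonempty := by
      refine ⟨root, mem_filter.2 ⟨hrootR, ?_⟩⟩
      have : dsc root = R := by
        ext w; rw [hmem]; exact ⟨fun h => h.1, fun h => ⟨h, hRroot w h⟩⟩
      rw [this]; omega
    -- A deepest vertex with at least M descendants: its children have fewer than M each, so cutting
    -- off its subtree costs at most Δ * M + 1 vertices.
    obtain ⟨x, hx, hmax⟩ := exists_max_image _ dp hX
    obtain ⟨hxR, hxM⟩ := mem_filter.1 hx
    have hxx : x ∈ dsc x := (hmem x x).2 ⟨hxR, 0, rfl⟩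
    have hxC : ∀ v ∈ dsc x, v ≠ x → v ≠ root ∧ par v ∈ dsc x := by
      intro v hv hvx
      obtain ⟨h1, j, hj⟩ := (hmem x v).1 hv
      refine ⟨fun e => hvx ?_, ?_⟩
      · rw [e, Function.iterate_fixed hT.par_root] at hj
        rw [e, hj]
      · rcases j with _ | j
        · exact absurd hj hvx
        · exact (hmem x _).2 ⟨hRpar v h1, j, by rwa [Function.iterate_succ_apply] at hj⟩
    have hxcard : #(dsc x) ≤ Δ * M + 1 := by
      have hsub : dsc x ⊆ insert x (({c | c ≠ root ∧ par c = x} : Finset W).biUnion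
          fun c => if M ≤ #(dsc c) then ∅ else dsc c) := by
        intro w hw
        by_cases hwx : w = x
        · rw [hwx]; exact mem_insert_self _ _
        obtain ⟨h1, hj⟩ := (hmem x w).1 hw
        obtain ⟨j, hj'⟩ : ∃ j, Nat.find hj = j + 1 :=
          Nat.exists_eq_succ_of_ne_zero fun h => hwx (by
            have := Nat.find_spec hj; rwa [h] at this)
        have h2 := Nat.find_spec hj
        have h3 : par^[j] w ≠ x := Nat.find_min hj (by omega)
        rw [hj', Function.iterate_succ_apply'] at h2
        have h4 : par^[j] w ≠ root := fun e => h3 (by rw [← h2, e, hT.par_root])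
        have h5 := hT.depth _ h4
        rw [h2] at h5
        refine mem_insert_of_mem (mem_biUnion.2 ⟨par^[j] w, by simp [h4, h2], ?_⟩)
        rw [if_neg]
        · exact (hmem _ _).2 ⟨h1, j, rfl⟩
        · intro hc
          have := hmax _ (mem_filter.2 ⟨hRit j w h1, hc⟩)
          omega
      refine (card_le_card hsub).trans ((card_insert_le _ _).trans (Nat.succ_le_succ ?_))
      refine (card_biUnion_le_card_mul _ _ M fun c _ => ?_).trans
        (Nat.mul_le_mul_right _ (hT.card_children x))
      split_ifs with h
      · simp
      · omega
    have hdR : dsc x ⊆ R := filter_subset _ _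
    have hcR : #(R \ dsc x) + #(dsc x) = #R := card_sdiff_add_card_eq_card hdR
    obtain ⟨I, C, h1, h2, h3, h4, h5⟩ := ih #(R \ dsc x) (by omega) (R \ dsc x) (by
      intro w hw hwr
      rw [mem_sdiff] at hw ⊢
      refine ⟨hR w hw.1 hwr, fun hc => hw.2 ?_⟩
      obtain ⟨-, j, hj⟩ := (hmem x _).1 hc
      exact (hmem x w).2 ⟨hw.1, j + 1, by rwa [Function.iterate_succ_apply]⟩) rfl
    have hxI : x ∉ I := fun hc => (mem_sdiff.1 (h1 hc)).2 hxx
    have hCx : Function.update C x (dsc x) x = dsc x := Function.update_self _ _ _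
    have hCo : ∀ y ∈ I, Function.update C x (dsc x) y = C y := fun y hy =>
      Function.update_of_ne (fun e => hxI (by rw [← e]; exact hy)) _ _
    have hdis : ∀ y ∈ I, Disjoint (C y) (dsc x) := fun y hy =>
      disjoint_left.2 fun w hw => (mem_sdiff.1 ((h2 y hy).1 hw)).2
    refine ⟨insert x I, Function.update C x (dsc x), ?_, ?_, ?_, ?_, ?_⟩
    · exact insert_subset hxR (h1.trans sdiff_subset)
    · intro y hy
      rcases mem_insert.1 hy with rfl | hy
      · rw [hCx]; exact ⟨hdR, hxx, hxM, hxcard, hxC⟩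
      · rw [hCo y hy]
        have := h2 y hy
        exact ⟨this.1.trans sdiff_subset, this.2⟩
    · intro y hy z hz hyz
      rcases mem_insert.1 hy with ey | hyI <;> rcases mem_insert.1 hz with ez | hzI
      · exact absurd (ey.trans ez.symm) hyz
      · rw [ey, hCx, hCo z hzI]; exact (hdis z hzI).symm
      · rw [ez, hCx, hCo y hyI]; exact hdis y hyI
      · rw [hCo y hyI, hCo z hzI]; exact h3 y hyI z hzI hyz
    · intro y hy v hv hvr hvC hpv
      rcases mem_insert.1 hy with rfl | hy
      · rw [hCx] at hvC hpv
        obtain ⟨-, j, hj⟩ := (hmem y _).1 hpv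
        exact absurd ((hmem y v).2 ⟨hv, j + 1, by rwa [Function.iterate_succ_apply]⟩) hvC
      · rw [hCo y hy] at hvC hpv
        by_cases hvx : v ∈ dsc x
        · by_cases e : v = x
          · rw [e]; exact mem_insert_self _ _
          · exact absurd (hxC v hvx e).2 (disjoint_left.1 (hdis y hy) hpv)
        · exact mem_insert_of_mem (h4 y hy v (mem_sdiff.2 ⟨hv, hvx⟩) hvr hvC hpv)
    · rw [card_insert_of_notMem hxI, Nat.mul_succ]
      omega

/-- Many disjoint gadgets of a given scale, avoiding a given small set. -/
theorem IsRootedTree.exists_clusterGadgets (hT : IsRootedTree par root dp Δ) {M N a : ℕ}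
    (hM : 2 * (Δ + 2) ^ (2 * a + 1) < M) (F : Finset W)
    (hN : 2 * (Δ * M + 1) * (N + #F) + M ≤ Fintype.card W) :
    ∃ 𝓖 : Finset (ClusterGadget par root dp), #𝓖 = N ∧
      (∀ g ∈ 𝓖, g.scale = a ∧ #g.carrier ≤ Δ * M + 1 ∧ Disjoint g.carrier F) ∧
      ∀ g ∈ 𝓖, ∀ g' ∈ 𝓖, g ≠ g' → Disjoint g.carrier g'.carrier := by
  classical
  obtain ⟨I, C, -, h2, h3, h4, h5⟩ := hT.exists_clusters (M := M) (by omega) univ (by simp)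
  set ex : W → Finset W := fun x => {v ∈ I | v ≠ root ∧ v ∉ C x ∧ par v ∈ C x} with hex
  -- Each cluster top hangs below at most one cluster, so clusters have at most one exit on average;
  -- hence at most half of them have two or more.
  have hexsum : ∑ x ∈ I, #(ex x) ≤ #I := by
    rw [← card_biUnion]
    · refine card_le_card fun v hv => ?_
      obtain ⟨x, _, hv⟩ := mem_biUnion.1 hv
      exact (mem_filter.1 hv).1
    · intro x hx y hy hxy
      refine disjoint_left.2 fun v hv hv' => ?_
      exact disjoint_left.1 (h3 x hx y hy hxy) (mem_filter.1 hv).2.2.2 (mem_filter.1 hv').2.2.2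
  set I₁ : Finset W := {x ∈ I | #(ex x) ≤ 1} with hI₁
  have hI₁c : #I ≤ 2 * #I₁ := by
    have e1 : #I₁ + #{x ∈ I | ¬ #(ex x) ≤ 1} = #I := card_filter_add_card_filter_not _
    have e2 : #{x ∈ I | ¬ #(ex x) ≤ 1} * 2 ≤ ∑ x ∈ I, #(ex x) := by
      rw [← smul_eq_mul]
      refine le_trans ?_ (sum_le_sum_of_subset (filter_subset (fun x => ¬ #(ex x) ≤ 1) I))
      exact card_nsmul_le_sum _ _ _ fun x hx => by have := (mem_filter.1 hx).2; omega
    omega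
  have hmeet : #{x ∈ I₁ | ¬ Disjoint (C x) F} ≤ #F := by
    have hne : ∀ x, ¬ Disjoint (C x) F → ∃ v ∈ F, v ∈ C x := by
      intro x hx
      rw [not_disjoint_iff] at hx
      obtain ⟨v, h, h'⟩ := hx
      exact ⟨v, h', h⟩
    choose! p hp using hne
    refine card_le_card_of_injOn p (fun x hx => (hp x (mem_filter.1 hx).2).1) ?_
    intro x hx y hy e
    have hx' := mem_filter.1 hx
    have hy' := mem_filter.1 hy
    by_contra hxy
    have h6 := (hp y hy'.2).2
    rw [← e] at h6
    exact disjoint_left.1 (h3 x (mem_filter.1 hx'.1).1 y (mem_filter.1 hy'.1).1 hxy)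
      (hp x hx'.2).2 h6
  have hI₂c : N ≤ #{x ∈ I₁ | Disjoint (C x) F} := by
    have e1 : #{x ∈ I₁ | Disjoint (C x) F} + #{x ∈ I₁ | ¬ Disjoint (C x) F} = #I₁ :=
      card_filter_add_card_filter_not _
    rw [card_univ] at h5
    have e2 : 2 * (Δ * M + 1) * (N + #F) ≤ 2 * (Δ * M + 1) * #I₁ := by
      have := Nat.mul_le_mul_left (Δ * M + 1) hI₁c
      nlinarith
    have := Nat.le_of_mul_le_mul_left e2 (by positivity)
    omega
  obtain ⟨J, hJ, hJc⟩ := exists_subset_card_eq hI₂c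
  have hJ' : ∀ x ∈ J, x ∈ I ∧ #(ex x) ≤ 1 ∧ Disjoint (C x) F := by
    intro x hx
    have := hJ hx
    simp only [hI₁, mem_filter] at this
    tauto
  have hg : ∀ x, x ∈ J → ∃ g : ClusterGadget par root dp, g.carrier = C x ∧ g.scale = a := by
    intro x hx
    obtain ⟨hxI, hxe, -⟩ := hJ' x hx
    obtain ⟨-, hxx, hxM, -, hxC⟩ := h2 x hxI
    obtain ⟨b, hb, hbe⟩ : ∃ b ∈ C x, ∀ v, v ≠ root → v ∉ C x → par v ∈ C x → par v = b := by
      rcases (ex x).eq_empty_or_nonempty with he | ⟨u, hu⟩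
      · refine ⟨x, hxx, fun v h6 h7 h8 => ?_⟩
        have : v ∈ ex x := mem_filter.2 ⟨h4 x hxI v (mem_univ _) h6 h7 h8, h6, h7, h8⟩
        simp [he] at this
      · refine ⟨par u, (mem_filter.1 hu).2.2.2, fun v h6 h7 h8 => ?_⟩
        have : v ∈ ex x := mem_filter.2 ⟨h4 x hxI v (mem_univ _) h6 h7 h8, h6, h7, h8⟩
        rw [card_le_one.1 hxe v this u hu]
    exact hT.exists_clusterGadget (fun v hv hvx => (hxC v hv hvx).1)
      (fun v hv hvx => (hxC v hv hvx).2) hxx hb hbe a (by omega)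
  choose g hgC hga using hg
  have hginj : Function.Injective fun x : {x // x ∈ J} => g x.1 x.2 := by
    intro x y e
    by_contra hxy
    have h6 := hgC x.1 x.2
    have e' : g x.1 x.2 = g y.1 y.2 := e
    rw [e', hgC y.1 y.2] at h6
    have h7 := h3 x.1 (hJ' _ x.2).1 y.1 (hJ' _ y.2).1 fun h => hxy (Subtype.ext h)
    rw [h6, disjoint_self_iff_empty] at h7
    have h8 := (h2 x.1 (hJ' _ x.2).1).2.1
    rw [h7] at h8
    simp at h8
  refine ⟨J.attach.image fun x => g x.1 x.2, ?_, ?_, ?_⟩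
  · rw [card_image_of_injective _ hginj, card_attach, hJc]
  · intro γ hγ
    obtain ⟨x, -, rfl⟩ := mem_image.1 hγ
    rw [hgC]
    exact ⟨hga _ _, (h2 _ (hJ' _ x.2).1).2.2.2.1, (hJ' _ x.2).2.2⟩
  · intro γ hγ γ' hγ' hne
    obtain ⟨x, -, rfl⟩ := mem_image.1 hγ
    obtain ⟨y, -, rfl⟩ := mem_image.1 hγ'
    rw [hgC, hgC]
    exact h3 _ (hJ' _ x.2).1 _ (hJ' _ y.2).1 fun h => hne (by congr 1)

end

section
variable {W : Type*} [Fintype W] [DecidableEq W] {par : W → W} {root : W} {dp : W → ℕ} {Δ : ℕ}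

/-- Rearranging a rooted tree inside pairwise disjoint clusters yields a rooted tree with a family
of gadgets. -/
theorem IsRootedTree.exists_gadgetFamily (hT : IsRootedTree par root dp Δ)
    (𝓖 : Finset (ClusterGadget par root dp))
    (hdisj : ∀ g ∈ 𝓖, ∀ g' ∈ 𝓖, g ≠ g' → Disjoint g.carrier g'.carrier) :
    ∃ (pt : W → W) (rk : W → ℕ) (Λ : Finset W) (sc : W → ℕ) (Br : W → Finset W),
      IsParentMap pt root rk (Δ + 1) ∧ IsGadgetFamily pt root Λ sc Br ∧ pt root = root ∧
      (∀ w, w ≠ root →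
        par w = pt w ∨ par w = pt (pt w) ∨ pt (par w) = w ∨ pt (pt (par w)) = w) ∧
      ∀ a, #{g ∈ 𝓖 | g.scale = a} ≤ #{l ∈ Λ | sc l = a} := by
  classical
  have huniq : ∀ g ∈ 𝓖, ∀ g' ∈ 𝓖, ∀ w, w ∈ g.carrier → w ∈ g'.carrier → g = g' := by
    intro g hg g' hg' w h h'
    by_contra hne
    exact disjoint_left.1 (hdisj g hg g' hg' hne) h h'
  obtain ⟨own, hown, hnone⟩ : ∃ own : W → Option (ClusterGadget par root dp),
      (∀ g ∈ 𝓖, ∀ w ∈ g.carrier, own w = some g) ∧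
      ∀ w, (∀ g ∈ 𝓖, w ∉ g.carrier) → own w = none := by
    refine ⟨fun w => if h : ∃ g ∈ 𝓖, w ∈ g.carrier then some h.choose else none, ?_, ?_⟩
    · intro g hg w hw
      have h : ∃ g ∈ 𝓖, w ∈ g.carrier := ⟨g, hg, hw⟩
      simp only [dif_pos h, Option.some.injEq]
      exact huniq _ h.choose_spec.1 g hg w h.choose_spec.2 hw
    · intro w hw
      exact dif_neg fun ⟨g, hg, h⟩ => hw g hg h
  obtain ⟨B, hBpos, hB⟩ : ∃ B, 0 < B ∧ ∀ g ∈ 𝓖, ∀ w, g.rank w < B := by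
    refine ⟨𝓖.sup (fun g => univ.sup g.rank) + 1, Nat.succ_pos _, fun g hg w => Nat.lt_succ_of_le ?_⟩
    exact (le_sup (f := g.rank) (mem_univ w)).trans (le_sup (f := fun g => univ.sup g.rank) hg)
  set pt : W → W := fun w => (own w).elim (par w) fun g => if w = g.top then par w else g.map w
    with hpt
  -- Lexicographic order: depth of the cluster top first, then the rank within the cluster, with `B`
  -- exceeding all ranks.
  set rk : W → ℕ := fun w => (own w).elim (B * dp w) fun g => B * dp g.top + g.rank w with hrk
  have hpin : ∀ g ∈ 𝓖, ∀ w ∈ g.carrier, w ≠ g.top → pt w = g.map w := by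
    intro g hg w hw hwt
    simp only [hpt, hown g hg w hw, Option.elim, if_neg hwt]
  have hpout : ∀ w, (∀ g ∈ 𝓖, w ∈ g.carrier → w = g.top) → pt w = par w := by
    intro w hw
    by_cases h : ∃ g ∈ 𝓖, w ∈ g.carrier
    · obtain ⟨g, hg, h⟩ := h
      simp only [hpt, hown g hg w h, Option.elim, if_pos (hw g hg h)]
    · push Not at h
      simp only [hpt, hnone w h, Option.elim]
  have hcases : ∀ w, (∃ g ∈ 𝓖, w ∈ g.carrier ∧ w ≠ g.top) ∨
      ∀ g ∈ 𝓖, w ∈ g.carrier → w = g.top := by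
    intro w
    by_cases h : ∃ g ∈ 𝓖, w ∈ g.carrier ∧ w ≠ g.top
    · exact Or.inl h
    · push Not at h
      exact Or.inr h
  have hproot : pt root = root := by
    rw [hpout root fun g hg h => ?_, hT.par_root]
    by_contra hne
    exact g.ne_root root h hne rfl
  have hrin : ∀ g ∈ 𝓖, ∀ w ∈ g.carrier, rk w = B * dp g.top + g.rank w := by
    intro g hg w hw
    simp only [hrk, hown g hg w hw, Option.elim]
  have hrout : ∀ w, (∀ g ∈ 𝓖, w ∉ g.carrier) → rk w = B * dp w := by
    intro w hw
    simp only [hrk, hnone w hw, Option.elim]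
  have hit : ∀ g ∈ 𝓖, ∀ j ≤ 2 * g.scale + 2, pt^[j] g.leaf = g.map^[j] g.leaf := by
    intro g hg j
    induction j with
    | zero => exact fun _ => rfl
    | succ j ih =>
      intro hj
      rw [Function.iterate_succ_apply', Function.iterate_succ_apply', ih (by omega)]
      have h := g.path_mem j (by omega)
      exact hpin g hg _ (g.branch_subset h) fun e => g.top_notMem (by rw [← e]; exact h)
  have hleafB : ∀ g : ClusterGadget par root dp, g.leaf ∈ g.branch := fun g => by
    simpa using g.path_mem 0 (by omega)
  have hleafC : ∀ g : ClusterGadget par root dp, g.leaf ∈ g.carrier := fun g =>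
    g.branch_subset (hleafB g)
  have hownl : ∀ g ∈ 𝓖, own g.leaf = some g := fun g hg => hown g hg _ (hleafC g)
  set sc : W → ℕ := fun l => (own l).elim 0 fun g => g.scale with hsc
  set Br : W → Finset W := fun l => (own l).elim ∅ fun g => g.branch with hBr
  have hscl : ∀ g ∈ 𝓖, sc g.leaf = g.scale := fun g hg => by
    simp only [hsc, hownl g hg, Option.elim]
  have hBrl : ∀ g ∈ 𝓖, Br g.leaf = g.branch := fun g hg => by
    simp only [hBr, hownl g hg, Option.elim]
  have hattC : ∀ g : ClusterGadget par root dp, g.map^[2 * g.scale + 2] g.leaf ∈ g.carrier := by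
    intro g
    rw [Function.iterate_succ_apply']
    exact g.map_mem _ (g.branch_subset (g.path_mem _ le_rfl))
  -- a vertex whose new parent lies in a branch lies in the same cluster
  have hstay : ∀ g ∈ 𝓖, ∀ w, w ≠ root → pt w ∈ g.branch →
      w ∈ g.carrier ∧ w ≠ g.top ∧ pt w = g.map w := by
    intro g hg w hwr hw
    rcases hcases w with ⟨g', hg', h1, h2⟩ | h
    · have h3 := hpin g' hg' w h1 h2
      have h4 : g' = g := huniq g' hg' g hg (pt w) (by rw [h3]; exact g'.map_mem w h1)
        (g.branch_subset hw)
      subst h4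
      exact ⟨h1, h2, h3⟩
    · rw [hpout w h] at hw ⊢
      by_cases hwC : w ∈ g.carrier
      · have e := h g hg hwC
        have h5 := g.depth_le _ (g.branch_subset hw)
        have h6 := hT.depth w hwr
        rw [← e] at h5
        omega
      · rw [g.exit w hwr hwC (g.branch_subset hw)] at hw
        exact absurd hw g.bot_notMem
  refine ⟨pt, rk, 𝓖.image ClusterGadget.leaf, sc, Br, ⟨?_, ?_⟩, ⟨?_, ?_, ?_, ?_, ?_, ?_, ?_⟩, hproot,
    ?_, ?_⟩
  · intro w hwr
    rcases hcases w with ⟨g, hg, h1, h2⟩ | h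
    · rw [hpin g hg w h1 h2, hrin g hg w h1, hrin g hg _ (g.map_mem w h1)]
      exact Nat.add_lt_add_left (g.rank_lt w h1 h2) _
    · have h3 : B * dp w ≤ rk w := by
        by_cases hw : ∃ g ∈ 𝓖, w ∈ g.carrier
        · obtain ⟨g, hg, hw⟩ := hw
          rw [hrin g hg w hw, ← h g hg hw]
          exact Nat.le_add_right _ _
        · push Not at hw
          rw [hrout w hw]
      refine lt_of_lt_of_le ?_ h3
      rw [hpout w h, ← hT.depth w hwr, Nat.mul_succ]
      by_cases hw : ∃ g ∈ 𝓖, par w ∈ g.carrier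
      · obtain ⟨g, hg, hw⟩ := hw
        rw [hrin g hg _ hw]
        exact Nat.add_lt_add_of_le_of_lt (Nat.mul_le_mul_left _ (g.depth_le _ hw)) (hB g hg _)
      · push Not at hw
        rw [hrout _ hw]
        omega
  · intro w
    have key : ∃ e, ∀ c, c ≠ root → pt c = w → par c = w ∨ c = e := by
      by_cases hw : ∃ g ∈ 𝓖, w ∈ g.carrier
      · obtain ⟨g, hg, hw⟩ := hw
        obtain ⟨e, he⟩ := g.children w
        refine ⟨e, fun c hcr hc => ?_⟩
        rcases hcases c with ⟨g', hg', h1, h2⟩ | h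
        · have h3 := hpin g' hg' c h1 h2
          have h4 : g' = g := huniq g' hg' g hg w (by rw [← hc, h3]; exact g'.map_mem c h1) hw
          subst h4
          exact he c h1 h2 (by rw [← h3, hc])
        · left; rw [← hc, hpout c h]
      · refine ⟨w, fun c hcr hc => ?_⟩
        rcases hcases c with ⟨g', hg', h1, h2⟩ | h
        · have h3 := hpin g' hg' c h1 h2
          exact absurd ⟨g', hg', by rw [← hc, h3]; exact g'.map_mem c h1⟩ hw
        · left; rw [← hc, hpout c h]
    obtain ⟨e, he⟩ := key
    refine le_trans (card_le_card (t := insert e ({c | c ≠ root ∧ par c = w} : Finset W))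
      fun c hc => ?_) ((card_insert_le _ _).trans (Nat.succ_le_succ (hT.card_children w)))
    simp only [mem_filter, mem_univ, true_and] at hc
    rcases he c hc.1 hc.2 with h | h
    · simp [h, hc.1]
    · simp [h]
  · intro l hl w hwr e
    obtain ⟨g, hg, rfl⟩ := mem_image.1 hl
    obtain ⟨h1, h2, h3⟩ := hstay g hg w hwr (by rw [e]; exact hleafB g)
    exact g.isLeaf w h1 (by rw [← h3, e])
  · intro l hl j hj
    obtain ⟨g, hg, rfl⟩ := mem_image.1 hl
    rw [hscl g hg] at hj
    rw [hBrl g hg, hit g hg j (by omega)]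
    exact g.path_mem j hj
  · intro l hl l' hl' hc
    obtain ⟨g, hg, rfl⟩ := mem_image.1 hl
    obtain ⟨g', hg', rfl⟩ := mem_image.1 hl'
    rw [hscl g hg, hBrl g' hg', hit g hg _ le_rfl] at hc
    have : g = g' := huniq g hg g' hg' _ (hattC g) (g'.branch_subset hc)
    subst this
    exact g.attach_notMem hc
  · intro l hl w hwr hw
    obtain ⟨g, hg, rfl⟩ := mem_image.1 hl
    rw [hBrl g hg] at hw ⊢
    obtain ⟨h1, h2, h3⟩ := hstay g hg w hwr hw
    exact g.closed w h1 (by rw [← h3]; exact hw)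
  · intro l hl hc
    obtain ⟨g, hg, rfl⟩ := mem_image.1 hl
    rw [hBrl g hg] at hc
    by_cases e : root = g.top
    · exact g.top_notMem (by rw [← e]; exact hc)
    · exact g.ne_root root (g.branch_subset hc) e rfl
  · intro l hl l' hl' hne
    obtain ⟨g, hg, rfl⟩ := mem_image.1 hl
    obtain ⟨g', hg', rfl⟩ := mem_image.1 hl'
    rw [hBrl g hg, hBrl g' hg']
    exact disjoint_of_subset_left g.branch_subset (disjoint_of_subset_right g'.branch_subset
      (hdisj g hg g' hg' fun e => hne (by rw [e])))
  · intro l hl l' hl' _ e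
    obtain ⟨g, hg, rfl⟩ := mem_image.1 hl
    obtain ⟨g', hg', rfl⟩ := mem_image.1 hl'
    rw [hscl g hg, hscl g' hg', hit g hg _ le_rfl, hit g' hg' _ le_rfl] at e
    rw [huniq g hg g' hg' _ (hattC g) (by rw [e]; exact hattC g')]
  · intro w hwr
    rcases hcases w with ⟨g, hg, h1, h2⟩ | h
    · have e1 := hpin g hg w h1 h2
      have hm := fun v hv (hne : v ≠ g.top) => hpin g hg v hv hne
      rcases g.near w h1 h2 with h | h | h | h
      · left; rw [h, e1]
      · by_cases h3 : g.map w = g.top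
        · left; rw [e1, h, h3, g.map_top]
        · right; left; rw [e1, hm _ (g.map_mem w h1) h3, h]
      · have h3 : par w ≠ g.top := fun e => h2 (by rw [e, g.map_top] at h; exact h.symm)
        right; right; left
        rw [hm _ (g.par_mem w h1 h2) h3, h]
      · have h3 : par w ≠ g.top := fun e => h2 (by
          rw [e, g.map_top, g.map_top] at h; exact h.symm)
        have h4 : g.map (par w) ≠ g.top := fun e => h2 (by rw [e, g.map_top] at h; exact h.symm)
        right; right; right
        rw [hm _ (g.par_mem w h1 h2) h3, hm _ (g.map_mem _ (g.par_mem w h1 h2)) h4, h]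
    · left; rw [hpout w h]
  · intro a
    refine card_le_card_of_injOn ClusterGadget.leaf (fun g hg => ?_) fun g hg g' hg' e => ?_
    · have hg' := mem_filter.1 hg
      exact mem_filter.2 ⟨mem_image_of_mem _ hg'.1, by rw [hscl g hg'.1, hg'.2]⟩
    · exact huniq g (mem_filter.1 hg).1 g' (mem_filter.1 hg').1 _ (hleafC g) (by
        rw [e]; exact hleafC g')

/-- Pairwise disjoint gadgets at all scales, in geometrically decreasing numbers. -/
theorem IsRootedTree.exists_all_scales (hT : IsRootedTree par root dp Δ) {μ m N₀ : ℕ}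
    (hμ : μ = 2 * (Δ + 2) ^ 2) (hm : 25 * μ ^ 3 * m ≤ Fintype.card W)
    (h0 : 2 * μ ^ 2 * (N₀ + 8 * m * μ ^ 3) + μ ≤ Fintype.card W) :
    ∃ 𝓖 : Finset (ClusterGadget par root dp),
      (∀ g ∈ 𝓖, ∀ g' ∈ 𝓖, g ≠ g' → Disjoint g.carrier g'.carrier) ∧
      N₀ ≤ #{g ∈ 𝓖 | g.scale = 0} ∧
      ∀ a, 4 * (m / μ ^ (4 * a)) ≤ #{g ∈ 𝓖 | g.scale = a + 1} := by
  classical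
  have hμ2 : 2 ≤ μ := by
    have : 0 < (Δ + 2) ^ 2 := by positivity
    omega
  -- Clusters of size at least μ ^ (a + 1) contain gadgets of scale a; by `hL` they have at most μ ^
  -- (a + 2) vertices.
  have hM : ∀ a, 2 * (Δ + 2) ^ (2 * a + 1) < μ ^ (a + 1) := by
    intro a
    rw [hμ, mul_pow, ← pow_mul, show 2 * (a + 1) = 2 * a + 1 + 1 by ring, pow_succ (Δ + 2)]
    have h1 : 2 ≤ 2 ^ (a + 1) := by rw [pow_succ]; have := Nat.one_le_two_pow (n := a); omega
    have h2 : 0 < (Δ + 2) ^ (2 * a + 1) := by positivity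
    calc 2 * (Δ + 2) ^ (2 * a + 1) < 2 * ((Δ + 2) ^ (2 * a + 1) * (Δ + 2)) := by nlinarith
      _ ≤ _ := Nat.mul_le_mul_right _ h1
  have hL : ∀ a, Δ * μ ^ (a + 1) + 1 ≤ μ ^ (a + 2) := by
    intro a
    have h1 : 1 ≤ μ ^ (a + 1) := Nat.one_le_pow _ _ (by omega)
    have h2 : Δ + 1 ≤ μ := by rw [hμ]; nlinarith
    rw [pow_succ μ (a + 1), mul_comm]
    nlinarith
  -- the union of two disjoint families
  have hunion : ∀ (𝓖 𝓗 : Finset (ClusterGadget par root dp)),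
      (∀ g ∈ 𝓖, ∀ g' ∈ 𝓖, g ≠ g' → Disjoint g.carrier g'.carrier) →
      (∀ g ∈ 𝓗, ∀ g' ∈ 𝓗, g ≠ g' → Disjoint g.carrier g'.carrier) →
      (∀ g ∈ 𝓗, Disjoint g.carrier (𝓖.biUnion ClusterGadget.carrier)) →
      ∀ g ∈ 𝓖 ∪ 𝓗, ∀ g' ∈ 𝓖 ∪ 𝓗, g ≠ g' → Disjoint g.carrier g'.carrier := by
    intro 𝓖 𝓗 h1 h2 h3 g hg g' hg' hne
    have h4 : ∀ g ∈ 𝓖, ∀ g' ∈ 𝓗, Disjoint g.carrier g'.carrier := fun g hg g' hg' =>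
      (disjoint_of_subset_right (subset_biUnion_of_mem ClusterGadget.carrier hg) (h3 g' hg')).symm
    rcases mem_union.1 hg with hg | hg <;> rcases mem_union.1 hg' with hg' | hg'
    · exact h1 g hg g' hg' hne
    · exact h4 g hg g' hg'
    · exact (h4 g' hg' g hg).symm
    · exact h2 g hg g' hg' hne
  -- Large scales come first: an occupied set F may spoil |F| clusters, so it must be small while
  -- clusters are large. Scale a + 1 takes about 4m / μ ^ (4a) clusters of size at most μ ^ (a + 3),
  -- so the occupied space decays like μ ^ (-3a).
  have key : ∀ t a, a + t = m → ∃ 𝓖 : Finset (ClusterGadget par root dp),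
      (∀ g ∈ 𝓖, ∀ g' ∈ 𝓖, g ≠ g' → Disjoint g.carrier g'.carrier) ∧
      (∀ a', a ≤ a' → 4 * (m / μ ^ (4 * a')) ≤ #{g ∈ 𝓖 | g.scale = a' + 1}) ∧
      μ ^ (3 * a) * #(𝓖.biUnion ClusterGadget.carrier) ≤ 8 * m * μ ^ 3 := by
    intro t
    induction t with
    | zero =>
      intro a ha
      refine ⟨∅, by simp, fun a' ha' => ?_, by simp⟩
      have h1 : m < μ ^ (4 * a') :=
        lt_of_le_of_lt (by omega : m ≤ 4 * a') (Nat.lt_pow_self (by omega))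
      rw [Nat.div_eq_of_lt h1]
      simp
    | succ t ih =>
      intro a ha
      obtain ⟨𝓖, h1, h2, h3⟩ := ih (a + 1) (by omega)
      set F := 𝓖.biUnion ClusterGadget.carrier with hF
      have h4 : μ ^ (3 * a) * #F ≤ 8 * m := by
        rw [show 3 * (a + 1) = 3 * a + 3 by ring, pow_add] at h3
        refine Nat.le_of_mul_le_mul_right ?_ (show 0 < μ ^ 3 by positivity)
        linarith
      have hμ3 : 8 ≤ μ ^ 3 := by
        calc 8 = 2 ^ 3 := by norm_num
          _ ≤ μ ^ 3 := Nat.pow_le_pow_left hμ2 3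
      by_cases hma : m < μ ^ (4 * a)
      · refine ⟨𝓖, h1, fun a' ha' => ?_, h4.trans (Nat.le_mul_of_pos_right _ (by positivity))⟩
        rcases ha'.lt_or_eq with h | rfl
        · exact h2 a' h
        · rw [Nat.div_eq_of_lt hma]; simp
      · set N := 4 * (m / μ ^ (4 * a)) with hN
        have h5 : N * μ ^ (4 * a) ≤ 4 * m := by
          have := Nat.div_mul_le_self m (μ ^ (4 * a))
          rw [hN]; linarith
        have h6 : μ ^ (3 * a) * (N * μ ^ (a + 3)) ≤ 4 * m * μ ^ 3 := by
          calc μ ^ (3 * a) * (N * μ ^ (a + 3)) = N * μ ^ (4 * a) * μ ^ 3 := by ring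
            _ ≤ _ := Nat.mul_le_mul_right _ h5
        have hpa : ∀ i j, i ≤ j → μ ^ i ≤ μ ^ j := fun i j h =>
          Nat.pow_le_pow_right (by omega) h
        have h7 : 2 * (Δ * μ ^ (a + 1 + 1) + 1) * (N + #F) + μ ^ (a + 1 + 1)
            ≤ Fintype.card W := by
          have e1 := hL (a + 1)
          have e2 : μ ^ (a + 3) * N ≤ 4 * m * μ ^ 3 :=
            le_trans (by
              rw [mul_comm]
              exact Nat.le_mul_of_pos_left _ (by positivity)) h6
          have e3 : μ ^ (a + 3) * #F ≤ 8 * m * μ ^ 3 := by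
            calc μ ^ (a + 3) * #F ≤ μ ^ (3 * a + 3) * #F :=
                  Nat.mul_le_mul_right _ (hpa _ _ (by omega))
              _ = μ ^ (3 * a) * #F * μ ^ 3 := by ring
              _ ≤ _ := Nat.mul_le_mul_right _ h4
          have e4 : μ ^ (a + 1 + 1) ≤ m * μ ^ 3 := by
            calc μ ^ (a + 1 + 1) ≤ μ ^ (4 * a + 3) := hpa _ _ (by omega)
              _ = μ ^ (4 * a) * μ ^ 3 := by ring
              _ ≤ _ := Nat.mul_le_mul_right _ (by omega)
          calc 2 * (Δ * μ ^ (a + 1 + 1) + 1) * (N + #F) + μ ^ (a + 1 + 1)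
              ≤ 2 * μ ^ (a + 3) * (N + #F) + μ ^ (a + 1 + 1) := by gcongr
            _ = 2 * (μ ^ (a + 3) * N) + 2 * (μ ^ (a + 3) * #F) + μ ^ (a + 1 + 1) := by ring
            _ ≤ 2 * (4 * m * μ ^ 3) + 2 * (8 * m * μ ^ 3) + m * μ ^ 3 := by gcongr
            _ = 25 * μ ^ 3 * m := by ring
            _ ≤ _ := hm
        obtain ⟨𝓗, h8, h9, h10⟩ := hT.exists_clusterGadgets (hM (a + 1)) F h7
        refine ⟨𝓖 ∪ 𝓗, hunion 𝓖 𝓗 h1 h10 fun g hg => (h9 g hg).2.2, fun a' ha' => ?_, ?_⟩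
        · rcases ha'.lt_or_eq with h | rfl
          · exact (h2 a' h).trans (card_le_card (filter_subset_filter _ subset_union_left))
          · rw [← hN, ← h8]
            exact card_le_card fun g hg => mem_filter.2 ⟨mem_union_right _ hg, (h9 g hg).1⟩
        · have h11 : #((𝓖 ∪ 𝓗).biUnion ClusterGadget.carrier) ≤ #F + N * μ ^ (a + 3) := by
            rw [union_biUnion]
            refine (card_union_le _ _).trans (Nat.add_le_add_left ?_ _)
            rw [← h8]
            exact card_biUnion_le_card_mul _ _ _ fun g hg => (h9 g hg).2.1.trans (hL (a + 1))
          calc μ ^ (3 * a) * #((𝓖 ∪ 𝓗).biUnion ClusterGadget.carrier)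
              ≤ μ ^ (3 * a) * (#F + N * μ ^ (a + 3)) := Nat.mul_le_mul_left _ h11
            _ = μ ^ (3 * a) * #F + μ ^ (3 * a) * (N * μ ^ (a + 3)) := by ring
            _ ≤ 8 * m + 4 * m * μ ^ 3 := add_le_add h4 h6
            _ ≤ 8 * m * μ ^ 3 := by nlinarith
  obtain ⟨𝓖, h1, h2, h3⟩ := key m 0 (by omega)
  rw [mul_zero, pow_zero, one_mul] at h3
  obtain ⟨𝓗, h8, h9, h10⟩ := hT.exists_clusterGadgets (N := N₀) (hM 0)
    (𝓖.biUnion ClusterGadget.carrier) (by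
      have e1 := hL 0
      rw [zero_add, pow_one] at e1 ⊢
      refine le_trans ?_ h0
      gcongr)
  refine ⟨𝓖 ∪ 𝓗, hunion 𝓖 𝓗 h1 h10 fun g hg => (h9 g hg).2.2, ?_, fun a => ?_⟩
  · rw [← h8]
    exact card_le_card fun g hg => mem_filter.2 ⟨mem_union_right _ hg, (h9 g hg).1⟩
  · exact (h2 a (by omega)).trans (card_le_card (filter_subset_filter _ subset_union_left))

end

/-! ### Rooting the tree and extracting expansion from the spectrum -/

/-- Rooting a finite tree. -/
theorem SimpleGraph.IsTree.exists_isRootedTree {W : Type*} [Fintype W] [DecidableEq W]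
    {T : SimpleGraph W} [DecidableRel T.Adj] (hT : T.IsTree) {Δ : ℕ} (hΔ : T.maxDegree ≤ Δ) :
    ∃ (par : W → W) (root : W) (dp : W → ℕ), IsRootedTree par root dp Δ ∧
      ∀ u v, T.Adj u v → (u ≠ root ∧ par u = v) ∨ (v ≠ root ∧ par v = u) := by
  classical
  obtain ⟨root⟩ := hT.connected.nonempty
  have hpar : ∀ w, ∃ p, (w = root → p = root) ∧
      (w ≠ root → T.Adj w p ∧ T.dist p root + 1 = T.dist w root) := by
    intro w
    by_cases hw : w = root
    · exact ⟨root, fun _ => rfl, fun h => absurd hw h⟩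
    · obtain ⟨p, hp⟩ := hT.connected.exists_walk_length_eq_dist w root
      cases p with
      | nil => exact absurd rfl hw
      | @cons _ v _ h q =>
        refine ⟨v, fun h => absurd h hw, fun _ => ⟨h, ?_⟩⟩
        rw [SimpleGraph.Walk.length_cons] at hp
        have h1 := SimpleGraph.dist_le q
        have h2 := hT.connected.dist_triangle (u := w) (v := v) (w := root)
        have h3 : T.dist w v = 1 := SimpleGraph.dist_eq_one_iff_adj.2 h
        omega
  choose par hpr hpa using hpar
  have hinj : Set.InjOn (fun w => s(w, par w)) ((univ : Finset W).erase root : Finset W) := by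
    intro w hw w' hw' e
    have h1 := (hpa w (by simpa using hw)).2
    have h2 := (hpa w' (by simpa using hw')).2
    have e' : s(w, par w) = s(w', par w') := e
    rw [Sym2.eq_iff] at e'
    rcases e' with ⟨h, -⟩ | ⟨h, h'⟩
    · exact h
    · rw [h'] at h1
      rw [← h] at h2
      omega
  -- The edges to parents are distinct and number |W| - 1, so they are all the edges of the tree.
  have himg : ((univ : Finset W).erase root).image (fun w => s(w, par w)) = T.edgeFinset := by
    refine eq_of_subset_of_card_le (fun e he => ?_) ?_
    · obtain ⟨w, hw, rfl⟩ := mem_image.1 he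
      rw [SimpleGraph.mem_edgeFinset, SimpleGraph.mem_edgeSet]
      exact (hpa w (by simpa using hw)).1
    · rw [card_image_of_injOn hinj, card_erase_of_mem (mem_univ _), card_univ]
      have := hT.card_edgeFinset
      omega
  refine ⟨par, root, fun w => T.dist w root, ⟨hpr root rfl, fun w hw => (hpa w hw).2, fun w => ?_⟩,
    fun u v huv => ?_⟩
  · refine le_trans ?_ ((T.degree_le_maxDegree w).trans hΔ)
    rw [← SimpleGraph.card_neighborFinset_eq_degree]
    refine card_le_card fun c hc => ?_
    simp only [mem_filter, mem_univ, true_and] at hc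
    rw [SimpleGraph.mem_neighborFinset, ← hc.2]
    exact (hpa c hc.1).1.symm
  · have h : s(u, v) ∈ ((univ : Finset W).erase root).image (fun w => s(w, par w)) := by
      rw [himg, SimpleGraph.mem_edgeFinset, SimpleGraph.mem_edgeSet]; exact huv
    obtain ⟨w, hw, e⟩ := mem_image.1 h
    have hw' : w ≠ root := by simpa using hw
    rcases Sym2.eq_iff.1 e with ⟨h1, h2⟩ | ⟨h1, h2⟩
    · left; subst h1; exact ⟨hw', h2⟩
    · right; subst h1; exact ⟨hw', h2⟩

theorem graphSquare_adj_of_adj_adj {V : Type*} {G : SimpleGraph V} {x y z : V} (hxy : G.Adj x y)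
    (hyz : G.Adj y z) (hne : x ≠ z) : (graphSquare G).Adj x z := by
  by_cases hxz : G.Adj x z
  · exact Or.inl hxz
  · right
    have h1 := SimpleGraph.dist_le (SimpleGraph.Walk.cons hxy (SimpleGraph.Walk.cons hyz .nil))
    have h2 : G.dist x z ≠ 1 := fun h => hxz (SimpleGraph.dist_eq_one_iff_adj.1 h)
    have h3 : 0 < G.dist x z := SimpleGraph.Reachable.pos_dist_of_ne
      ⟨SimpleGraph.Walk.cons hxy (SimpleGraph.Walk.cons hyz .nil)⟩ hne
    simp only [SimpleGraph.Walk.length_cons, SimpleGraph.Walk.length_nil] at h1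
    omega

section
variable {V : Type*} [Fintype V] [DecidableEq V] {G : SimpleGraph V} [DecidableRel G.Adj]
  {n d : ℕ} {lam : ℝ}

/-- Without edges between A and B, the mixing lemma gives d * √(|A||B|) ≤ λ * n, which contradicts λ
* n < d * m. -/
theorem IsNDLambdaGraph.exists_adj (h : IsNDLambdaGraph G n d lam) (hlam : lam < d)
    (hlam0 : 0 ≤ lam) {m : ℕ} (hm : lam * n < d * m) (A B : Finset V) (hA : m ≤ #A)
    (hB : m ≤ #B) : ∃ x ∈ A, ∃ y ∈ B, G.Adj x y := by
  by_contra hc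
  push Not at hc
  have hmix := h.mixing hlam hlam0 A B
  have hz : ∑ a ∈ A, (#(G.neighborFinset a ∩ B) : ℝ) = 0 := by
    refine sum_eq_zero fun a ha => ?_
    rw [Nat.cast_eq_zero, card_eq_zero, ← disjoint_iff_inter_eq_empty, disjoint_left]
    intro y hy hyB
    exact hc a ha y hyB (by simpa using hy)
  have hd : (0 : ℝ) < d := hlam0.trans_lt hlam
  have hm0 : (0 : ℝ) < m := by
    have : 0 < (d : ℝ) * m := lt_of_le_of_lt (by positivity) hm
    exact pos_of_mul_pos_right this hd.le
  have hn : (0 : ℝ) < n := by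
    have h1 : #A ≤ n := by rw [← h.card_eq]; exact card_le_univ _
    have h2 : (#A : ℝ) ≤ n := by exact_mod_cast h1
    have h3 : (m : ℝ) ≤ #A := by exact_mod_cast hA
    linarith
  rw [hz, zero_sub, abs_neg, abs_of_nonneg (by positivity), div_le_iff₀ hn] at hmix
  set r := √((#A : ℝ) * #B) with hr
  have hr2 : r * r = (#A : ℝ) * #B := Real.mul_self_sqrt (by positivity)
  have hmr : (m : ℝ) ≤ r := by
    refine Real.le_sqrt_of_sq_le ?_
    rw [sq]
    have h3 : (m : ℝ) ≤ #A := by exact_mod_cast hA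
    have h4 : (m : ℝ) ≤ #B := by exact_mod_cast hB
    gcongr
  rw [mul_assoc, ← hr2, ← mul_assoc] at hmix
  have h5 : d * r ≤ lam * n := by
    refine le_of_mul_le_mul_right (a := r) ?_ (hm0.trans_le hmr)
    linarith
  have h6 : (d : ℝ) * m ≤ d * r := by gcongr
  linarith

/-- If B, the neighbourhood of Y inside Z, were smaller than K * |Y|, it would still receive s * |Y|
edges from Y, more than the mixing lemma permits. -/
theorem IsNDLambdaGraph.card_le_card_nbhd_inter (h : IsNDLambdaGraph G n d lam) (hlam : lam < d)
    (hlam0 : 0 ≤ lam) {m s K : ℕ} (hK : 1 ≤ K)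
    (hs : (d : ℝ) * K * (2 * m) + lam * K * n < s * n) (Z : Finset V)
    (hZ : ∀ v, s ≤ #(G.neighborFinset v ∩ Z)) (Y : Finset V) (hY : #Y ≤ 2 * m) :
    K * #Y ≤ #(G.nbhd Y ∩ Z) := by
  by_contra hc
  push Not at hc
  have hY0 : 0 < #Y := by
    by_contra h0
    have : #Y = 0 := by omega
    simp [this] at hc
  set B := G.nbhd Y ∩ Z with hB
  have hmix := (abs_le.1 (h.mixing hlam hlam0 Y B)).2
  have hsum : (s : ℝ) * #Y ≤ ∑ a ∈ Y, (#(G.neighborFinset a ∩ B) : ℝ) := by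
    rw [mul_comm, ← nsmul_eq_mul]
    refine card_nsmul_le_sum _ _ _ fun a ha => ?_
    have : G.neighborFinset a ∩ Z ⊆ G.neighborFinset a ∩ B := by
      intro v hv
      rw [mem_inter] at hv
      refine mem_inter.2 ⟨hv.1, mem_inter.2 ⟨SimpleGraph.mem_nbhd.2 ⟨a, ha, ?_⟩, hv.2⟩⟩
      simpa using hv.1
    exact_mod_cast (hZ a).trans (card_le_card this)
  have hn : (0 : ℝ) < n := by
    have h1 : #Y ≤ n := by rw [← h.card_eq]; exact card_le_univ _
    exact_mod_cast hY0.trans_le h1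
  have hBc : (#B : ℝ) ≤ K * #Y := by exact_mod_cast hc.le
  have hY0' : (0 : ℝ) < #Y := by exact_mod_cast hY0
  have hY' : (#Y : ℝ) ≤ 2 * m := by exact_mod_cast hY
  have hK' : (1 : ℝ) ≤ K := by exact_mod_cast hK
  have h1 : √((#Y : ℝ) * #B) ≤ K * #Y := by
    refine Real.sqrt_le_iff.2 ⟨by positivity, ?_⟩
    calc (#Y : ℝ) * #B ≤ #Y * (K * #Y) := by gcongr
      _ ≤ (K * #Y) * (K * #Y) := by nlinarith [mul_pos hY0' hY0']
      _ = _ := (sq _).symm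
  have h2 : (d : ℝ) * #Y * #B / n ≤ d * #Y * (K * (2 * m)) / n := by
    have : (#B : ℝ) ≤ K * (2 * m) := hBc.trans (by gcongr)
    gcongr
  have h3 : (s : ℝ) * #Y ≤ d * #Y * (K * (2 * m)) / n + lam * (K * #Y) := by
    have := mul_le_mul_of_nonneg_left h1 hlam0
    linarith
  have h4 : (s : ℝ) * #Y * n ≤ (d * K * (2 * m) + lam * K * n) * #Y := by
    have := mul_le_mul_of_nonneg_right h3 hn.le
    rw [add_mul, div_mul_cancel₀ _ hn.ne'] at this
    linarith
  have h5 := mul_lt_mul_of_pos_right hs hY0'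
  linarith

/-- Double counting of the edges into D. It keeps D large enough to serve as working space. -/
theorem SimpleGraph.IsRegularOfDegree.card_mul_le_of_dominating (hG : G.IsRegularOfDegree d) {s : ℕ}
    (D : Finset V) (hD : ∀ v, s ≤ #(G.neighborFinset v ∩ D)) :
    Fintype.card V * s ≤ d * #D := by
  calc Fintype.card V * s ≤ ∑ v, #(G.neighborFinset v ∩ D) := by
        rw [← card_univ, ← smul_eq_mul]
        exact card_nsmul_le_sum _ _ _ fun v _ => hD v
    _ = ∑ v, #(D.bipartiteAbove G.Adj v) := by
        refine sum_congr rfl fun v _ => congrArg _ ?_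
        ext u; simp [mem_bipartiteAbove, and_comm]
    _ = ∑ u ∈ D, #((univ : Finset V).bipartiteBelow G.Adj u) :=
        sum_card_bipartiteAbove_eq_sum_card_bipartiteBelow _
    _ = ∑ u ∈ D, d := by
        refine sum_congr rfl fun u _ => ?_
        rw [← hG u, ← SimpleGraph.card_neighborFinset_eq_degree]
        congr 1
        ext v; simp [mem_bipartiteBelow, G.adj_comm]
    _ = d * #D := by rw [sum_const, smul_eq_mul, mul_comm]

end

/-! ### Assembly and choice of constants -/

/-- A bounded degree tree is contained in the square of every sufficiently good expander. -/
theorem IsNDLambdaGraph.isContained_graphSquare {V W : Type*} [Fintype V] [DecidableEq V]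
    [Fintype W] {G : SimpleGraph V} [DecidableRel G.Adj] {n d : ℕ} {lam : ℝ}
    (h : IsNDLambdaGraph G n d lam) (hlam : lam < d) (hlam0 : 0 ≤ lam)
    {T : SimpleGraph W} [DecidableRel T.Adj] (hT : T.IsTree) (hW : Fintype.card W = n)
    {Δ μ k m s : ℕ} (hΔ : T.maxDegree ≤ Δ) (hμ : μ = 2 * (Δ + 2) ^ 2)
    (hk : k = μ ^ 4 + (Δ + 1) + 1) (hm : 0 < m) (hjoin : lam * n < d * m)
    (hs : (d : ℝ) * (k + 1 : ℕ) * (2 * m) + lam * (k + 1 : ℕ) * n < s * n)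
    (D : Finset V) (hDs : ∀ v, s ≤ #(G.neighborFinset v ∩ D) ∧ s ≤ #(G.neighborFinset v \ D))
    (hD : 4 * (m + μ ^ 4 * m) + m + 2 * m * k ≤ #D) (hmn : 25 * μ ^ 3 * m ≤ n)
    (hDn : 2 * μ ^ 2 * (2 * #D + m + 8 * m * μ ^ 3) + μ ≤ n) :
    T.IsContained (graphSquare G) := by
  classical
  have hμ2 : 2 ≤ μ := by
    have : 0 < (Δ + 2) ^ 2 := by positivity
    omega
  have hWV : Fintype.card W = Fintype.card V := hW.trans h.card_eq.symm
  obtain ⟨par, root, dp, hpar, hedge⟩ := hT.exists_isRootedTree hΔ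
  obtain ⟨𝓖, h1, h2, h3⟩ := hpar.exists_all_scales (N₀ := 2 * #D + m) hμ (by rw [hW]; exact hmn)
    (by rw [hW]; exact hDn)
  obtain ⟨pt, rk, Λ, sc, Br, hpt, hΛ, hroot, hnear, hcount⟩ := hpar.exists_gadgetFamily 𝓖 h1
  have hj : ∀ A B : Finset V, m ≤ #A → m ≤ #B → ∃ x ∈ A, ∃ y ∈ B, G.Adj x y :=
    h.exists_adj hlam hlam0 hjoin
  have hbig : ∀ Y : Finset V, m < #Y → Fintype.card V ≤ #(G.nbhd Y) + m := by
    intro Y hY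
    by_contra hc
    have h4 := card_compl (G.nbhd Y)
    obtain ⟨x, hx, y, hy, hxy⟩ := hj Y (G.nbhd Y)ᶜ hY.le (by omega)
    exact (mem_compl.1 hy) (SimpleGraph.mem_nbhd.2 ⟨x, hx, hxy⟩)
  have hΛ0 : 2 * #D + m ≤ #{l ∈ Λ | sc l = 0} := h2.trans (hcount 0)
  -- The branching is b = μ ^ 4, matching the rate at which the numbers of gadgets decrease with the
  -- scale.
  obtain ⟨φ, hφ, hadj⟩ := exists_spanning_embedding hpt hk.ge hm
    (show 2 ≤ μ ^ 4 from hμ2.trans (Nat.le_self_pow (by omega) μ)) hj hbig hΛ hWV hD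
    (by
      have := card_le_card (filter_subset (fun l => sc l = 0) Λ)
      omega) (by omega)
    (by
      intro a ha
      have h4 := (h3 a).trans (hcount (a + 1))
      rw [← pow_mul] at ha
      have h5 : m < 2 * (m / μ ^ (4 * a)) * μ ^ (4 * a) := by
        have h6 : 1 ≤ m / μ ^ (4 * a) := (Nat.one_le_div_iff (by positivity)).2 ha.le
        have h7 := Nat.lt_mul_div_succ m (show 0 < μ ^ (4 * a) by positivity)
        nlinarith
      rw [← pow_mul, mul_add, pow_add, mul_one]
      have h8 : 1 ≤ μ ^ 4 := Nat.one_le_pow _ _ (by omega)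
      calc (μ ^ 4 + 1) * m ≤ 2 * μ ^ 4 * m := Nat.mul_le_mul_right _ (by omega)
        _ ≤ 2 * μ ^ 4 * (2 * (m / μ ^ (4 * a)) * μ ^ (4 * a)) := Nat.mul_le_mul_left _ h5.le
        _ = 4 * (m / μ ^ (4 * a)) * (μ ^ (4 * a) * μ ^ 4) := by ring
        _ ≤ _ := Nat.mul_le_mul_right _ h4)
    (by
      intro Y hY
      have h4 := h.card_le_card_nbhd_inter hlam hlam0 (by omega) hs Dᶜ (fun v => by
        have := (hDs v).2
        rwa [sdiff_eq_inter_compl] at this) Y hY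
      rwa [← sdiff_eq_inter_compl] at h4)
    (by
      intro A hA
      have h4 := h.card_le_card_nbhd_inter hlam hlam0 (by omega) hs D (fun v => (hDs v).1) A
        (by omega)
      nlinarith)
  have hsq : ∀ u, u ≠ root → (graphSquare G).Adj (φ u) (φ (par u)) := by
    intro u hu
    have hne : φ u ≠ φ (par u) := fun e => by
      have h5 := hpar.depth u hu
      rw [← hφ e] at h5
      omega
    rcases hnear u hu with h4 | h4 | h4 | h4
    · rw [h4]; exact Or.inl (hadj u hu)
    · by_cases h5 : pt u = root
      · rw [h4, h5, hroot, ← h5]; exact Or.inl (hadj u hu)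
      · refine graphSquare_adj_of_adj_adj (hadj u hu) ?_ hne
        rw [h4]; exact hadj _ h5
    · have h5 : par u ≠ root := fun e => hu (by rw [← h4, e, hroot])
      have h6 := hadj _ h5
      rw [h4] at h6
      exact Or.inl h6.symm
    · have h5 : par u ≠ root := fun e => hu (by rw [← h4, e, hroot, hroot])
      have h6 : pt (par u) ≠ root := fun e => hu (by rw [← h4, e, hroot])
      have h7 := hadj _ h6
      rw [h4] at h7
      exact graphSquare_adj_of_adj_adj h7.symm (hadj _ h5).symm hne
  refine ⟨⟨⟨φ, fun {u v} huv => ?_⟩, hφ⟩⟩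
  rcases hedge u v huv with ⟨h4, rfl⟩ | ⟨h4, rfl⟩
  · exact hsq u h4
  · exact (hsq v h4).symm

/-- The growth condition of `exists_sparse_dominating` holds for large degrees. -/
theorem exists_forall_growth (Q : ℕ) (hQ : 0 < Q) :
    ∃ d₀ : ℕ, ∀ d, d₀ ≤ d → 38 * d * (1.4 : ℝ) ^ (d / Q) ≤ 1.9 ^ (d / Q) := by
  have h1 := tendsto_self_mul_const_pow_of_lt_one (r := (1.4 / 1.9 : ℝ)) (by norm_num) (by norm_num)
  have hε : (0 : ℝ) < 1 / (76 * Q) := by positivity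
  obtain ⟨s₀, hs₀⟩ := Filter.eventually_atTop.1 (h1.eventually_lt_const hε)
  refine ⟨(s₀ + 1) * Q, fun d hd => ?_⟩
  set s := d / Q with hs
  have hs1 : s₀ + 1 ≤ s := (Nat.le_div_iff_mul_le hQ).2 hd
  have hdQ : d ≤ 2 * s * Q := by
    have := Nat.lt_mul_div_succ d hQ
    rw [← hs] at this
    nlinarith
  have hdQ' : (d : ℝ) ≤ 2 * s * Q := by exact_mod_cast hdQ
  have h2 := hs₀ s (by omega)
  rw [div_pow, lt_div_iff₀ (by positivity), mul_div_assoc', div_mul_eq_mul_div,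
    div_lt_iff₀ (by positivity)] at h2
  calc 38 * d * (1.4 : ℝ) ^ s ≤ 38 * (2 * s * Q) * (1.4 : ℝ) ^ s := by gcongr
    _ = s * 1.4 ^ s * (76 * Q) := by ring
    _ ≤ _ := by linarith

theorem theorem1p5 (Δ : ℕ) :
    ∃ C : ℝ, 0 < C ∧ ∃ d₀ : ℕ, ∀ d : ℕ, d₀ ≤ d →
      ∀ (n : ℕ) (lam : ℝ) (V : Type*) [Fintype V] [DecidableEq V]
        (G : SimpleGraph V) [DecidableRel G.Adj],
        IsNDLambdaGraph G n d lam → C ≤ (d : ℝ) / lam →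
        ∀ (W : Type*) [Fintype W] (T : SimpleGraph W) [DecidableRel T.Adj],
          Fintype.card W = n → T.IsTree → T.maxDegree ≤ Δ →
          T.IsContained (graphSquare G) := by
  obtain ⟨μ, hμ⟩ : ∃ μ, μ = 2 * (Δ + 2) ^ 2 := ⟨_, rfl⟩
  obtain ⟨k, hk⟩ : ∃ k, k = μ ^ 4 + (Δ + 1) + 1 := ⟨_, rfl⟩
  -- Chosen so that 2 ^ (j + 1) ≥ 16 * μ ^ 2; after j + 1 halvings D has at most n / (16 * μ ^ 2)
  -- vertices.
  obtain ⟨j, hj⟩ : ∃ j, j = 16 * μ ^ 2 := ⟨_, rfl⟩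
  obtain ⟨Q, hQ⟩ : ∃ Q, Q = 10 ^ (j + 1) := ⟨_, rfl⟩
  -- The summands serve, in order, expansion with factor k + 1, the lower bound on |D|, room for
  -- gadgets of positive scale, and room for those of scale 0.
  obtain ⟨E, hE⟩ : ∃ E, E = 16 * (k + 1) + 2 * (5 + 4 * μ ^ 4 + 2 * k) + 50 * μ ^ 3 +
    4 * (2 * μ ^ 2 * (1 + 8 * μ ^ 3) + μ) := ⟨_, rfl⟩
  have hQ0 : 0 < Q := by rw [hQ]; positivity
  obtain ⟨d₁, hd₁⟩ := exists_forall_growth Q hQ0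
  have hQ0' : (0 : ℝ) < Q := by exact_mod_cast hQ0
  have hE1 : 1 ≤ E := by rw [hE]; omega
  have hE0 : (1 : ℝ) ≤ E := by exact_mod_cast hE1
  -- `γ = 1 / (2 * Q)` and `ε = γ / E`
  refine ⟨4 * Q * E, by positivity, max d₁ (2 * Q * E), ?_⟩
  intro d hd n lam V _ _ G _ h hC W _ T _ hW hT hΔ
  have hdd₁ : d₁ ≤ d := (le_max_left _ _).trans hd
  have hdE : 2 * Q * E ≤ d := (le_max_right _ _).trans hd
  have hdE' : 2 * Q * E ≤ (d : ℝ) := by exact_mod_cast hdE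
  have hd0 : (0 : ℝ) < d := lt_of_lt_of_le (by positivity) hdE'
  have hlam0 : 0 < lam := by
    by_contra hc
    have := div_nonpos_of_nonneg_of_nonpos hd0.le (not_lt.1 hc)
    have : (0 : ℝ) < 4 * Q * E := by positivity
    linarith
  have hClam : 4 * Q * E * lam ≤ d := (le_div_iff₀ hlam0).1 hC
  have hQ1 : (1 : ℝ) ≤ Q := by exact_mod_cast hQ0
  have hQE1 : (1 : ℝ) ≤ Q * E := one_le_mul_of_one_le_of_one_le hQ1 hE0
  have hlam : lam < d := by nlinarith
  -- So n ≥ 2 * Q * E, and rounding up n / (2 * Q * E) at most doubles it.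
  have hdn : d + 1 ≤ n := by
    obtain ⟨w⟩ := hT.connected.nonempty
    have h0 : 0 < Fintype.card V := by
      rw [h.card_eq, ← hW]; exact Fintype.card_pos_iff.2 ⟨w⟩
    obtain ⟨v⟩ := Fintype.card_pos_iff.1 h0
    rw [← h.regular v, ← h.card_eq]
    exact G.degree_lt_card_verts v
  have hn0 : (0 : ℝ) < n := by
    have : 0 < n := by omega
    exact_mod_cast this
  set s := d / Q with hs
  have hsQ : s * Q ≤ d := Nat.div_mul_le_self d Q
  have hs1 : (d : ℝ) ≤ 2 * s * Q := by
    have h1 := Nat.lt_mul_div_succ d hQ0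
    rw [← hs] at h1
    have h2 : 1 ≤ s := (Nat.le_div_iff_mul_le hQ0).2 (by nlinarith)
    have : d ≤ 2 * s * Q := by nlinarith
    exact_mod_cast this
  have hs0 : 0 < s := by
    by_contra h0
    have : s = 0 := Nat.eq_zero_of_not_pos h0
    rw [this, Nat.cast_zero, mul_zero, zero_mul] at hs1
    linarith
  obtain ⟨D, hDc, hDs⟩ := exists_sparse_dominating G d h.regular s hs0 (hd₁ d hdd₁) j (by
    rw [← hQ, mul_comm]; exact hsQ)
  rw [h.card_eq] at hDc
  -- `m` is about `ε * n`
  set m := ⌈(n : ℝ) / (2 * Q * E)⌉₊ with hm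
  have hm1 : (n : ℝ) ≤ 2 * Q * E * m := by
    have := Nat.le_ceil ((n : ℝ) / (2 * Q * E))
    rwa [← hm, div_le_iff₀ (by positivity), mul_comm] at this
  have hm2 : Q * E * m ≤ (n : ℝ) := by
    have h1 := Nat.ceil_lt_add_one (show 0 ≤ (n : ℝ) / (2 * Q * E) by positivity)
    rw [← hm] at h1
    have h2 : (1 : ℝ) ≤ n / (2 * Q * E) := by
      rw [le_div_iff₀ (by positivity), one_mul]
      have : (d : ℝ) ≤ n := by exact_mod_cast (by omega : d ≤ n)
      linarith
    have h3 : (m : ℝ) ≤ 2 * (n / (2 * Q * E)) := by linarith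
    calc Q * E * (m : ℝ) ≤ Q * E * (2 * (n / (2 * Q * E))) := by gcongr
      _ = n := by field_simp
  have hm0 : 0 < m := by
    by_contra h0
    have : m = 0 := by omega
    rw [this, Nat.cast_zero, mul_zero] at hm1
    linarith
  have hm2' : Q * E * m ≤ n := by exact_mod_cast hm2
  have hEm : E * m ≤ n := le_trans (by
    rw [mul_assoc]; exact Nat.le_mul_of_pos_left _ hQ0) hm2'
  have hjoin : lam * n < d * m := by
    have hm0' : (0 : ℝ) < m := by exact_mod_cast hm0
    calc lam * n ≤ lam * (2 * Q * E * m) := by gcongr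
      _ = 4 * Q * E * lam * m / 2 := by ring
      _ ≤ d * m / 2 := by gcongr
      _ < d * m := by linarith [mul_pos hd0 hm0']
  have hEk : (16 * (k + 1 : ℕ) : ℝ) ≤ E := by
    have : 16 * (k + 1) ≤ E := by rw [hE]; omega
    exact_mod_cast this
  have hexp : (d : ℝ) * (k + 1 : ℕ) * (2 * m) + lam * (k + 1 : ℕ) * n < s * n := by
    set K : ℝ := ((k + 1 : ℕ) : ℝ) with hKdef
    have hK0 : 0 ≤ K := Nat.cast_nonneg _
    have h1 : Q * (d * K * (2 * m)) * 8 ≤ d * n := by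
      calc Q * (d * K * (2 * m)) * 8 = d * (Q * (16 * K) * m) := by ring
        _ ≤ d * (Q * E * m) := by gcongr
        _ ≤ d * n := by gcongr
    have h2 : Q * (lam * K * n) * 64 ≤ d * n := by
      calc Q * (lam * K * n) * 64 = 4 * Q * (16 * K) * lam * n := by ring
        _ ≤ 4 * Q * E * lam * n := by gcongr
        _ ≤ d * n := by gcongr
    have h3 : d * n ≤ 2 * s * Q * (n : ℝ) := by gcongr
    have h4 : (0 : ℝ) < d * n := by positivity
    refine lt_of_mul_lt_mul_left (a := (Q : ℝ)) ?_ hQ0'.le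
    linarith
  -- Domination gives |D| ≥ n * s / d ≥ n / (2 * Q), whereas m ≤ n / (Q * E).
  have hDlow : (5 + 4 * μ ^ 4 + 2 * k) * m ≤ #D := by
    have h1 := h.regular.card_mul_le_of_dominating D fun v => (hDs v).1
    rw [h.card_eq] at h1
    have h1' : (n : ℝ) * s ≤ d * #D := by exact_mod_cast h1
    have hE2 : (2 * (5 + 4 * μ ^ 4 + 2 * k : ℕ) : ℝ) ≤ E := by
      have : 2 * (5 + 4 * μ ^ 4 + 2 * k) ≤ E := by rw [hE]; omega
      exact_mod_cast this
    have h2 : d * (((5 + 4 * μ ^ 4 + 2 * k : ℕ) : ℝ) * m) ≤ d * #D := by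
      set R : ℝ := ((5 + 4 * μ ^ 4 + 2 * k : ℕ) : ℝ)
      have h3 : 2 * (d * (R * m)) ≤ 2 * (n * s) := by
        calc 2 * (d * (R * m)) ≤ 2 * (2 * s * Q * (R * m)) := by gcongr
          _ = 2 * s * (Q * (2 * R) * m) := by ring
          _ ≤ 2 * s * (Q * E * m) := by gcongr
          _ ≤ 2 * s * n := by gcongr
          _ = 2 * (n * s) := by ring
      linarith
    exact_mod_cast le_of_mul_le_mul_left h2 hd0
  have hDup : 16 * μ ^ 2 * #D ≤ n := by
    refine le_trans (Nat.mul_le_mul_right _ ?_) hDc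
    rw [← hj]
    exact (Nat.lt_two_pow_self.le).trans (Nat.pow_le_pow_right (by omega) (by omega))
  refine h.isContained_graphSquare hlam hlam0.le hT hW hΔ hμ hk hm0 hjoin hexp D hDs ?_ ?_ ?_
  · calc 4 * (m + μ ^ 4 * m) + m + 2 * m * k = (5 + 4 * μ ^ 4 + 2 * k) * m := by ring
      _ ≤ _ := hDlow
  · refine le_trans (Nat.mul_le_mul_right _ ?_) hEm
    rw [hE]; omega
  · have h1 : 4 * (2 * μ ^ 2 * (1 + 8 * μ ^ 3) + μ) * m ≤ n := by
      refine le_trans (Nat.mul_le_mul_right _ ?_) hEm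
      rw [hE]; omega
    have h2 : μ ≤ μ * m := Nat.le_mul_of_pos_right _ hm0
    linarith
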